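/- **Setting.** Let $0<\alpha\le 2$, $d\ge 1$, and let $\{\xi_i\}_{i\in\mathbb Z^d}$ be i.i.d. real random variables with $\mathbb E\xi_0^2=\infty$, in the domain of attraction of an $\alpha$-stable law, in the following sense. If $\alpha<2$: $\mathbb P(|\xi_0|>x)\sim x^{-\alpha}L_1(x)$ as $x\to\infty$ with $L_1$ slowly varying at infinity, and $\mathbb P(\xi_0>x)/\mathbb P(|\xi_0|>x)\to c^+$, $\mathbb P(\xi_0<-x)/\mathbb P(|\xi_0|>x)\to c^-$ (so $c^++c^-=1$). If $\alpha=2$: $x\mapsto \mathbb E(\xi_0^2 1_{\{|\xi_0|\le x\}})$ is slowly varying at infinity. Assume Condition A: $\mathbb E\xi_0=0$ if $1<\alpha\le2$, and $\xi_0$ is symmetric if $\alpha=1$. Assume also that $\xi_0$ is non-lattice, i.e. its law is not concentrated on any set $a+h\mathbb Z$ with $a\in\mathbb R$, $h>0$. Put $\kappa_\alpha=(2-\alpha)/\alpha$ if $\alpha<2$, $\kappa_2=1$, and $b=\inf\{x\ge1:\mathbb E(\xi_0^21_{\{|\xi_0|\le x\}})>1\}$. Let $L(x)=\kappa_\alpha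 x^{\alpha-2}\,\mathbb E(\xi_0^21_{\{|\xi_0|\le x\}})$ for $x\ge b$ and $L(x)=L(b)$ for $0<x<b$; by convention $|x|^\alpha L(1/|x|)=0$ for $x=0$. Let $\{a_i\}_{i\in\mathbb Z^d}$ be real numbers with $\sum_i|a_i|<\infty$ and $\sum_i|a_i|^\alpha L(1/|a_i|)<\infty$. Let $X_j=\sum_{i\in\mathbb Z^d}a_i\xi_{j-i}$ (almost surely convergent in every order of summation). For arbitrary finite sets $\Gamma_n\subset\mathbb Z^d$ put $S_n=\sum_{j\in\Gamma_n}X_j$, $b_{ni}=\sum_{j\in\Gamma_n}a_{j-i}$ and $$B_n=\inf\Big\{x\ge1:\ \sum_{i\in\mathbb Z^d}(|b_{ni}|/x)^\alpha L(x/|b_{ni}|)\le1\Big\},$$ and assume $B_n\to\infty$ as $n\to\infty$. Let $G$ be the $\alpha$-stable law with characteristic function $\exp\{-c_\alpha|t|^\alpha(1-\mathrm i\beta\tau(\alpha,t))\}$, where $\beta=c^+-c^-$ (irrelevant if $\alpha=2$), $\tau(\alpha,t)=\operatorname{sgn}(t)\tan(\pi\alpha/2)$ if $\alpha\ne1$,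 $\tau(1,t)=0$, and $c_\alpha=\Gamma(1-\alpha)\cos(\pi\alpha/2)$ if $\alpha\ne1,2$, $c_1=\pi/2$, $c_2=1/2$. **Theorem (local limit theorem, summable coefficients).** The law $G$ exists, and for a law $\mathcal L$ on $\mathbb R$ with continuous density $f_{\mathcal L}$ consider the assertion that for every continuous $m:\mathbb R\to\mathbb R$ with compact support $$\lim_{n\to\infty}\ \sup_{u\in\mathbb R}\Big|B_n\,\mathbb E\,m(S_n+u)-f_{\mathcal L}\Big(-\frac u{B_n}\Big)\int_{\mathbb R} m(t)\,dt\Big|=0.\qquad(*)$$ 1. Let $c_{ni}=b_{ni}/B_n$ and suppose that for some $0\le c\le1$, as $n\to\infty$, $\sum_{i:\,c_{ni}>0}|c_{ni}|^\alpha L(1/|c_{ni}|)\to c$ and $\sum_{i:\,c_{ni}<0}|c_{ni}|^\alpha L(1/|c_{ni}|)\to1-c$. Then the law $\mathcal L$ of $c^{1/\alpha}S'-(1-c)^{1/\alpha}S''$, where $S',S''$ are independent with law $G$, has a continuous density and $(*)$ holds. 2. Suppose that $\xi_0$ is symmetric, or that $a_i\ge0$ for all $i$. Then $\mathcal L=G$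 has a continuous density and $(*)$ holds. No restriction on the shape of the sets $\Gamma_n$ is needed. -/

import Mathlib

open MeasureTheory ProbabilityTheory Filter Topology

noncomputable section

namespace LinearRandomField

/-- Slow variation at infinity (in the sense of Karamata). -/
def SlowlyVarying (ℓ : ℝ → ℝ) : Prop :=
  Measurable ℓ ∧ (∀ᶠ x in atTop, 0 < ℓ x) ∧
    ∀ r : ℝ, 0 < r → Tendsto (fun x => ℓ (r * x) / ℓ x) atTop (𝓝 1)

/-- The truncated second moment `E (ξ² 1_{|ξ| ≤ x})` of a random variable `ξ` with law `μ`. -/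
def truncSecondMoment (μ : Measure ℝ) (x : ℝ) : ℝ :=
  ∫ y in {y : ℝ | |y| ≤ x}, y ^ 2 ∂μ

/-- The law `μ` has infinite second moment and is in the domain of attraction of an `α`-stable law.
For `α < 2`: the tail of `|ξ|` is regularly varying of index `-α`, and the right and left tails have
the asymptotic proportions `cp` and `cm`; the limits force `0 ≤ cp`, `0 ≤ cm` and `cp + cm = 1`.
For `α = 2`: the truncated second moment is slowly varying (this holds in particular when the second
moment is infinite and `x ^ 2 * P(|ξ| > x)` is asymptotic to a slowly varying function), and `cp`,
`cm` play no role. -/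
structure InDomainOfAttraction (μ : Measure ℝ) (α cp cm : ℝ) : Prop where
  infinite_second_moment : ∫⁻ y, ENNReal.ofReal (y ^ 2) ∂μ = ⊤
  tail : α < 2 → ∃ L₁ : ℝ → ℝ, SlowlyVarying L₁ ∧
    Tendsto (fun x : ℝ => μ.real {y | x < |y|} / (x ^ (-α) * L₁ x)) atTop (𝓝 1)
  right_tail : α < 2 →
    Tendsto (fun x : ℝ => μ.real {y | x < y} / μ.real {y | x < |y|}) atTop (𝓝 cp)
  left_tail : α < 2 →
    Tendsto (fun x : ℝ => μ.real {y | y < -x} / μ.real {y | x < |y|}) atTop (𝓝 cm)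
  gaussian : α = 2 → SlowlyVarying (truncSecondMoment μ)

/-- `ξ` and `-ξ` have the same law. -/
def IsSymmetric (μ : Measure ℝ) : Prop := μ.map (fun y => -y) = μ

/-- Condition A: the innovations are centred if `1 < α ≤ 2` and symmetric if `α = 1`. -/
def ConditionA (μ : Measure ℝ) (α : ℝ) : Prop :=
  (1 < α → ∫ y, y ∂μ = 0) ∧ (α = 1 → IsSymmetric μ)

/-- The law is not concentrated on any arithmetic progression `a + h ℤ`. -/
def IsNonLattice (μ : Measure ℝ) : Prop :=
  ¬ ∃ a h : ℝ, 0 < h ∧ ∀ᵐ y ∂μ, ∃ k : ℤ, y = a + k * h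

/-- `b = inf {x ≥ 1 : E (ξ² 1_{|ξ| ≤ x}) > 1}`. -/
def cutoff (μ : Measure ℝ) : ℝ := sInf {x : ℝ | 1 ≤ x ∧ 1 < truncSecondMoment μ x}

/-- The slowly varying function `L`: for `x ≥ b` it is
`((2 - α) / α) x ^ (α - 2) E (ξ² 1_{|ξ| ≤ x})` if `α < 2`, and `E (ξ² 1_{|ξ| ≤ x})` if `α = 2`;
on `(0, b)` it is constant, equal to its value at `b`. -/
def L (μ : Measure ℝ) (α x : ℝ) : ℝ :=
  (if α = 2 then 1 else (2 - α) / α) *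
    (max x (cutoff μ)) ^ (α - 2) * truncSecondMoment μ (max x (cutoff μ))

/-- `|y| ^ α L(1 / |y|)`; it vanishes at `y = 0`, since `0 ^ α = 0` for `α > 0`. -/
def weight (μ : Measure ℝ) (α y : ℝ) : ℝ := |y| ^ α * L μ α (1 / |y|)

/-- `∑ᵢ |cᵢ| ^ α L(1 / |cᵢ|)` over the indices with `cᵢ > 0`. -/
def posWeight {ι : Type*} (μ : Measure ℝ) (α : ℝ) (c : ι → ℝ) : ℝ :=
  ∑' i : {i // 0 < c i}, weight μ α (c i)

/-- `∑ᵢ |cᵢ| ^ α L(1 / |cᵢ|)` over the indices with `cᵢ < 0`. -/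
def negWeight {ι : Type*} (μ : Measure ℝ) (α : ℝ) (c : ι → ℝ) : ℝ :=
  ∑' i : {i // c i < 0}, weight μ α (c i)

/-- The normalizer `inf {x ≥ 1 : ∑ᵢ (|bᵢ| / x) ^ α L(x / |bᵢ|) ≤ 1}`. -/
def normalizer {ι : Type*} (μ : Measure ℝ) (α : ℝ) (b : ι → ℝ) : ℝ :=
  sInf {x : ℝ | 1 ≤ x ∧ Summable (fun i => weight μ α (b i / x)) ∧
    ∑' i, weight μ α (b i / x) ≤ 1}

/-- `X` is the linear random field `X_j = ∑ᵢ aᵢ ξ_{j-i}`: the series converges almost surely to `X_j`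
in whatever order its terms are enumerated. The convergence need not be absolute. -/
def IsLinearField {Ω : Type*} [MeasurableSpace Ω] (P : Measure Ω) {d : ℕ}
    (a : (Fin d → ℤ) → ℝ) (ξ X : (Fin d → ℤ) → Ω → ℝ) : Prop :=
  ∀ (j : Fin d → ℤ) (e : ℕ ≃ (Fin d → ℤ)), ∀ᵐ ω ∂P,
    Tendsto (fun N => ∑ k ∈ Finset.range N, a (e k) * ξ (j - e k) ω) atTop (𝓝 (X j ω))

/-- The coefficients `b_i = ∑_{j ∈ Γ} a_{j-i}` of `∑_{j ∈ Γ} X_j` as a series in the innovations. -/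
def sumCoeff {d : ℕ} (a : (Fin d → ℤ) → ℝ) (Γ : Finset (Fin d → ℤ)) (i : Fin d → ℤ) : ℝ :=
  ∑ j ∈ Γ, a (j - i)

/-- The partial sum `∑_{j ∈ Γ} X_j`. -/
def partialSum {Ω : Type*} {d : ℕ} (X : (Fin d → ℤ) → Ω → ℝ) (Γ : Finset (Fin d → ℤ)) (ω : Ω) : ℝ :=
  ∑ j ∈ Γ, X j ω

/-- The constant `c_α` for which, as `t → 0`, the innovations satisfy
`1 - φ_ξ(t) ∼ c_α |t| ^ α L(1 / |t|) (1 - i β τ(α, t))`. -/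
def stableConst (α : ℝ) : ℝ :=
  if α = 2 then 1 / 2
  else if α = 1 then Real.pi / 2
  else Real.Gamma (1 - α) * Real.cos (Real.pi * α / 2)

/-- `τ(α, t) = sgn t tan(π α / 2)` if `α ≠ 1`, and `0` if `α = 1`. -/
def tau (α t : ℝ) : ℝ := if α = 1 then 0 else Real.sign t * Real.tan (Real.pi * α / 2)

/-- The characteristic function `exp (-c_α |t| ^ α (1 - i β τ(α, t)))` of the stable law. -/
def stableCharFun (α β t : ℝ) : ℂ :=
  Complex.exp (-((stableConst α * |t| ^ α : ℝ) : ℂ) * (1 - Complex.I * ((β * tau α t : ℝ) : ℂ)))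

/-- The law of `c ^ (1 / α) S' - (1 - c) ^ (1 / α) S''`, with `S'`, `S''` independent of law `G`. -/
def mixedLaw (G : Measure ℝ) (α c : ℝ) : Measure ℝ :=
  (G.prod G).map (fun p : ℝ × ℝ => c ^ (1 / α) * p.1 - (1 - c) ^ (1 / α) * p.2)

/-- The local limit theorem for `S n` with normalizer `B n` and limit law `ν`: the law `ν` has a
continuous density `f` and, for every continuous `m` with compact support,
`B n * E m(S n + u) - f(-u / B n) ∫ m` tends to `0` uniformly in `u ∈ ℝ`. -/
def LocalLimit {Ω : Type*} [MeasurableSpace Ω] (P : Measure Ω) (B : ℕ → ℝ) (S : ℕ → Ω → ℝ)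
    (ν : Measure ℝ) : Prop :=
  ∃ f : ℝ → ℝ, Continuous f ∧ (∀ x, 0 ≤ f x) ∧
    ν = volume.withDensity (fun x => ENNReal.ofReal (f x)) ∧
    ∀ m : ℝ → ℝ, Continuous m → HasCompactSupport m →
      TendstoUniformly
        (fun n u => B n * (∫ ω, m (S n ω + u) ∂P) - f (-(u / B n)) * ∫ x, m x)
        (fun _ => 0) atTop

end LinearRandomField

end

open LinearRandomField

namespace LinearRandomField

/-! This is the Fourier proof of a Gnedenko–Stone local limit theorem. Write `w(s) = |s|^α L(1/|s|)`
(`weight`), `φ` for the characteristic function of an innovation, and `c_{ni} = b_{ni}/B_n`.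
Everything about the innovations enters through `1 - φ(s) ∼ c_α (1 - iβτ) w(s)` as `s ↓ 0`
(`tendsto_charFun_weight`) and the regular variation of `w` at `0` with index `α`. For `α < 2` the
expansion comes from Fubini and Potter bounds applied to the tail; for `α = 2` from Taylor expansion
and slow variation of the truncated second moment.

The normalizer forces `∑ w(c_{ni}) → 1` (`tendsto_tsum_weight`). Summability of `a` gives `|b_{ni}|
≤ ∑ |a_i|`, so `c_{ni} → 0` uniformly in `i`, whatever the shape of the regions. The characteristic
function of `S_n/B_n` is a limit of finite products of factors `φ(c_{ni} t)`. Two facts follow.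
Replacing each factor by `exp(w(c_{ni}) E(±t))`, where `E` is the stable exponent and the sign is
that of `c_{ni}`, costs at most `ε ∑ w(c_{ni})`, which gives pointwise convergence
(`tendsto_charFun_partialSum`). And a factor is at most `exp(-C |t|^(α/2) w(c_{ni}))` for `|t| ≥ 1`
as long as `c_{ni} t` stays bounded (`exists_norm_charFun_mul_le`; non-latticeness enters here),
which gives an integrable majorant on each range `|t| ≤ K B_n`
(`exists_integrable_bound_charFun_partialSum`).

The passage to expectations is `tendstoUniformly_of_charFun`. For a Fejér kernel, whose Fourier
transform has compact support, `B_n E K(S_n + u)` is an integral of the characteristic function over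
`|t| ≤ T B_n`, and it converges uniformly in `u` by dominated convergence. A general test function
is replaced by its Fejér mean; since the error is multiplied by `B_n`, a small uniform error is not
enough, and it is instead dominated by a small multiple of two translates of the Fejér kernel
(`eventually_abs_sub_fejerMean_le_fejer`), whose expectations times `B_n` are bounded.

The law `G` is obtained as a limit of normalized i.i.d. sums of innovations (`exists_stableLaw`),
and the limit laws have continuous densities because their characteristic functions are integrable
(`eq_withDensity_charInv`). -/

/-! ### The Fejér kernel and its Fourier transform -/

/-- The triangle function `max 0 (1 - |s|)`. -/
noncomputable def tri (s : ℝ) : ℝ := max 0 (1 - |s|)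

/-- The Fejér kernel, the Fourier transform of the triangle function. -/
noncomputable def fejer (x : ℝ) : ℝ := Real.sinc (x / 2) ^ 2

lemma continuous_tri : Continuous tri := by unfold tri; fun_prop

lemma tri_nonneg (s : ℝ) : 0 ≤ tri s := le_max_left _ _

lemma tri_le_one (s : ℝ) : tri s ≤ 1 := by
  unfold tri; exact max_le (by norm_num) (by linarith [abs_nonneg s])

lemma tri_zero : tri 0 = 1 := by simp [tri]

lemma tri_eq_zero {s : ℝ} (h : 1 ≤ |s|) : tri s = 0 := by
  unfold tri; exact max_eq_left (by linarith)

lemma hasCompactSupport_tri : HasCompactSupport tri := by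
  refine HasCompactSupport.intro (K := Set.Icc (-1) 1) isCompact_Icc fun x hx => tri_eq_zero ?_
  by_contra h
  exact hx (abs_le.1 (not_le.1 h).le)

lemma integrable_tri : Integrable tri := continuous_tri.integrable_of_hasCompactSupport
  hasCompactSupport_tri

lemma continuous_fejer : Continuous fejer := by
  unfold fejer; exact (Real.continuous_sinc.comp (by fun_prop)).pow 2

lemma fejer_nonneg (x : ℝ) : 0 ≤ fejer x := sq_nonneg _

lemma fejer_of_ne_zero {x : ℝ} (hx : x ≠ 0) : fejer x = 2 * (1 - Real.cos x) / x ^ 2 := by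
  have h : Real.cos x = 1 - 2 * Real.sin (x / 2) ^ 2 := by
    have := Real.cos_sq' (x / 2)
    have h2 := Real.cos_two_mul (x / 2)
    rw [show 2 * (x / 2) = x by ring] at h2
    linarith
  rw [fejer, Real.sinc_of_ne_zero (by positivity), h]
  field_simp
  ring

lemma fejer_le_one (x : ℝ) : fejer x ≤ 1 := by
  unfold fejer
  rw [sq_le_one_iff_abs_le_one]
  exact Real.abs_sinc_le_one _

lemma fejer_mul_sq (x : ℝ) : fejer x * x ^ 2 = 2 * (1 - Real.cos x) := by
  rcases eq_or_ne x 0 with rfl | hx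
  · simp
  · rw [fejer_of_ne_zero hx]; field_simp

lemma fejer_mul_sq_le (x : ℝ) : fejer x * x ^ 2 ≤ 4 := by
  rw [fejer_mul_sq]; linarith [Real.neg_one_le_cos x]

lemma fejer_le (x : ℝ) : fejer x ≤ 5 * (1 + x ^ 2)⁻¹ := by
  rw [← div_eq_mul_inv, le_div_iff₀ (by positivity)]
  linarith [fejer_mul_sq_le x, fejer_le_one x]

lemma integrable_fejer : Integrable fejer :=
  (integrable_inv_one_add_sq.const_mul 5).mono' continuous_fejer.aestronglyMeasurable
    (ae_of_all _ fun x => by rw [Real.norm_of_nonneg (fejer_nonneg x)]; exact fejer_le x)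

lemma fejer_neg (x : ℝ) : fejer (-x) = fejer x := by
  unfold fejer; rw [neg_div, Real.sinc_neg]

lemma integral_tri_mul_cos {x : ℝ} :
    ∫ s in (0 : ℝ)..1, (1 - s) * (2 * Real.cos (s * x)) = fejer x := by
  rcases eq_or_ne x 0 with rfl | hx
  · have : ∫ s in (0 : ℝ)..1, (1 - s) = 1 / 2 := by
      rw [intervalIntegral.integral_sub (by simp) (by simp)]
      norm_num
    simp [fejer, this]
  · rw [intervalIntegral.integral_eq_sub_of_hasDerivAt
      (f := fun s => 2 * ((1 - s) * (Real.sin (s * x) / x) - Real.cos (s * x) / x ^ 2))]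
    · rw [fejer_of_ne_zero hx]; simp; field_simp; ring
    · intro s _
      have h0 : HasDerivAt (fun s : ℝ => s * x) x s := by simpa using (hasDerivAt_id s).mul_const x
      have h1 := ((h0.sin).div_const x)
      have h2 := ((h0.cos).div_const (x ^ 2))
      have h3 : HasDerivAt (fun s : ℝ => 1 - s) (-1) s := by
        simpa using (hasDerivAt_id s).const_sub 1
      refine (((h3.mul h1).sub h2).const_mul 2).congr_deriv ?_
      field_simp
      ring
    · exact (by fun_prop : Continuous fun s : ℝ => (1 - s) * (2 * Real.cos (s * x))).intervalIntegrable _ _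

lemma integral_tri_mul_cexp (x : ℝ) :
    ∫ s, (tri s : ℂ) * Complex.exp (s * x * Complex.I) = fejer x := by
  have hc : Continuous fun s : ℝ => (tri s : ℂ) * Complex.exp (s * x * Complex.I) := by
    have := continuous_tri
    fun_prop
  have h1 : ∫ s, (tri s : ℂ) * Complex.exp (s * x * Complex.I) =
      ∫ s in (-1 : ℝ)..1, (tri s : ℂ) * Complex.exp (s * x * Complex.I) := by
    rw [intervalIntegral.integral_of_le (by norm_num), ← integral_Icc_eq_integral_Ioc,
      setIntegral_eq_integral_of_forall_compl_eq_zero]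
    intro s hs
    rw [tri_eq_zero, Complex.ofReal_zero, zero_mul]
    by_contra h
    exact hs (abs_le.1 (not_le.1 h).le)
  rw [h1, ← intervalIntegral.integral_add_adjacent_intervals (b := 0)
    (hc.intervalIntegrable _ _) (hc.intervalIntegrable _ _)]
  have h2 : ∫ s in (-1 : ℝ)..0, (tri s : ℂ) * Complex.exp (s * x * Complex.I) =
      ∫ s in (0 : ℝ)..1, (tri s : ℂ) * Complex.exp (-s * x * Complex.I) := by
    have := intervalIntegral.integral_comp_neg (a := 0) (b := 1)
      (fun s : ℝ => (tri s : ℂ) * Complex.exp (s * x * Complex.I))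
    simp only [neg_zero] at this
    rw [← this]
    refine intervalIntegral.integral_congr fun s _ => ?_
    simp [tri]
  have hc' : Continuous fun s : ℝ => (tri s : ℂ) * Complex.exp (-s * x * Complex.I) := by
    have := continuous_tri
    fun_prop
  rw [h2, ← intervalIntegral.integral_add (hc'.intervalIntegrable _ _) (hc.intervalIntegrable _ _),
    ← integral_tri_mul_cos, ← intervalIntegral.integral_ofReal]
  refine intervalIntegral.integral_congr fun s hs => ?_
  rw [Set.uIcc_of_le (by norm_num)] at hs
  have : tri s = 1 - s := by
    unfold tri; rw [abs_of_nonneg hs.1, max_eq_right (by linarith [hs.2])]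
  simp only [this]
  push_cast
  rw [Complex.cos]
  ring_nf

lemma integral_tri_div_mul_cexp {R : ℝ} (hR : 0 < R) (y : ℝ) :
    ∫ t, (tri (t / R) : ℂ) * Complex.exp (t * y * Complex.I) = (R * fejer (R * y) : ℝ) := by
  have h := Measure.integral_comp_mul_left
    (fun s : ℝ => (tri s : ℂ) * Complex.exp (s * (R * y : ℝ) * Complex.I)) R⁻¹
  rw [integral_tri_mul_cexp, inv_inv, abs_of_pos hR] at h
  rw [Complex.ofReal_mul, ← Complex.real_smul, ← h]
  refine integral_congr_ae (ae_of_all _ fun t => ?_)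
  simp only
  rw [div_eq_inv_mul]
  congr 2
  push_cast
  have : (R : ℂ) ≠ 0 := by exact_mod_cast hR.ne'
  field_simp

/-- Fourier inversion for the triangle function, evaluated at `0`, where the triangle equals `1`. -/
lemma integral_fejer : ∫ x, fejer x = 2 * Real.pi := by
  have hF : ∀ w : ℝ, FourierTransform.fourier (fun s : ℝ => (tri s : ℂ)) w =
      fejer (2 * Real.pi * w) := by
    intro w
    rw [Real.fourier_eq', ← fejer_neg, ← integral_tri_mul_cexp]
    refine integral_congr_ae (ae_of_all _ fun t => ?_)
    simp only [smul_eq_mul]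
    rw [mul_comm]
    congr 2
    simp
    ring
  have hint : Integrable (FourierTransform.fourier (fun s : ℝ => (tri s : ℂ))) := by
    rw [funext hF]
    exact (integrable_fejer.comp_mul_left' (by positivity)).ofReal
  have hc : Continuous fun s : ℝ => (tri s : ℂ) := by
    have := continuous_tri
    fun_prop
  have := congrFun (hc.fourierInv_fourier_eq integrable_tri.ofReal hint) 0
  rw [Real.fourierInv_eq', funext hF] at this
  simp only [inner_zero_right, mul_zero, Complex.ofReal_zero, zero_mul, Complex.exp_zero, one_smul,
    tri_zero] at this
  rw [integral_complex_ofReal, Measure.integral_comp_mul_left, abs_of_pos (by positivity)] at this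
  have h2 : (2 * Real.pi)⁻¹ • ∫ x, fejer x = 1 := by exact_mod_cast this
  rw [smul_eq_mul] at h2
  field_simp at h2
  linarith

/-! ### The inversion integral and Fejér smoothings of a law -/

/-- The candidate for the density of a law with integrable characteristic function `ψ`. -/
noncomputable def charInv (ψ : ℝ → ℂ) (x : ℝ) : ℝ :=
  (2 * Real.pi)⁻¹ * (∫ t, ψ t * Complex.exp (-(t * x) * Complex.I)).re

lemma norm_cexp_mul_I (t x : ℝ) : ‖Complex.exp (t * x * Complex.I)‖ = 1 := by
  rw [← Complex.ofReal_mul, Complex.norm_exp_ofReal_mul_I]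

lemma norm_cexp_neg_mul_I (t x : ℝ) : ‖Complex.exp (-(t * x) * Complex.I)‖ = 1 := by
  rw [← Complex.ofReal_mul, ← Complex.ofReal_neg, Complex.norm_exp_ofReal_mul_I]

/-- Fubini. The right side only sees the characteristic function on `[-R, R]`, so domination on a
bounded frequency range is all that the local limit theorem needs. -/
lemma integral_fejer_charFun (ν : Measure ℝ) [IsProbabilityMeasure ν] {R : ℝ} (hR : 0 < R) (v : ℝ) :
    ((R * ∫ x, fejer (R * (x + v)) ∂ν : ℝ) : ℂ) =
      ∫ t, (tri (t / R) : ℂ) * charFun ν t * Complex.exp (t * v * Complex.I) := by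
  have htri := continuous_tri
  have hint : Integrable (Function.uncurry fun (x t : ℝ) =>
      (tri (t / R) : ℂ) * Complex.exp (t * (x + v : ℝ) * Complex.I)) (ν.prod volume) := by
    have h1 : Integrable (fun t => tri (t / R)) := integrable_tri.comp_div hR.ne'
    refine (h1.comp_snd ν).mono' ?_ (ae_of_all _ fun p => ?_)
    · exact (by fun_prop : Continuous (Function.uncurry fun (x t : ℝ) =>
        (tri (t / R) : ℂ) * Complex.exp (t * (x + v : ℝ) * Complex.I))).aestronglyMeasurable
    · simp only [Function.uncurry]
      rw [norm_mul, norm_cexp_mul_I, mul_one, Complex.norm_real, Real.norm_of_nonneg (tri_nonneg _)]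
  rw [← integral_const_mul, ← integral_complex_ofReal]
  simp_rw [← integral_tri_div_mul_cexp hR]
  rw [integral_integral_swap hint]
  refine integral_congr_ae (ae_of_all _ fun t => ?_)
  simp only
  rw [integral_const_mul, charFun_apply_real, mul_assoc, ← integral_mul_const]
  congr 2
  ext x
  rw [← Complex.exp_add]
  push_cast
  ring_nf

/-- The error is at most the `L¹` norm of `tri (t / R n) * charFun (ν n) t - ψ t`, which does not
involve `v`: dominated convergence therefore gives uniformity in `v` for free. Outside `[-R n, R n]`
the triangle vanishes, so `g` need not dominate there. -/
lemma eventually_abs_fejer_sub_charInv_le {ι : Type*} {l : Filter ι} [l.IsCountablyGenerated]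
    {ν : ι → Measure ℝ} [∀ n, IsProbabilityMeasure (ν n)] {R : ι → ℝ} (hR : Tendsto R l atTop)
    {ψ : ℝ → ℂ} (hψ : Integrable ψ) {g : ℝ → ℝ} (hg : Integrable g)
    (hdom : ∀ᶠ n in l, ∀ t, |t| ≤ R n → ‖charFun (ν n) t‖ ≤ g t)
    (hlim : ∀ t, Tendsto (fun n => charFun (ν n) t) l (𝓝 (ψ t))) {ε : ℝ} (hε : 0 < ε) :
    ∀ᶠ n in l, ∀ v, |R n * ∫ x, fejer (R n * (x + v)) ∂ν n - 2 * Real.pi * charInv ψ (-v)| ≤ ε := by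
  have htri := continuous_tri
  have hmeas : ∀ n, AEStronglyMeasurable (fun t => (tri (t / R n) : ℂ) * charFun (ν n) t) := by
    intro n
    have := measurable_charFun (μ := ν n)
    have h2 : Measurable fun t => (tri (t / R n) : ℂ) := by
      exact (by fun_prop : Continuous fun t => (tri (t / R n) : ℂ)).measurable
    exact (h2.mul this).aestronglyMeasurable
  have hbd : ∀ᶠ n in l, ∀ t, ‖(tri (t / R n) : ℂ) * charFun (ν n) t‖ ≤ |g t| := by
    filter_upwards [hdom, hR.eventually_gt_atTop 0] with n hn hRn t
    rw [norm_mul, Complex.norm_real, Real.norm_of_nonneg (tri_nonneg _)]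
    by_cases h : |t| ≤ R n
    · calc _ ≤ 1 * g t := by
            gcongr
            · exact tri_le_one _
            · exact hn t h
        _ ≤ |g t| := by rw [one_mul]; exact le_abs_self _
    · rw [tri_eq_zero, zero_mul]; · exact abs_nonneg _
      rw [abs_div, abs_of_pos hRn, le_div_iff₀ hRn, one_mul]
      exact (not_le.1 h).le
  have hto : Tendsto (fun n => ∫ t, ‖(tri (t / R n) : ℂ) * charFun (ν n) t - ψ t‖) l (𝓝 0) := by
    rw [← integral_zero ℝ ℝ (μ := volume)]
    refine tendsto_integral_filter_of_dominated_convergence (fun t => |g t| + ‖ψ t‖)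
      (Eventually.of_forall fun n => ((hmeas n).sub hψ.1).norm) ?_ (hg.abs.add hψ.norm) ?_
    · filter_upwards [hbd] with n hn
      refine ae_of_all _ fun t => ?_
      rw [norm_norm]
      exact (norm_sub_le _ _).trans (by gcongr; exact hn t)
    · refine ae_of_all _ fun t => ?_
      have h1 : Tendsto (fun n => (tri (t / R n) : ℂ)) l (𝓝 1) := by
        have h0 : Tendsto (fun n => t / R n) l (𝓝 0) := hR.const_div_atTop t
        have := (htri.tendsto 0).comp h0
        rw [tri_zero] at this
        exact_mod_cast (Complex.continuous_ofReal.tendsto _).comp this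
      have := ((h1.mul (hlim t)).sub_const (ψ t)).norm
      simpa using this
  filter_upwards [hbd, hto.eventually (gt_mem_nhds hε), hR.eventually_gt_atTop 0] with n hn hn2 hRn v
  have hmexp : AEStronglyMeasurable (fun t : ℝ => Complex.exp (t * v * Complex.I)) :=
    (by fun_prop : Continuous fun t : ℝ => Complex.exp (t * v * Complex.I)).aestronglyMeasurable
  have hi1 : Integrable fun t => (tri (t / R n) : ℂ) * charFun (ν n) t * Complex.exp (t * v * Complex.I) := by
    refine hg.abs.mono' ((hmeas n).mul hmexp) (ae_of_all _ fun t => ?_)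
    rw [norm_mul, norm_cexp_mul_I, mul_one]
    exact hn t
  have hi2 : Integrable fun t => ψ t * Complex.exp (t * v * Complex.I) := by
    refine hψ.norm.mono' (hψ.1.mul hmexp) (ae_of_all _ fun t => ?_)
    rw [norm_mul, norm_cexp_mul_I, mul_one]
  have h2 : 2 * Real.pi * charInv ψ (-v) = (∫ t, ψ t * Complex.exp (t * v * Complex.I)).re := by
    rw [charInv, mul_inv_cancel_left₀ (by positivity)]
    simp
  have h3 := congrArg Complex.re (integral_fejer_charFun (ν n) hRn v)
  rw [Complex.ofReal_re] at h3
  rw [h3, h2, ← Complex.sub_re, ← integral_sub hi1 hi2]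
  refine (Complex.abs_re_le_norm _).trans ((norm_integral_le_integral_norm _).trans (le_trans ?_ hn2.le))
  refine le_of_eq (integral_congr_ae (ae_of_all _ fun t => ?_))
  simp only
  rw [← sub_mul, norm_mul, norm_cexp_mul_I, mul_one]

lemma charInv_eq_fourier (ψ : ℝ → ℂ) (x : ℝ) : charInv ψ x =
    (2 * Real.pi)⁻¹ * (FourierTransform.fourier ψ (x / (2 * Real.pi))).re := by
  rw [charInv, Real.fourier_eq']
  congr 3
  ext t
  rw [smul_eq_mul, mul_comm]
  congr 2
  simp
  field_simp

lemma continuous_charInv {ψ : ℝ → ℂ} (hψ : Integrable ψ) : Continuous (charInv ψ) := by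
  rw [funext (charInv_eq_fourier ψ)]
  have := VectorFourier.fourierIntegral_continuous Real.continuous_fourierChar
    (L := innerₗ ℝ) continuous_inner hψ
  exact continuous_const.mul (Complex.continuous_re.comp (this.comp (by fun_prop)))

lemma tendsto_charInv_cocompact (ψ : ℝ → ℂ) : Tendsto (charInv ψ) (cocompact ℝ) (𝓝 0) := by
  rw [funext (charInv_eq_fourier ψ)]
  have h1 := Real.zero_at_infty_fourier ψ
  have h2 : Tendsto (fun x : ℝ => x / (2 * Real.pi)) (cocompact ℝ) (cocompact ℝ) := by
    simp_rw [div_eq_mul_inv]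
    exact tendsto_cocompact_mul_right₀ (by positivity)
  have := ((Complex.continuous_re.tendsto _).comp (h1.comp h2)).const_mul (2 * Real.pi)⁻¹
  simpa using this

/-- Continuity together with decay at infinity (Riemann–Lebesgue). It lets the argument of the
density be moved by a small amount uniformly in `u`. -/
lemma uniformContinuous_charInv {ψ : ℝ → ℂ} (hψ : Integrable ψ) : UniformContinuous (charInv ψ) :=
  (continuous_charInv hψ).uniformContinuous_of_tendsto_cocompact (tendsto_charInv_cocompact ψ)

lemma abs_charInv_le {ψ : ℝ → ℂ} (x : ℝ) : 2 * Real.pi * |charInv ψ x| ≤ ∫ t, ‖ψ t‖ := by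
  rw [charInv, abs_mul, abs_of_pos (by positivity), mul_inv_cancel_left₀ (by positivity)]
  refine (Complex.abs_re_le_norm _).trans ((norm_integral_le_integral_norm _).trans (le_of_eq ?_))
  refine integral_congr_ae (ae_of_all _ fun t => ?_)
  simp only
  rw [norm_mul, norm_cexp_neg_mul_I, mul_one]

/-! ### Approximation of test functions by Fejér means -/

/-- The convolution of `m` with the rescaled Fejér kernel. -/
noncomputable def fejerMean (m : ℝ → ℝ) (T x : ℝ) : ℝ := ∫ y, m y * (T * fejer (T * (x - y)))

/-- The kernel has total mass `2π`, so the mean approximates `2π m` rather than `m`; the factor is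
carried along instead of being normalized away. -/
lemma two_pi_mul_sub_fejerMean {m : ℝ → ℝ} (hm : Continuous m) {A : ℝ} (hA : ∀ x, |m x| ≤ A)
    {T : ℝ} (hT : 0 < T) (x : ℝ) :
    2 * Real.pi * m x - fejerMean m T x = ∫ z, (m x - m (x - z / T)) * fejer z := by
  have hf := continuous_fejer
  have hi : Integrable fun z => m (x - z / T) * fejer z := by
    refine (integrable_fejer.const_mul A).mono'
      (by fun_prop : Continuous fun z => m (x - z / T) * fejer z).aestronglyMeasurable
      (ae_of_all _ fun z => ?_)
    rw [Real.norm_eq_abs, abs_mul, abs_of_nonneg (fejer_nonneg z)]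
    exact mul_le_mul_of_nonneg_right (hA _) (fejer_nonneg z)
  simp_rw [sub_mul]
  rw [integral_sub (integrable_fejer.const_mul _) hi, integral_const_mul, integral_fejer, mul_comm]
  congr 1
  unfold fejerMean
  have h1 := integral_sub_left_eq_self (fun y => m y * (T * fejer (T * (x - y)))) volume x
  rw [← h1]
  have h2 := Measure.integral_comp_mul_left (fun z => m (x - z / T) * fejer z) T
  rw [abs_of_pos (by positivity), smul_eq_mul] at h2
  rw [← mul_inv_cancel_left₀ hT.ne' (∫ z, m (x - z / T) * fejer z), ← h2, ← integral_const_mul]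
  refine integral_congr_ae (ae_of_all _ fun z => ?_)
  simp only [sub_sub_cancel]
  rw [mul_div_cancel_left₀ _ hT.ne']
  ring

lemma tendsto_integral_fejer_tail {δ : ℝ} (hδ : 0 < δ) :
    Tendsto (fun T : ℝ => ∫ z, {z : ℝ | δ * T < |z|}.indicator fejer z) atTop (𝓝 0) := by
  rw [← integral_zero ℝ ℝ (μ := volume)]
  have hms : ∀ T : ℝ, MeasurableSet {z : ℝ | δ * T < |z|} := fun T =>
    measurableSet_lt measurable_const continuous_abs.measurable
  refine tendsto_integral_filter_of_dominated_convergence fejer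
    (Eventually.of_forall fun T => (integrable_fejer.indicator (hms T)).1)
    (Eventually.of_forall fun T => ae_of_all _ fun z => ?_) integrable_fejer
    (ae_of_all _ fun z => ?_)
  · rw [norm_indicator_eq_indicator_norm]
    refine Set.indicator_le_self' (fun _ _ => norm_nonneg _) z |>.trans ?_
    exact le_of_eq (Real.norm_of_nonneg (fejer_nonneg z))
  · refine tendsto_const_nhds.congr' ?_
    filter_upwards [eventually_ge_atTop (|z| / δ)] with T hT
    rw [Set.indicator_of_notMem]
    simp only [Set.mem_ofPred_eq, not_lt]
    rw [div_le_iff₀ hδ] at hT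
    linarith

lemma exists_abs_le_of_hasCompactSupport {m : ℝ → ℝ} (hm : Continuous m) (hs : HasCompactSupport m) :
    ∃ A, 0 ≤ A ∧ ∀ x, |m x| ≤ A := by
  obtain ⟨A, hA⟩ := hs.exists_bound_of_continuous hm
  exact ⟨A, (norm_nonneg _).trans (hA 0), hA⟩

lemma eventually_abs_sub_fejerMean_le {m : ℝ → ℝ} (hm : Continuous m) (hs : HasCompactSupport m)
    {ε : ℝ} (hε : 0 < ε) :
    ∀ᶠ T : ℝ in atTop, ∀ x, |2 * Real.pi * m x - fejerMean m T x| ≤ ε := by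
  obtain ⟨A, hA0, hA⟩ := exists_abs_le_of_hasCompactSupport hm hs
  have hpi := Real.pi_pos
  -- Oscillation below `ε'` against a kernel of mass `2π` contributes `ε / 2`; the other half is the
  -- kernel mass outside `|z| ≤ δT/2`.
  set ε' := ε / (4 * Real.pi) with hε'
  have hε'0 : 0 < ε' := by positivity
  obtain ⟨δ, hδ, hδm⟩ := Metric.uniformContinuous_iff.1 (hs.uniformContinuous_of_continuous hm) ε' hε'0
  have h1 := ((tendsto_integral_fejer_tail (half_pos hδ)).const_mul (2 * A)).eventually
    (gt_mem_nhds (show 2 * A * 0 < ε / 2 by simpa using half_pos hε))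
  filter_upwards [h1, eventually_gt_atTop 0] with T hT hT0 x
  have hms : MeasurableSet {z : ℝ | δ / 2 * T < |z|} :=
    measurableSet_lt measurable_const continuous_abs.measurable
  rw [two_pi_mul_sub_fejerMean hm hA hT0, ← Real.norm_eq_abs]
  have hi2 := (integrable_fejer.indicator hms).const_mul (2 * A)
  have hi1 := integrable_fejer.const_mul ε'
  calc _ ≤ ∫ z, (ε' * fejer z + 2 * A * {z : ℝ | δ / 2 * T < |z|}.indicator fejer z) := by
        refine norm_integral_le_of_norm_le (hi1.add hi2) (ae_of_all _ fun z => ?_)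
        rw [norm_mul, Real.norm_of_nonneg (fejer_nonneg z), Real.norm_eq_abs]
        by_cases hz : δ / 2 * T < |z|
        · rw [Set.indicator_of_mem (by exact hz), ← add_mul]
          refine mul_le_mul_of_nonneg_right ?_ (fejer_nonneg z)
          have := abs_sub (m x) (m (x - z / T))
          linarith [hA x, hA (x - z / T)]
        · rw [Set.indicator_of_notMem (by exact hz), mul_zero, add_zero]
          refine mul_le_mul_of_nonneg_right ?_ (fejer_nonneg z)
          refine (hδm ?_).le
          rw [Real.dist_eq, sub_sub_cancel, abs_div, abs_of_pos hT0, div_lt_iff₀ hT0]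
          nlinarith [mul_pos hδ hT0]
    _ = ε / 2 + 2 * A * ∫ z, {z : ℝ | δ / 2 * T < |z|}.indicator fejer z := by
        rw [integral_add hi1 hi2, integral_const_mul, integral_const_mul, integral_fejer, hε']
        congr 1
        field_simp
        norm_num
    _ ≤ ε := by linarith

/-- One Fejér kernel vanishes at the nonzero multiples of `2π`, so it has no lower bound of order
`1/(1 + x²)`. A translate by `1` fills the zeros, since `cos x + cos (x - 1) = 2 cos (x - 1/2) cos
(1/2)` stays below `2 cos (1/2) < 2`. -/
lemma exists_le_fejer_add_fejer : ∃ c : ℝ, 0 < c ∧ ∀ x, c / (1 + x ^ 2) ≤ fejer x + fejer (x - 1) := by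
  have hc1 : Real.cos (1 / 2) < 1 := by
    have := Real.cos_lt_cos_of_nonneg_of_le_pi le_rfl
      (show (1 / 2 : ℝ) ≤ Real.pi by linarith [Real.pi_gt_three]) (by norm_num)
    rwa [Real.cos_zero] at this
  have hc0 : 0 ≤ Real.cos (1 / 2) :=
    Real.cos_nonneg_of_mem_Icc ⟨by linarith [Real.pi_pos], by linarith [Real.pi_gt_three]⟩
  refine ⟨2 - 2 * Real.cos (1 / 2), by linarith, fun x => ?_⟩
  rw [div_le_iff₀ (by positivity)]
  have h1 := fejer_mul_sq x
  have h2 := fejer_mul_sq (x - 1)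
  have h3 : Real.cos x + Real.cos (x - 1) = 2 * Real.cos (x - 1 / 2) * Real.cos (1 / 2) := by
    rw [Real.cos_add_cos]; ring_nf
  have h4 : Real.cos (x - 1 / 2) * Real.cos (1 / 2) ≤ Real.cos (1 / 2) :=
    mul_le_of_le_one_left hc0 (Real.cos_le_one _)
  have h5 : fejer (x - 1) * (x - 1) ^ 2 ≤ fejer (x - 1) * (2 * (1 + x ^ 2)) := by
    refine mul_le_mul_of_nonneg_left ?_ (fejer_nonneg _)
    nlinarith [sq_nonneg (x + 1)]
  have h6 : fejer x * x ^ 2 ≤ fejer x * (2 * (1 + x ^ 2)) := by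
    refine mul_le_mul_of_nonneg_left ?_ (fejer_nonneg _)
    nlinarith [sq_nonneg x]
  linarith

/-- The error has to be small relative to an integrable kernel with controlled expectation, because
it will be multiplied by `B n → ∞`. Near the support uniform convergence suffices; far away `m`
vanishes and its Fejér mean is `O(1/(T x²))`. -/
lemma eventually_abs_sub_fejerMean_le_fejer {m : ℝ → ℝ} (hm : Continuous m)
    (hs : HasCompactSupport m) {η : ℝ} (hη : 0 < η) :
    ∀ᶠ T : ℝ in atTop, ∀ x,
      |2 * Real.pi * m x - fejerMean m T x| ≤ η * (fejer x + fejer (x - 1)) := by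
  obtain ⟨c, hc, hcf⟩ := exists_le_fejer_add_fejer
  obtain ⟨M, hM⟩ := hs.isBounded.subset_closedBall 0
  have hM' : ∀ y, M < |y| → m y = 0 := fun y hy => by
    by_contra h
    have := hM (subset_tsupport m h)
    rw [mem_closedBall_zero_iff, Real.norm_eq_abs] at this
    linarith
  set N := max M 1
  have hN1 : 1 ≤ N := le_max_right _ _
  have hMN : M ≤ N := le_max_left _ _
  have hmi : Integrable m := hm.integrable_of_hasCompactSupport hs
  set I := ∫ y, |m y|
  -- The uniform error is taken equal to the least value of `η c / (1 + x²)` on `|x| ≤ 2N`.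
  have h1 := eventually_abs_sub_fejerMean_le hm hs (ε := η * (c / (1 + (2 * N) ^ 2))) (by positivity)
  filter_upwards [h1, eventually_gt_atTop 0, eventually_ge_atTop (32 * I / (η * c))] with T hT hT0 hT1 x
  refine le_trans ?_ (mul_le_mul_of_nonneg_left (hcf x) hη.le)
  by_cases hx : |x| ≤ 2 * N
  · refine (hT x).trans ?_
    gcongr η * (c / (1 + ?_))
    exact sq_le_sq' (by linarith [neg_abs_le x]) (by linarith [le_abs_self x])
  · push Not at hx
    rw [hM' x (by linarith), mul_zero, zero_sub, abs_neg, ← Real.norm_eq_abs]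
    have hx2 : 1 ≤ x ^ 2 := by rw [← sq_abs]; nlinarith
    calc _ ≤ ∫ y, |m y| * (32 / (T * (1 + x ^ 2))) := by
          refine norm_integral_le_of_norm_le (hmi.abs.mul_const _) (ae_of_all _ fun y => ?_)
          rw [norm_mul, Real.norm_eq_abs]
          by_cases hy : M < |y|
          · simp [hM' y hy]
          refine mul_le_mul_of_nonneg_left ?_ (abs_nonneg _)
          rw [Real.norm_of_nonneg (mul_nonneg hT0.le (fejer_nonneg _)), le_div_iff₀ (by positivity)]
          push Not at hy
          have h3 : |x| / 2 ≤ |x - y| := by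
            have := abs_sub_abs_le_abs_sub x y
            linarith
          have h4 : 1 + x ^ 2 ≤ 8 * (x - y) ^ 2 := by
            rw [← sq_abs (x - y)]
            have := sq_abs x
            nlinarith [abs_nonneg x]
          have h5 := fejer_mul_sq_le (T * (x - y))
          calc T * fejer (T * (x - y)) * (T * (1 + x ^ 2))
              ≤ T * fejer (T * (x - y)) * (T * (8 * (x - y) ^ 2)) := by
                have := fejer_nonneg (T * (x - y))
                gcongr
            _ = 8 * (fejer (T * (x - y)) * (T * (x - y)) ^ 2) := by ring
            _ ≤ 32 := by linarith
      _ = 32 * I / T / (1 + x ^ 2) := by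
          rw [integral_mul_const]
          field_simp
          rfl
      _ ≤ η * (c / (1 + x ^ 2)) := by
          rw [← mul_div_assoc]
          gcongr
          rw [div_le_iff₀ (by positivity)] at hT1
          rw [div_le_iff₀ hT0]
          linarith

lemma integral_fejerMean {m : ℝ → ℝ} (hm : Continuous m) (hs : HasCompactSupport m)
    (ρ : Measure ℝ) [IsProbabilityMeasure ρ] {T : ℝ} (hT : 0 < T) (u : ℝ) :
    ∫ x, fejerMean m T (x + u) ∂ρ = ∫ y, m y * (T * ∫ x, fejer (T * (x + (u - y))) ∂ρ) := by
  have hf := continuous_fejer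
  have hmi : Integrable m := hm.integrable_of_hasCompactSupport hs
  unfold fejerMean
  rw [integral_integral_swap]
  · refine integral_congr_ae (ae_of_all _ fun y => ?_)
    simp only
    rw [integral_const_mul, integral_const_mul]
    simp_rw [add_sub_assoc]
  · refine ((hmi.norm.mul_const T).comp_snd ρ).mono'
      (by fun_prop : Continuous (Function.uncurry fun (x y : ℝ) =>
        m y * (T * fejer (T * (x + u - y))))).aestronglyMeasurable (ae_of_all _ fun p => ?_)
    simp only [Function.uncurry]
    rw [norm_mul, norm_mul, Real.norm_of_nonneg (fejer_nonneg _), Real.norm_of_nonneg hT.le]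
    gcongr
    exact mul_le_of_le_one_right hT.le (fejer_le_one _)

lemma integrable_fejerMean {m : ℝ → ℝ} (hm : Continuous m) (hs : HasCompactSupport m)
    (ρ : Measure ℝ) [IsProbabilityMeasure ρ] {T : ℝ} (hT : 0 < T) (u : ℝ) :
    Integrable (fun x => fejerMean m T (x + u)) ρ := by
  have hf := continuous_fejer
  have hmi : Integrable m := hm.integrable_of_hasCompactSupport hs
  have : Integrable (Function.uncurry fun (x y : ℝ) => m y * (T * fejer (T * (x + u - y))))
      (ρ.prod volume) := by
    refine ((hmi.norm.mul_const T).comp_snd ρ).mono'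
      (by fun_prop : Continuous (Function.uncurry fun (x y : ℝ) =>
        m y * (T * fejer (T * (x + u - y))))).aestronglyMeasurable (ae_of_all _ fun p => ?_)
    simp only [Function.uncurry]
    rw [norm_mul, norm_mul, Real.norm_of_nonneg (fejer_nonneg _), Real.norm_of_nonneg hT.le]
    gcongr
    exact mul_le_of_le_one_right hT.le (fejer_le_one _)
  exact this.integral_prod_left

lemma abs_integral_mul_sub_le {m : ℝ → ℝ} (hmi : Integrable m) {h : ℝ → ℝ} {c ε : ℝ}
    (hh : ∀ y, m y ≠ 0 → |h y - c| ≤ ε) (hhi : Integrable fun y => m y * h y) :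
    |(∫ y, m y * h y) - c * ∫ y, m y| ≤ ε * ∫ y, |m y| := by
  rw [← integral_const_mul, ← integral_sub hhi (hmi.const_mul _), ← integral_const_mul,
    ← Real.norm_eq_abs]
  refine norm_integral_le_of_norm_le (hmi.abs.const_mul _) (ae_of_all _ fun y => ?_)
  by_cases hy : m y = 0
  · simp [hy]
  · rw [mul_comm c, ← mul_sub, Real.norm_eq_abs, abs_mul, mul_comm]
    exact mul_le_mul_of_nonneg_right (hh y hy) (abs_nonneg _)

/-! ### From characteristic functions to densities and local limits -/

/-- `2π` times the inversion integral is a limit of Fejér smoothings of a positive measure. -/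
lemma charInv_charFun_nonneg (ν : Measure ℝ) [IsProbabilityMeasure ν] (hν : Integrable (charFun ν))
    (x : ℝ) : 0 ≤ charInv (charFun ν) x := by
  have h := fun ε hε => eventually_abs_fejer_sub_charInv_le (ν := fun _ : ℝ => ν) (R := id)
    tendsto_id hν hν.norm (Eventually.of_forall fun _ _ _ => le_rfl) (fun _ => tendsto_const_nhds)
    (ε := ε) hε
  refine le_of_forall_pos_le_add fun ε hε => ?_
  obtain ⟨R, hR, hR0⟩ := ((h ε hε).and (eventually_gt_atTop 0)).exists
  have h1 := hR (-x)
  rw [neg_neg] at h1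
  have h2 : 0 ≤ R * ∫ y, fejer (R * (y + -x)) ∂ν :=
    mul_nonneg hR0.le (integral_nonneg fun y => fejer_nonneg _)
  have h3 := (abs_le.1 h1).2
  have h4 : -ε ≤ 2 * Real.pi * charInv (charFun ν) x := by
    have := (abs_le.1 h1).2
    simp only [id] at this
    linarith [(abs_le.1 h1).1]
  by_contra h5
  push Not at h5
  nlinarith [Real.pi_gt_three]

/-- Both measures are tested on continuous compactly supported functions. The integral of the Fejér
mean of `m` against `ν` is, by Fubini, the integral of `m` against the Fejér smoothing of `ν`, which
is uniformly close to `2π` times the candidate density. -/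
theorem eq_withDensity_charInv (ν : Measure ℝ) [IsProbabilityMeasure ν]
    (hν : Integrable (charFun ν)) :
    ν = volume.withDensity (fun x => ENNReal.ofReal (charInv (charFun ν) x)) := by
  have hf0 := charInv_charFun_nonneg ν hν
  have hfc := continuous_charInv hν
  set f := charInv (charFun ν) with hfdef
  have hfj := continuous_fejer
  have : IsLocallyFiniteMeasure (volume.withDensity (fun x => ENNReal.ofReal (f x))) :=
    IsLocallyFiniteMeasure.withDensity_ofReal hfc
  refine Measure.ext_of_integral_eq_on_compactlySupported fun m => ?_
  have hm : Continuous (m : ℝ → ℝ) := m.continuous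
  have hs : HasCompactSupport (m : ℝ → ℝ) := m.hasCompactSupport
  have hmi : Integrable m := hm.integrable_of_hasCompactSupport hs
  rw [integral_withDensity_eq_integral_toReal_smul (by fun_prop) (by simp)]
  simp only [ENNReal.toReal_ofReal (hf0 _), smul_eq_mul]
  refine eq_of_forall_dist_le fun ε hε => ?_
  set I := ∫ y, |m y|
  have hI0 : 0 ≤ I := integral_nonneg fun _ => abs_nonneg _
  have h1 := eventually_abs_sub_fejerMean_le hm hs hε
  have h2 := eventually_abs_fejer_sub_charInv_le (ν := fun _ : ℝ => ν) (R := id)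
    tendsto_id hν hν.norm (Eventually.of_forall fun _ _ _ => le_rfl) (fun _ => tendsto_const_nhds)
    (ε := ε / (I + 1)) (by positivity)
  obtain ⟨T, hT1, hT2, hT0⟩ := (h1.and (h2.and (eventually_gt_atTop 0))).exists
  obtain ⟨A, hA0, hA⟩ := exists_abs_le_of_hasCompactSupport hm hs
  have hmν : Integrable m ν := Integrable.of_bound hm.aestronglyMeasurable A (ae_of_all _ hA)
  have e1 : |2 * Real.pi * (∫ x, m x ∂ν) - ∫ x, fejerMean m T x ∂ν| ≤ ε := by
    have hint := integrable_fejerMean hm hs ν hT0 0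
    simp only [add_zero] at hint
    rw [← integral_const_mul, ← integral_sub (hmν.const_mul _) hint, ← Real.norm_eq_abs]
    refine (norm_integral_le_of_norm_le_const (ae_of_all _ hT1)).trans ?_
    simp
  have e2 : |(∫ x, fejerMean m T x ∂ν) - 2 * Real.pi * ∫ y, f y * m y| ≤ ε := by
    have := integral_fejerMean hm hs ν hT0 0
    simp only [add_zero, zero_sub] at this
    have hc : Continuous fun y : ℝ => T * ∫ x, fejer (T * (x + -y)) ∂ν := by
      refine continuous_const.mul (continuous_of_dominated (bound := fun _ => 1)
        (fun y => by fun_prop) (fun y => ae_of_all _ fun x => ?_) (integrable_const _)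
        (ae_of_all _ fun x => by fun_prop))
      rw [Real.norm_of_nonneg (fejer_nonneg _)]
      exact fejer_le_one _
    rw [this, ← integral_const_mul, ← integral_sub, ← Real.norm_eq_abs]
    · calc _ ≤ ∫ y, |m y| * (ε / (I + 1)) := by
            refine norm_integral_le_of_norm_le (hmi.abs.mul_const _) (ae_of_all _ fun y => ?_)
            have h3 := hT2 (-y)
            rw [neg_neg] at h3
            rw [show m y * (T * ∫ x, fejer (T * (x + -y)) ∂ν) - 2 * Real.pi * (f y * m y) =
              m y * (T * (∫ x, fejer (T * (x + -y)) ∂ν) - 2 * Real.pi * f y) by ring,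
              norm_mul, Real.norm_eq_abs]
            exact mul_le_mul_of_nonneg_left h3 (abs_nonneg _)
        _ = ε * (I / (I + 1)) := by rw [integral_mul_const]; ring
        _ ≤ ε := mul_le_of_le_one_right hε.le ((div_le_one (by positivity)).2 (by linarith))
    · exact (hm.mul hc).integrable_of_hasCompactSupport hs.mul_right
    · exact ((hfc.mul hm).integrable_of_hasCompactSupport hs.mul_left).const_mul _
  rw [Real.dist_eq]
  have e3 : |2 * Real.pi * (∫ x, m x ∂ν) - 2 * Real.pi * ∫ y, f y * m y| ≤ 2 * ε := by
    have := abs_sub_le (2 * Real.pi * (∫ x, m x ∂ν)) (∫ x, fejerMean m T x ∂ν)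
      (2 * Real.pi * ∫ y, f y * m y)
    linarith
  rw [← mul_sub, abs_mul, abs_of_pos (by positivity)] at e3
  nlinarith [Real.pi_gt_three, abs_nonneg ((∫ x, m x ∂ν) - ∫ y, f y * m y)]

/-- Convergence for Fejér kernels of every fixed width `1/T`, then approximation of `m` from inside
by its Fejér mean. The domination is demanded only for `|t| ≤ K * B n`, that is for frequencies of
`S n` in a fixed bounded interval. -/
theorem tendstoUniformly_of_charFun {Ω : Type*} [MeasurableSpace Ω] {P : Measure Ω}
    [IsProbabilityMeasure P] {S : ℕ → Ω → ℝ} (hS : ∀ n, AEMeasurable (S n) P) {B : ℕ → ℝ}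
    (hB : Tendsto B atTop atTop) {ψ : ℝ → ℂ} (hψ : Integrable ψ)
    (hlim : ∀ t, Tendsto (fun n => charFun (P.map (S n)) (t / B n)) atTop (𝓝 (ψ t)))
    (hdom : ∀ K : ℝ, 0 < K → ∃ g : ℝ → ℝ, Integrable g ∧ ∀ᶠ n in atTop, ∀ t, |t| ≤ K * B n →
      ‖charFun (P.map (S n)) (t / B n)‖ ≤ g t)
    {m : ℝ → ℝ} (hm : Continuous m) (hs : HasCompactSupport m) :
    TendstoUniformly (fun n u => B n * (∫ ω, m (S n ω + u) ∂P) -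
      charInv ψ (-(u / B n)) * ∫ x, m x) (fun _ => 0) atTop := by
  have hfj := continuous_fejer
  have hpi := Real.pi_gt_three
  have hρ : ∀ n, IsProbabilityMeasure (P.map (S n)) := fun n =>
    Measure.isProbabilityMeasure_map (hS n)
  have hmi : Integrable m := hm.integrable_of_hasCompactSupport hs
  set I := ∫ y, |m y| with hI
  have hI0 : 0 ≤ I := integral_nonneg fun _ => abs_nonneg _
  set J := ∫ t, ‖ψ t‖ with hJ
  have hJ0 : 0 ≤ J := integral_nonneg fun _ => norm_nonneg _
  -- A kernel of width `1/T` for `S n` is one of width `1/(T * B n)` for `S n / B n`, so the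
  -- smoothing lemma applies with `R n = T * B n → ∞`.
  have key : ∀ T : ℝ, 0 < T → ∀ ε : ℝ, 0 < ε → ∀ᶠ n in atTop, ∀ u,
      |B n * (T * ∫ x, fejer (T * (x + u)) ∂(P.map (S n))) -
        2 * Real.pi * charInv ψ (-(u / B n))| ≤ ε := by
    intro T hT ε hε
    obtain ⟨g, hg, hgd⟩ := hdom T hT
    have : ∀ n, IsProbabilityMeasure ((P.map (S n)).map ((B n)⁻¹ * ·)) := fun n =>
      Measure.isProbabilityMeasure_map (by fun_prop)
    have hcf : ∀ n t, charFun ((P.map (S n)).map ((B n)⁻¹ * ·)) t =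
        charFun (P.map (S n)) (t / B n) := fun n t => by
      rw [charFun_map_mul, div_eq_inv_mul]
    have := eventually_abs_fejer_sub_charInv_le
      (ν := fun n => (P.map (S n)).map ((B n)⁻¹ * ·)) (R := fun n => T * B n)
      (hB.const_mul_atTop hT) hψ hg (by simpa only [hcf] using hgd)
      (by simpa only [hcf] using hlim) hε
    filter_upwards [this, hB.eventually_gt_atTop 0] with n hn hBn u
    have h1 := hn (u / B n)
    rw [integral_map (by fun_prop) (by fun_prop)] at h1
    have h2 : ∀ x, T * B n * ((B n)⁻¹ * x + u / B n) = T * (x + u) := fun x => by field_simp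
    simp only [h2] at h1
    rwa [mul_left_comm, ← mul_assoc]
  rw [Metric.tendstoUniformly_iff]
  intro ε hε
  set C := 2 * (J + 1) with hC
  obtain ⟨T, hT, hT0⟩ := ((eventually_abs_sub_fejerMean_le_fejer hm hs (η := ε / C)
    (by positivity)).and (eventually_gt_atTop 0)).exists
  obtain ⟨δ, hδ, hδf⟩ := Metric.uniformContinuous_iff.1 (uniformContinuous_charInv hψ)
    (ε / (2 * Real.pi * (I + 1))) (by positivity)
  obtain ⟨M, hM⟩ := hs.isBounded.subset_closedBall 0
  filter_upwards [key 1 one_pos 1 one_pos, key T hT0 (ε / (I + 1)) (by positivity),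
    hB.eventually_gt_atTop 0, hB.eventually_gt_atTop (M / δ)] with n hn1 hn2 hBn hBM u
  rw [dist_zero_left, Real.norm_eq_abs]
  set ρ := P.map (S n) with hρdef
  have hE : ∫ ω, m (S n ω + u) ∂P = ∫ x, m (x + u) ∂ρ := by
    rw [hρdef, integral_map (hS n)]
    exact (by fun_prop : Continuous fun x => m (x + u)).aestronglyMeasurable
  rw [hE]
  obtain ⟨A, hA0, hA⟩ := exists_abs_le_of_hasCompactSupport hm hs
  have hmρ : Integrable (fun x => m (x + u)) ρ := Integrable.of_bound
    (by fun_prop : Continuous fun x => m (x + u)).aestronglyMeasurable A (ae_of_all _ fun x => hA _)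
  have hfi : ∀ w : ℝ, Integrable (fun x => fejer (x + w)) ρ := fun w => Integrable.of_bound
    (by fun_prop : Continuous fun x => fejer (x + w)).aestronglyMeasurable 1
    (ae_of_all _ fun x => by rw [Real.norm_of_nonneg (fejer_nonneg _)]; exact fejer_le_one _)
  -- A concentration bound: the case `T = 1`, error `1`, together with `2π |charInv ψ| ≤ J`. It
  -- turns the pointwise error `ε / C` times two kernels into `ε`, which explains `C = 2 (J + 1)`.
  have hfb : ∀ w : ℝ, B n * ∫ x, fejer (x + w) ∂ρ ≤ J + 1 := by
    intro w
    have h1 := hn1 w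
    simp only [one_mul] at h1
    have h2 := abs_charInv_le (ψ := ψ) (-(w / B n))
    have h3 := (abs_le.1 h1).2
    have h4 := le_abs_self (charInv ψ (-(w / B n)))
    nlinarith
  have e1 : |2 * Real.pi * (B n * ∫ x, m (x + u) ∂ρ) - B n * ∫ x, fejerMean m T (x + u) ∂ρ| ≤ ε := by
    have hint := integrable_fejerMean hm hs ρ hT0 u
    rw [show 2 * Real.pi * (B n * ∫ x, m (x + u) ∂ρ) - B n * ∫ x, fejerMean m T (x + u) ∂ρ =
      B n * (2 * Real.pi * (∫ x, m (x + u) ∂ρ) - ∫ x, fejerMean m T (x + u) ∂ρ) by ring, abs_mul,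
      abs_of_pos hBn, ← integral_const_mul, ← integral_sub (hmρ.const_mul _) hint, ← Real.norm_eq_abs]
    have hfi2 := (hfi u).add (hfi (u - 1))
    calc _ ≤ B n * ∫ x, ε / C * (fejer (x + u) + fejer (x + (u - 1))) ∂ρ := by
          refine mul_le_mul_of_nonneg_left ?_ hBn.le
          refine norm_integral_le_of_norm_le (hfi2.const_mul _) (ae_of_all _ fun x => ?_)
          have := hT (x + u)
          rwa [add_sub_assoc] at this
      _ = ε / C * (B n * (∫ x, fejer (x + u) ∂ρ) + B n * ∫ x, fejer (x + (u - 1)) ∂ρ) := by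
          rw [integral_const_mul, integral_add (hfi u) (hfi (u - 1))]; ring
      _ ≤ ε / C * (J + 1 + (J + 1)) := by
          gcongr
          · exact hfb u
          · exact hfb (u - 1)
      _ = ε := by rw [hC]; field_simp; ring
  have hfc := continuous_charInv hψ
  have hc : Continuous fun y : ℝ => T * ∫ x, fejer (T * (x + (u - y))) ∂ρ := by
    refine continuous_const.mul (continuous_of_dominated (bound := fun _ => 1)
      (fun y => by fun_prop) (fun y => ae_of_all _ fun x => ?_) (integrable_const _)
      (ae_of_all _ fun x => by fun_prop))
    rw [Real.norm_of_nonneg (fejer_nonneg _)]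
    exact fejer_le_one _
  have e2 : |B n * (∫ x, fejerMean m T (x + u) ∂ρ) -
      2 * Real.pi * (charInv ψ (-(u / B n)) * ∫ x, m x)| ≤ 2 * ε := by
    have h0 : ∀ y, B n * (m y * (T * ∫ x, fejer (T * (x + (u - y))) ∂ρ)) =
        m y * (B n * (T * ∫ x, fejer (T * (x + (u - y))) ∂ρ)) := fun y => by ring
    rw [integral_fejerMean hm hs ρ hT0 u, ← integral_const_mul, ← mul_assoc]
    simp only [h0]
    refine (abs_integral_mul_sub_le hmi (ε := 2 * (ε / (I + 1))) (fun y hy => ?_) ?_).trans ?_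
    -- Only `y` in the support of `m` matters, and for those the argument of the density moves by
    -- `|y| / B n < δ`.
    · have hy2 : |y| ≤ M := by
        have := hM (subset_tsupport m hy)
        rwa [mem_closedBall_zero_iff, Real.norm_eq_abs] at this
      have h1 := hn2 (u - y)
      have h2 := (hδf (a := -((u - y) / B n)) (b := -(u / B n)) (by
        rw [Real.dist_eq, show -((u - y) / B n) - -(u / B n) = y / B n by ring, abs_div,
          abs_of_pos hBn, div_lt_iff₀ hBn]
        rw [div_lt_iff₀ hδ] at hBM
        linarith)).le
      rw [Real.dist_eq] at h2
      have h3 : |2 * Real.pi * charInv ψ (-((u - y) / B n)) - 2 * Real.pi * charInv ψ (-(u / B n))| ≤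
          ε / (I + 1) := by
        rw [← mul_sub, abs_mul, abs_of_pos (by positivity)]
        calc _ ≤ 2 * Real.pi * (ε / (2 * Real.pi * (I + 1))) := by gcongr
          _ = _ := by field_simp
      have := abs_sub_le (B n * (T * ∫ x, fejer (T * (x + (u - y))) ∂ρ))
        (2 * Real.pi * charInv ψ (-((u - y) / B n))) (2 * Real.pi * charInv ψ (-(u / B n)))
      linarith
    · exact (hm.mul (continuous_const.mul hc)).integrable_of_hasCompactSupport hs.mul_right
    · rw [mul_assoc]
      refine mul_le_mul_of_nonneg_left ?_ (by norm_num)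
      rw [div_mul_eq_mul_div, div_le_iff₀ (by positivity)]
      nlinarith
  have e3 := abs_sub_le (2 * Real.pi * (B n * ∫ x, m (x + u) ∂ρ))
    (B n * ∫ x, fejerMean m T (x + u) ∂ρ) (2 * Real.pi * (charInv ψ (-(u / B n)) * ∫ x, m x))
  rw [← mul_sub, abs_mul, abs_of_pos (by positivity)] at e3
  nlinarith [abs_nonneg (B n * (∫ x, m (x + u) ∂ρ) - charInv ψ (-(u / B n)) * ∫ x, m x)]

/-! ### Regular variation: Potter bounds and Karamata's theorem -/

lemma exists_two_pow_le_lt {y : ℝ} (hy : 1 ≤ y) : ∃ k : ℕ, (2 : ℝ) ^ k ≤ y ∧ y < 2 ^ (k + 1) :=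
  exists_nat_pow_near hy one_lt_two

lemma le_two_pow_rpow_of_doubling {f : ℝ → ℝ} {q x₀ : ℝ} (hx₀ : 0 < x₀)
    (hd : ∀ x, x₀ ≤ x → f (2 * x) ≤ 2 ^ q * f x) {x : ℝ} (hx : x₀ ≤ x) (k : ℕ) :
    f (x * 2 ^ k) ≤ ((2 : ℝ) ^ k) ^ q * f x := by
  induction k with
  | zero => simp
  | succ k ih =>
    have h2 : (1 : ℝ) ≤ 2 ^ k := one_le_pow₀ one_le_two
    have h1 := hd (x * 2 ^ k) (by nlinarith)
    calc f (x * 2 ^ (k + 1)) = f (2 * (x * 2 ^ k)) := by ring_nf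
      _ ≤ 2 ^ q * f (x * 2 ^ k) := h1
      _ ≤ 2 ^ q * (((2 : ℝ) ^ k) ^ q * f x) := by gcongr
      _ = _ := by
        rw [pow_succ, Real.mul_rpow (by positivity) (by positivity)]; ring

/-- The doubling inequality is iterated along `x * 2 ^ k`; monotonicity covers the factors between
two powers of two at the price of one extra `2 ^ q`. -/
lemma le_rpow_of_monotone_of_doubling {f : ℝ → ℝ} (hf : Monotone f) (h0 : ∀ x, 0 ≤ f x)
    {q x₀ : ℝ} (hq : 0 ≤ q) (hx₀ : 0 < x₀) (hd : ∀ x, x₀ ≤ x → f (2 * x) ≤ 2 ^ q * f x)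
    {x y : ℝ} (hx : x₀ ≤ x) (hy : 1 ≤ y) : f (x * y) ≤ 2 ^ q * y ^ q * f x := by
  obtain ⟨k, hk1, hk2⟩ := exists_two_pow_le_lt hy
  calc f (x * y) ≤ f (x * 2 ^ (k + 1)) := hf (by gcongr; linarith)
    _ ≤ ((2 : ℝ) ^ (k + 1)) ^ q * f x := le_two_pow_rpow_of_doubling hx₀ hd hx _
    _ ≤ (2 * y) ^ q * f x := by
      have := h0 x
      rw [pow_succ']
      gcongr
    _ = _ := by rw [Real.mul_rpow (by norm_num) (by linarith)]

lemma le_rpow_of_antitone_of_doubling {f : ℝ → ℝ} (hf : Antitone f) (h0 : ∀ x, 0 ≤ f x)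
    {q x₀ : ℝ} (hq : 0 ≤ q) (hx₀ : 0 < x₀) (hd : ∀ x, x₀ ≤ x → f (2 * x) ≤ 2 ^ (-q) * f x)
    {x y : ℝ} (hx : x₀ ≤ x) (hy : 1 ≤ y) : f (x * y) ≤ 2 ^ q * y ^ (-q) * f x := by
  obtain ⟨k, hk1, hk2⟩ := exists_two_pow_le_lt hy
  calc f (x * y) ≤ f (x * 2 ^ k) := hf (by gcongr; linarith)
    _ ≤ ((2 : ℝ) ^ k) ^ (-q) * f x := le_two_pow_rpow_of_doubling hx₀ hd hx _
    _ ≤ (y / 2) ^ (-q) * f x := by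
      refine mul_le_mul_of_nonneg_right ?_ (h0 x)
      refine Real.rpow_le_rpow_of_nonpos (by linarith) ?_ (by linarith)
      rw [pow_succ] at hk2
      linarith
    _ = _ := by
      rw [Real.div_rpow (by linarith) (by norm_num), Real.rpow_neg (by norm_num : (0 : ℝ) ≤ 2)]
      field_simp

/-- A tail function bounded by one that is regularly varying at infinity of index `-α`. -/
structure IsRegVarTail (T : ℝ → ℝ) (α : ℝ) : Prop where
  anti : Antitone T
  pos : ∀ x, 0 < T x
  le_one : ∀ x, T x ≤ 1
  ratio : ∀ r, 0 < r → Tendsto (fun x => T (r * x) / T x) atTop (𝓝 (r ^ (-α)))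

/-- A Potter bound valid for every `y > 0`. The limit of the ratio at `r = 2` lies strictly between
`2 ^ (-p)` and `2 ^ (-q)`, which gives doubling inequalities for `T` and for `1 / T` beyond some
`x₀`. -/
lemma IsRegVarTail.potter {T : ℝ → ℝ} {α : ℝ} (hT : IsRegVarTail T α) {p q : ℝ} (hq0 : 0 ≤ q)
    (hq : q < α) (hp : α < p) :
    ∃ C x₀ : ℝ, 0 < C ∧ 0 < x₀ ∧ ∀ x, x₀ ≤ x → ∀ y, 0 < y →
      T (y * x) ≤ C * (y ^ (-p) + y ^ (-q)) * T x := by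
  have hp0 : 0 ≤ p := by linarith
  have h1 : ∀ᶠ x in atTop, T (2 * x) / T x < 2 ^ (-q) :=
    (hT.ratio 2 two_pos).eventually (gt_mem_nhds (Real.rpow_lt_rpow_of_exponent_lt (by norm_num) (by linarith)))
  have h2 : ∀ᶠ x in atTop, 2 ^ (-p) < T (2 * x) / T x :=
    (hT.ratio 2 two_pos).eventually (lt_mem_nhds (Real.rpow_lt_rpow_of_exponent_lt (by norm_num) (by linarith)))
  obtain ⟨x₀, hx₀⟩ := eventually_atTop.1 (h1.and (h2.and (eventually_gt_atTop 0)))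
  have hx0 : 0 < x₀ := (hx₀ x₀ le_rfl).2.2
  have A : ∀ x, x₀ ≤ x → ∀ y, 1 ≤ y → T (x * y) ≤ 2 ^ q * y ^ (-q) * T x := fun x hx y hy =>
    le_rpow_of_antitone_of_doubling hT.anti (fun x => (hT.pos x).le) hq0 hx0 (fun x hx => by
      have := (hx₀ x hx).1
      rw [div_lt_iff₀ (hT.pos x)] at this
      exact this.le) hx hy
  have B : ∀ x, x₀ ≤ x → ∀ y, 1 ≤ y → T x ≤ 2 ^ p * y ^ p * T (x * y) := fun x hx y hy => by
    have := le_rpow_of_monotone_of_doubling (f := fun x => (T x)⁻¹)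
      (fun a b hab => inv_anti₀ (hT.pos b) (hT.anti hab)) (fun x => (inv_pos.2 (hT.pos x)).le)
      hp0 hx0 (fun x hx => by
        have := (hx₀ x hx).2.1
        rw [lt_div_iff₀ (hT.pos x), Real.rpow_neg (by norm_num)] at this
        have h3 := hT.pos x
        have h4 := hT.pos (2 * x)
        rw [← div_eq_mul_inv, le_div_iff₀ h3, inv_mul_le_iff₀ h4]
        rw [inv_mul_lt_iff₀ (by positivity)] at this
        linarith) hx hy
    have h3 := hT.pos x
    have h4 := hT.pos (x * y)
    rw [← div_eq_mul_inv, le_div_iff₀ h3, inv_mul_le_iff₀ h4] at this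
    linarith
  refine ⟨2 ^ p + 2 ^ q + 2 ^ p / T x₀, x₀, by have := hT.pos x₀; positivity, hx0, fun x hx y hy => ?_⟩
  have hTx := hT.pos x
  have hTx0 := hT.pos x₀
  have hyp : 0 < y ^ (-p) := by positivity
  have hyq : 0 < y ^ (-q) := by positivity
  have hxpos : 0 < x := hx0.trans_le hx
  rcases le_or_gt 1 y with h | h
  · have := A x hx y h
    rw [mul_comm y x]
    refine this.trans ?_
    gcongr
    · have : 0 < (2 : ℝ) ^ p := by positivity
      have : 0 < 2 ^ p / T x₀ := by positivity
      linarith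
    · linarith
  rcases le_or_gt x₀ (y * x) with h' | h'
  · have := B (y * x) h' y⁻¹ ((one_le_inv₀ hy).2 h.le)
    rw [show y * x * y⁻¹ = x by field_simp, Real.inv_rpow hy.le, ← Real.rpow_neg hy.le] at this
    refine this.trans ?_
    gcongr
    · have : 0 < (2 : ℝ) ^ q := by positivity
      have : 0 < 2 ^ p / T x₀ := by positivity
      linarith
    · linarith
  · have h3 := B x₀ le_rfl (x / x₀) ((one_le_div hx0).2 hx)
    rw [mul_div_cancel₀ _ hx0.ne'] at h3
    have h4 : (x / x₀) ^ p ≤ y ^ (-p) := by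
      rw [Real.rpow_neg hy.le, ← Real.inv_rpow hy.le]
      refine Real.rpow_le_rpow (by positivity) ?_ hp0
      rw [div_le_iff₀ hx0, ← div_eq_inv_mul, le_div_iff₀ hy]
      linarith
    -- Below `x₀` regular variation says nothing. Here `T ≤ 1` is used, together with the lower
    -- bound for `T x` that comes from comparing it with `T x₀`; this is the source of the term `2 ^
    -- p / T x₀`.
    calc T (y * x) ≤ 1 := hT.le_one _
      _ ≤ 2 ^ p / T x₀ * y ^ (-p) * T x := by
        rw [div_mul_eq_mul_div, div_mul_eq_mul_div, le_div_iff₀ hTx0, one_mul]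
        refine h3.trans ?_
        gcongr
      _ ≤ _ := by
        gcongr
        · have : 0 < (2 : ℝ) ^ q := by positivity
          have : 0 < (2 : ℝ) ^ p := by positivity
          linarith
        · linarith

lemma integrableOn_mul_rpow_add_rpow {g : ℝ → ℂ} (hg : Measurable g) {C p q p' q' : ℝ}
    (hpp : p' < p) (hqq : q < q') (hqp : q' ≤ p') (hg1 : ∀ u, 0 < u → ‖g u‖ ≤ C * u ^ (p - 1))
    (hg2 : ∀ u, 0 < u → ‖g u‖ ≤ C * u ^ (q - 1)) :
    IntegrableOn (fun u => ‖g u‖ * (u ^ (-p') + u ^ (-q'))) (Set.Ioi 0) := by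
  have hC : 0 ≤ C := by
    have := hg1 1 one_pos
    rw [Real.one_rpow, mul_one] at this
    exact (norm_nonneg _).trans this
  have hm : Measurable fun u : ℝ => ‖g u‖ * (u ^ (-p') + u ^ (-q')) := by fun_prop
  rw [← Set.Ioc_union_Ioi_eq_Ioi zero_le_one, integrableOn_union]
  constructor
  · have h1 : IntegrableOn (fun u : ℝ => C * 2 * u ^ (p - 1 - p')) (Set.Ioc 0 1) := by
      have := (intervalIntegral.intervalIntegrable_rpow' (a := 0) (b := 1)
        (r := p - 1 - p') (by linarith)).const_mul (C * 2)
      rwa [intervalIntegrable_iff_integrableOn_Ioc_of_le zero_le_one] at this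
    refine Integrable.mono' h1 hm.aestronglyMeasurable ?_
    filter_upwards [ae_restrict_mem measurableSet_Ioc] with u hu
    have h0 : 0 < u := hu.1
    rw [Real.norm_of_nonneg (by positivity), sub_eq_add_neg (p - 1), Real.rpow_add h0]
    have h2 : u ^ (-q') ≤ u ^ (-p') := Real.rpow_le_rpow_of_exponent_ge h0 hu.2 (by linarith)
    calc _ ≤ C * u ^ (p - 1) * (u ^ (-p') + u ^ (-p')) := by
          gcongr
          exact hg1 u h0
      _ = _ := by ring
  · have h1 : IntegrableOn (fun u : ℝ => C * 2 * u ^ (q - 1 - q')) (Set.Ioi 1) :=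
      (integrableOn_Ioi_rpow_of_lt (by linarith) one_pos).const_mul _
    refine Integrable.mono' h1 hm.aestronglyMeasurable ?_
    filter_upwards [ae_restrict_mem measurableSet_Ioi] with u hu
    have h0 : 0 < u := one_pos.trans hu
    rw [Real.norm_of_nonneg (by positivity), sub_eq_add_neg (q - 1), Real.rpow_add h0]
    have h2 : u ^ (-p') ≤ u ^ (-q') :=
      Real.rpow_le_rpow_of_exponent_le (le_of_lt hu) (by linarith)
    calc _ ≤ C * u ^ (q - 1) * (u ^ (-q') + u ^ (-q')) := by
          gcongr
          exact hg2 u h0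
      _ = _ := by ring

/-- Karamata's theorem for the expectation of `∫₀^{Y/x} g`, where the tail of `Y` is comparable with
the regularly varying tail `T`. -/
theorem IsRegVarTail.tendsto_integral_div {T : ℝ → ℝ} {α : ℝ} (hT : IsRegVarTail T α) (hα : 0 < α)
    {ρ : Measure ℝ} [IsFiniteMeasure ρ] {r : ℝ} (hρ : ∀ x, 0 < x → ρ.real (Set.Ioi x) ≤ T x)
    (hr : Tendsto (fun x => ρ.real (Set.Ioi x) / T x) atTop (𝓝 r)) {g : ℝ → ℂ} (hg : Measurable g)
    {C p q : ℝ} (hp : α < p) (hq : q < α) (hg1 : ∀ u, 0 < u → ‖g u‖ ≤ C * u ^ (p - 1))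
    (hg2 : ∀ u, 0 < u → ‖g u‖ ≤ C * u ^ (q - 1)) :
    (∀ᶠ x in atTop, Integrable (fun y => ∫ u in Set.Ioc 0 (y / x), g u) ρ) ∧
    Tendsto (fun x => (∫ y, (∫ u in Set.Ioc 0 (y / x), g u) ∂ρ) / (T x : ℂ)) atTop
      (𝓝 (r * ∫ u in Set.Ioi 0, g u * ((u ^ (-α) : ℝ) : ℂ))) := by
  obtain ⟨p', hp'1, hp'2⟩ := exists_between hp
  -- `max q 0` because the Potter bound needs a nonnegative lower exponent, while `q` itself may be
  -- negative.
  obtain ⟨q', hq'1, hq'2⟩ := exists_between (max_lt hq hα)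
  obtain ⟨K, x₀, hK, hx₀, hpot⟩ := hT.potter (p := p') (q := q') ((le_max_right _ _).trans hq'1.le)
    hq'2 hp'1
  have hD := integrableOn_mul_rpow_add_rpow hg hp'2 ((le_max_left _ _).trans_lt hq'1)
    (by linarith) hg1 hg2
  have hbound : ∀ x, x₀ ≤ x → ∀ u, 0 < u → ‖g u * (ρ.real (Set.Ioi (u * x)) : ℂ)‖ ≤
      ‖g u‖ * (u ^ (-p') + u ^ (-q')) * (K * T x) := by
    intro x hx u hu
    have hxp : 0 < x := hx₀.trans_le hx
    rw [norm_mul, Complex.norm_real, Real.norm_of_nonneg measureReal_nonneg]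
    calc _ ≤ ‖g u‖ * (K * (u ^ (-p') + u ^ (-q')) * T x) := by
          gcongr
          exact (hρ _ (by positivity)).trans (hpot x hx u hu)
      _ = _ := by ring
  have hRm : ∀ x : ℝ, 0 < x → Measurable fun u : ℝ => ρ.real (Set.Ioi (u * x)) := by
    intro x hx
    have : Antitone fun u : ℝ => ρ.real (Set.Ioi (u * x)) := fun a b hab =>
      measureReal_mono (Set.Ioi_subset_Ioi (by gcongr))
    exact this.measurable
  have hgR : ∀ x, x₀ ≤ x → IntegrableOn (fun u => g u * (ρ.real (Set.Ioi (u * x)) : ℂ)) (Set.Ioi 0) := by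
    intro x hx
    refine Integrable.mono' (hD.mul_const (K * T x)) ?_ ?_
    · have := hRm x (hx₀.trans_le hx)
      exact (hg.mul (by fun_prop)).aestronglyMeasurable
    · filter_upwards [ae_restrict_mem measurableSet_Ioi] with u hu
      exact hbound x hx u hu
  have hfub : ∀ x, x₀ ≤ x → Integrable (fun y => ∫ u in Set.Ioc 0 (y / x), g u) ρ ∧
      ∫ y, (∫ u in Set.Ioc 0 (y / x), g u) ∂ρ =
        ∫ u in Set.Ioi 0, g u * (ρ.real (Set.Ioi (u * x)) : ℂ) := by
    intro x hx
    have hxp : 0 < x := hx₀.trans_le hx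
    -- Layer cake: exchanging the integrals over `u < y / x` turns the expectation into `∫ g u * P(Y
    -- > u x) du`.
    set F : ℝ → ℝ → ℂ := fun y u => {z : ℝ × ℝ | z.2 * x < z.1}.indicator (fun z => g z.2) (y, u)
    have hmset : MeasurableSet {z : ℝ × ℝ | z.2 * x < z.1} :=
      measurableSet_lt (by fun_prop) (by fun_prop)
    have hFm : Measurable (Function.uncurry F) :=
      (hg.comp measurable_snd).indicator hmset
    have hFy : ∀ u y, F y u = (Set.Ioi (u * x)).indicator (fun _ => g u) y := by
      intro u y
      simp only [F, Set.indicator_apply, Set.mem_ofPred_eq, Set.mem_Ioi]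
    have hFint : Integrable (Function.uncurry F) (ρ.prod (volume.restrict (Set.Ioi 0))) := by
      rw [integrable_prod_iff' hFm.aestronglyMeasurable]
      constructor
      · refine ae_of_all _ fun u => ?_
        simp only [Function.uncurry, hFy]
        exact (integrable_const _).indicator measurableSet_Ioi
      · refine (hgR x hx).norm.congr (ae_of_all _ fun u => ?_)
        simp only [Function.uncurry, hFy, norm_indicator_eq_indicator_norm]
        rw [integral_indicator_const _ measurableSet_Ioi, norm_mul, Complex.norm_real,
          Real.norm_of_nonneg measureReal_nonneg, smul_eq_mul, mul_comm]
    have hFu : ∀ y, ∫ u in Set.Ioi 0, F y u = ∫ u in Set.Ioc 0 (y / x), g u := by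
      intro y
      have : ∀ u, F y u = (Set.Iio (y / x)).indicator g u := by
        intro u
        simp only [F, Set.indicator_apply, Set.mem_ofPred_eq, Set.mem_Iio, lt_div_iff₀ hxp]
      simp only [this]
      rw [setIntegral_indicator measurableSet_Iio, Set.Ioi_inter_Iio, integral_Ioc_eq_integral_Ioo]
    have h1 := integral_integral_swap hFint
    have h2 := hFint.integral_prod_left
    simp only [Function.uncurry, hFu] at h1 h2
    refine ⟨h2, h1.trans (integral_congr_ae (ae_of_all _ fun u => ?_))⟩
    simp only [hFy]
    rw [integral_indicator_const _ measurableSet_Ioi, Complex.real_smul, mul_comm]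
  refine ⟨(eventually_ge_atTop x₀).mono fun x hx => (hfub x hx).1, ?_⟩
  have hlim : Tendsto (fun x => ∫ u in Set.Ioi 0, g u * ((ρ.real (Set.Ioi (u * x)) / T x : ℝ) : ℂ))
      atTop (𝓝 (∫ u in Set.Ioi 0, g u * ((r * u ^ (-α) : ℝ) : ℂ))) := by
    refine tendsto_integral_filter_of_dominated_convergence
      (fun u => ‖g u‖ * (u ^ (-p') + u ^ (-q')) * K) ?_ ?_ (hD.mul_const K) ?_
    · filter_upwards [eventually_gt_atTop 0] with x hx
      have := hRm x hx
      exact (hg.mul (by fun_prop)).aestronglyMeasurable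
    · filter_upwards [eventually_ge_atTop x₀] with x hx
      filter_upwards [ae_restrict_mem measurableSet_Ioi] with u hu
      have h1 := hbound x hx u hu
      have h2 := hT.pos x
      push_cast
      rw [← mul_div_assoc, norm_div, Complex.norm_real (T x), Real.norm_of_nonneg h2.le,
        div_le_iff₀ h2]
      linarith
    · filter_upwards [ae_restrict_mem measurableSet_Ioi] with u hu
      refine Tendsto.const_mul _ ((Complex.continuous_ofReal.tendsto _).comp ?_)
      -- The ratio `P(Y > u x) / T x` factors through `T (u x)`: the first factor tends to `r`, the
      -- second to `u ^ (-α)`.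
      have h1 := (hr.comp (tendsto_id.const_mul_atTop hu)).mul (hT.ratio u hu)
      refine h1.congr fun x => ?_
      have := (hT.pos (u * x)).ne'
      simp only [Function.comp, id]
      field_simp
  have heq : ∫ u in Set.Ioi 0, g u * ((r * u ^ (-α) : ℝ) : ℂ) =
      r * ∫ u in Set.Ioi 0, g u * ((u ^ (-α) : ℝ) : ℂ) := by
    rw [← integral_const_mul]
    refine integral_congr_ae (ae_of_all _ fun u => ?_)
    push_cast
    ring
  rw [← heq]
  refine hlim.congr' ?_
  filter_upwards [eventually_ge_atTop x₀] with x hx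
  rw [(hfub x hx).2, ← integral_div]
  refine integral_congr_ae (ae_of_all _ fun u => ?_)
  push_cast
  ring

/-! ### Gamma-type integrals with complex parameter and the Dirichlet integral -/

lemma norm_cexp_neg_mul_sub_one_le {z : ℂ} (hz : 0 ≤ z.re) {u : ℝ} (hu : 0 ≤ u) :
    ‖1 - Complex.exp (-(z * u))‖ ≤ 2 ∧ ‖1 - Complex.exp (-(z * u))‖ ≤ 2 * (‖z‖ * u) := by
  have h1 : ‖Complex.exp (-(z * u))‖ ≤ 1 := by
    rw [Complex.norm_exp, Real.exp_le_one_iff]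
    simp
    positivity
  have h2 : ‖1 - Complex.exp (-(z * u))‖ ≤ 2 := by
    refine (norm_sub_le _ _).trans ?_
    rw [norm_one]
    linarith
  refine ⟨h2, ?_⟩
  have h3 : ‖-(z * u)‖ = ‖z‖ * u := by rw [norm_neg, norm_mul, Complex.norm_real, Real.norm_of_nonneg hu]
  rcases le_or_gt (‖z‖ * u) 1 with h | h
  · have := Complex.norm_exp_sub_one_le (x := -(z * u)) (by rw [h3]; exact h)
    rwa [h3, norm_sub_rev] at this
  · linarith

/-- Analytic continuation from `z > 0`: as a function of `w = -z` the left side is the complex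
moment generating function of `u ^ (a - 1) du`, hence analytic on `Re w < 0`. -/
lemma integral_cexp_mul_rpow {a : ℝ} (ha : 0 < a) {z : ℂ} (hz : 0 < z.re) :
    ∫ u in Set.Ioi (0 : ℝ), Complex.exp (-(z * u)) * ((u ^ (a - 1) : ℝ) : ℂ) =
      z ^ (-a : ℂ) * Complex.Gamma a := by
  set m : Measure ℝ := (volume.restrict (Set.Ioi 0)).withDensity
    (fun u => ENNReal.ofReal (u ^ (a - 1))) with hm
  have hmeas : Measurable fun u : ℝ => ENNReal.ofReal (u ^ (a - 1)) := by fun_prop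
  have hmgf : ∀ w : ℂ, complexMGF id m w =
      ∫ u in Set.Ioi (0 : ℝ), Complex.exp (w * u) * ((u ^ (a - 1) : ℝ) : ℂ) := by
    intro w
    rw [complexMGF, hm, integral_withDensity_eq_integral_toReal_smul hmeas (by simp)]
    refine setIntegral_congr_fun measurableSet_Ioi fun u hu => ?_
    simp only [id]
    rw [ENNReal.toReal_ofReal (Real.rpow_nonneg (le_of_lt hu) _), Complex.real_smul, mul_comm]
  have hset : Set.Iio (0 : ℝ) ⊆ interior (integrableExpSet id m) := by
    refine interior_maximal (fun t ht => ?_) isOpen_Iio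
    have ht0 : 0 < -t := neg_pos.2 ht
    have h1 := (integrableOn_rpow_mul_exp_neg_mul_rpow (s := a - 1) (p := 1) (b := -t) (by linarith)
      one_pos ht0)
    rw [integrableExpSet, Set.mem_ofPred_eq, hm,
      integrable_withDensity_iff_integrable_smul' hmeas (by simp)]
    refine h1.congr ?_
    filter_upwards [ae_restrict_mem measurableSet_Ioi] with u hu
    rw [ENNReal.toReal_ofReal (Real.rpow_nonneg (le_of_lt hu) _), Real.rpow_one, smul_eq_mul]
    simp
  have hopen : IsOpen {w : ℂ | w.re < 0} := isOpen_lt Complex.continuous_re continuous_const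
  have hd1 : AnalyticOnNhd ℂ (complexMGF id m) {w : ℂ | w.re < 0} :=
    (differentiableOn_complexMGF.mono fun w hw => hset hw).analyticOnNhd hopen
  have hd2 : AnalyticOnNhd ℂ (fun w : ℂ => (-w) ^ (-a : ℂ) * Complex.Gamma a) {w : ℂ | w.re < 0} := by
    refine DifferentiableOn.analyticOnNhd (fun w hw => ?_) hopen
    have : -w ∈ Complex.slitPlane := Or.inl (by simpa using hw)
    exact (((differentiableAt_id.neg).cpow_const this).mul_const _).differentiableWithinAt
  have hpre : IsPreconnected {w : ℂ | w.re < 0} :=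
    (convex_halfSpace_re_lt 0).isPreconnected
  have hreal : ∀ t : ℝ, 0 < t → complexMGF id m (-t : ℂ) = (-(-t : ℂ)) ^ (-a : ℂ) * Complex.Gamma a := by
    intro t ht
    rw [hmgf, neg_neg]
    have := Complex.integral_cpow_mul_exp_neg_mul_Ioi (a := a) (r := t) (by simpa using ha) ht
    rw [one_div, Complex.inv_cpow _ _ (by
      rw [Complex.arg_ofReal_of_nonneg ht.le]; exact Real.pi_pos.ne), ← Complex.cpow_neg] at this
    rw [← this]
    refine setIntegral_congr_fun measurableSet_Ioi fun u hu => ?_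
    rw [Complex.ofReal_cpow (le_of_lt hu), mul_comm]
    push_cast
    rw [neg_mul]
  have hfreq : ∃ᶠ w in 𝓝[≠] (-1 : ℂ), complexMGF id m w = (-w) ^ (-a : ℂ) * Complex.Gamma a := by
    -- Real points accumulating at `-1` without reaching it, as the identity theorem requires.
    have h1 : Tendsto (fun n : ℕ => (-((1 + 1 / ((n : ℝ) + 1) : ℝ) : ℂ))) atTop (𝓝[≠] (-1 : ℂ)) := by
      rw [tendsto_nhdsWithin_iff]
      constructor
      · have h2 : Tendsto (fun n : ℕ => (1 + 1 / ((n : ℝ) + 1) : ℝ)) atTop (𝓝 1) := by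
          simpa using (tendsto_one_div_add_atTop_nhds_zero_nat (𝕜 := ℝ)).const_add 1
        have := ((Complex.continuous_ofReal.tendsto _).comp h2).neg
        simpa using this
      · refine Eventually.of_forall fun n => ?_
        have : (0 : ℝ) < 1 / ((n : ℝ) + 1) := by positivity
        simp only [Set.mem_compl_iff, Set.mem_singleton_iff, neg_inj]
        rw [← Complex.ofReal_one, Complex.ofReal_inj]
        linarith
    refine h1.frequently (Frequently.of_forall fun n => ?_)
    exact hreal _ (by positivity)
  have := hd1.eqOn_of_preconnected_of_frequently_eq hd2 hpre (z₀ := -1) (by simp) hfreq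
    (show -z ∈ {w : ℂ | w.re < 0} by simpa using hz)
  simp only [hmgf, neg_neg, neg_mul] at this
  exact this

lemma integrableOn_min_mul_rpow {β : ℝ} (h0 : 0 < β) (h1 : β < 1) :
    IntegrableOn (fun u : ℝ => min 1 u * u ^ (-β - 1)) (Set.Ioi 0) := by
  have := integrableOn_mul_rpow_add_rpow (g := fun u : ℝ => ((min 1 u : ℝ) : ℂ)) (by fun_prop)
    (C := 1) (p := 2) (q := 1) (p' := β + 1) (q' := β + 1) (by linarith) (by linarith) le_rfl
    (fun u hu => by
      rw [Complex.norm_real, Real.norm_of_nonneg (by positivity)]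
      norm_num)
    (fun u hu => by
      rw [Complex.norm_real, Real.norm_of_nonneg (by positivity)]
      norm_num)
  refine (this.div_const 2).congr ?_
  filter_upwards [ae_restrict_mem measurableSet_Ioi] with u hu
  have hu0 : 0 < u := hu
  rw [Complex.norm_real, Real.norm_of_nonneg (by positivity), neg_add']
  ring

/-- Integration by parts against `-u ^ (-β) / β`. Both boundary terms vanish because `1 - exp (-z
u)` is `O(min 1 u)` and `0 < β < 1`. -/
lemma integral_one_sub_cexp_mul_rpow_of_re_pos {β : ℝ} (h0 : 0 < β) (h1 : β < 1) {z : ℂ}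
    (hz : 0 < z.re) :
    ∫ u in Set.Ioi (0 : ℝ), (1 - Complex.exp (-(z * u))) * ((u ^ (-β - 1) : ℝ) : ℂ) =
      z ^ (β : ℂ) * Complex.Gamma (1 - β) / β := by
  have hz0 : z ≠ 0 := by rintro rfl; simp at hz
  have hβ : (β : ℂ) ≠ 0 := by exact_mod_cast h0.ne'
  set F : ℝ → ℂ := fun u => 1 - Complex.exp (-(z * u))
  set G : ℝ → ℂ := fun u => ((-(u ^ (-β)) / β : ℝ) : ℂ)
  have hF : ∀ u : ℝ, HasDerivAt F (z * Complex.exp (-(z * u))) u := by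
    intro u
    have h2 : HasDerivAt (fun u : ℝ => -(z * (u : ℂ))) (-z) u := by
      have := ((hasDerivAt_id (u : ℂ)).comp_ofReal.const_mul z).neg
      rw [mul_one] at this
      exact this
    refine (h2.cexp.const_sub 1).congr_deriv ?_
    ring
  have hG : ∀ u : ℝ, 0 < u → HasDerivAt G (((u ^ (-β - 1) : ℝ) : ℂ)) u := by
    intro u hu
    have h2 := ((Real.hasDerivAt_rpow_const (x := u) (p := -β) (Or.inl hu.ne')).neg.div_const β)
    refine h2.ofReal_comp.congr_deriv ?_
    congr 1
    field_simp
  have hbd : ∀ u : ℝ, 0 < u → ‖F u‖ ≤ (2 + 2 * ‖z‖) * min 1 u := by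
    intro u hu
    have := norm_cexp_neg_mul_sub_one_le hz.le hu.le
    rcases min_cases 1 u with ⟨h, h'⟩ | ⟨h, h'⟩ <;> rw [h]
    · nlinarith [this.1, norm_nonneg z]
    · nlinarith [this.2, norm_nonneg z]
  have hFc : Continuous F := by fun_prop
  have hFG' : IntegrableOn (F * fun u => ((u ^ (-β - 1) : ℝ) : ℂ)) (Set.Ioi 0) := by
    refine Integrable.mono' ((integrableOn_min_mul_rpow h0 h1).const_mul (2 + 2 * ‖z‖)) ?_ ?_
    · exact (hFc.measurable.mul (by fun_prop)).aestronglyMeasurable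
    · filter_upwards [ae_restrict_mem measurableSet_Ioi] with u hu
      have hu0 : 0 < u := hu
      rw [Pi.mul_apply, norm_mul, Complex.norm_real, Real.norm_of_nonneg (by positivity), ← mul_assoc]
      gcongr
      exact hbd u hu
  have hF'G : IntegrableOn ((fun u : ℝ => z * Complex.exp (-(z * u))) * G) (Set.Ioi 0) := by
    have h2 := (integrableOn_rpow_mul_exp_neg_mul_rpow (s := -β) (p := 1) (b := z.re) (by linarith)
      one_pos hz).const_mul (‖z‖ / β)
    refine Integrable.mono' h2 ?_ ?_
    · refine Measurable.aestronglyMeasurable (Measurable.mul (by fun_prop) (by fun_prop))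
    · filter_upwards [ae_restrict_mem measurableSet_Ioi] with u hu
      have hu0 : 0 < u := hu
      rw [Pi.mul_apply, norm_mul, norm_mul, Complex.norm_real, Complex.norm_exp, Real.norm_eq_abs,
        abs_div, abs_neg, abs_of_pos h0, abs_of_pos (by positivity : 0 < u ^ (-β)), Real.rpow_one]
      simp
      refine le_of_eq ?_
      ring
  have hlim0 : Tendsto (F * G) (𝓝[>] 0) (𝓝 0) := by
    rw [tendsto_zero_iff_norm_tendsto_zero]
    have h3 : Tendsto (fun u : ℝ => (2 + 2 * ‖z‖) / β * u ^ (1 - β)) (𝓝[>] 0) (𝓝 0) := by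
      have : Tendsto (fun u : ℝ => u ^ (1 - β)) (𝓝 0) (𝓝 (0 ^ (1 - β))) :=
        (Real.continuousAt_rpow_const 0 (1 - β) (Or.inr (by linarith))).tendsto
      rw [Real.zero_rpow (by linarith)] at this
      simpa using (this.const_mul ((2 + 2 * ‖z‖) / β)).mono_left nhdsWithin_le_nhds
    refine squeeze_zero' (Eventually.of_forall fun _ => norm_nonneg _) ?_ h3
    filter_upwards [self_mem_nhdsWithin] with u hu
    have hu0 : 0 < u := hu
    rw [Pi.mul_apply, norm_mul, Complex.norm_real, Real.norm_eq_abs, abs_div, abs_neg,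
      abs_of_pos h0, abs_of_pos (by positivity : 0 < u ^ (-β)), sub_eq_add_neg, Real.rpow_add hu0,
      Real.rpow_one]
    calc _ ≤ (2 + 2 * ‖z‖) * u * (u ^ (-β) / β) := by
          gcongr
          exact (hbd u hu).trans (by gcongr; exact min_le_right _ _)
      _ = _ := by ring
  have hlim1 : Tendsto (F * G) atTop (𝓝 0) := by
    rw [tendsto_zero_iff_norm_tendsto_zero]
    have h3 : Tendsto (fun u : ℝ => (2 + 2 * ‖z‖) / β * u ^ (-β)) atTop (𝓝 0) := by
      simpa using (tendsto_rpow_neg_atTop h0).const_mul ((2 + 2 * ‖z‖) / β)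
    refine squeeze_zero' (Eventually.of_forall fun _ => norm_nonneg _) ?_ h3
    filter_upwards [eventually_gt_atTop 0] with u hu0
    rw [Pi.mul_apply, norm_mul, Complex.norm_real, Real.norm_eq_abs, abs_div, abs_neg,
      abs_of_pos h0, abs_of_pos (by positivity : 0 < u ^ (-β))]
    calc _ ≤ (2 + 2 * ‖z‖) * 1 * (u ^ (-β) / β) := by
          gcongr
          exact (hbd u hu0).trans (by gcongr; exact min_le_left _ _)
      _ = _ := by ring
  have key := integral_Ioi_mul_deriv_eq_deriv_mul (fun u _ => hF u) (fun u hu => hG u hu) hFG' hF'G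
    hlim0 hlim1
  have h4 := integral_cexp_mul_rpow (a := 1 - β) (by linarith) hz
  rw [key, sub_zero, zero_sub, ← integral_neg]
  have h5 : ∀ u : ℝ, -(z * Complex.exp (-(z * u)) * G u) =
      z / β * (Complex.exp (-(z * u)) * ((u ^ (1 - β - 1) : ℝ) : ℂ)) := by
    intro u
    simp only [G]
    rw [show 1 - β - 1 = -β by ring]
    push_cast
    field_simp
  simp only [h5]
  rw [integral_const_mul, h4]
  have h6 : z * z ^ (-((1 - β : ℝ) : ℂ)) = z ^ (β : ℂ) := by
    nth_rewrite 1 [← Complex.cpow_one z]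
    rw [← Complex.cpow_add _ _ hz0]
    congr 1
    push_cast
    ring
  rw [← h6]
  push_cast
  ring

lemma tendsto_ofReal_sub_I : Tendsto (fun r : ℝ => (r : ℂ) - Complex.I) (𝓝[>] 0) (𝓝 (-Complex.I)) := by
  have : Tendsto (fun r : ℝ => (r : ℂ) - Complex.I) (𝓝 0) (𝓝 (((0 : ℝ) : ℂ) - Complex.I)) :=
    (by fun_prop : Continuous fun r : ℝ => (r : ℂ) - Complex.I).tendsto 0
  rw [Complex.ofReal_zero, zero_sub] at this
  exact this.mono_left nhdsWithin_le_nhds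

lemma neg_I_cpow (β : ℝ) :
    (-Complex.I) ^ (β : ℂ) = Complex.exp (-(Real.pi * β / 2 : ℝ) * Complex.I) := by
  rw [Complex.cpow_def_of_ne_zero (by simp), Complex.log_neg_I]
  congr 1
  push_cast
  ring

lemma tendsto_sub_I_cpow (β : ℝ) : Tendsto (fun r : ℝ => ((r : ℂ) - Complex.I) ^ (β : ℂ)) (𝓝[>] 0)
    (𝓝 (Complex.exp (-(Real.pi * β / 2 : ℝ) * Complex.I))) := by
  rw [← neg_I_cpow]
  have h : ContinuousAt (fun z : ℂ => z ^ (β : ℂ)) (-Complex.I) :=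
    continuousAt_cpow_const (by simp [Complex.slitPlane])
  exact h.tendsto.comp tendsto_ofReal_sub_I

/-- The boundary value at `z = -i`, reached along `z = r - i` with `r ↓ 0`. The integrand is
dominated uniformly in `r < 1`, unlike the one for `exp (-z u)` alone. -/
lemma integral_one_sub_cexp_mul_rpow {β : ℝ} (h0 : 0 < β) (h1 : β < 1) :
    ∫ u in Set.Ioi (0 : ℝ), (1 - Complex.exp (u * Complex.I)) * ((u ^ (-β - 1) : ℝ) : ℂ) =
      Complex.exp (-(Real.pi * β / 2 : ℝ) * Complex.I) * Complex.Gamma (1 - β) / β := by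
  have h2 : Tendsto (fun r : ℝ => ∫ u in Set.Ioi (0 : ℝ),
      (1 - Complex.exp (-(((r : ℂ) - Complex.I) * u))) * ((u ^ (-β - 1) : ℝ) : ℂ)) (𝓝[>] 0)
      (𝓝 (∫ u in Set.Ioi (0 : ℝ), (1 - Complex.exp (-(-Complex.I * u))) * ((u ^ (-β - 1) : ℝ) : ℂ))) := by
    refine tendsto_integral_filter_of_dominated_convergence
      (fun u => 6 * (min 1 u * u ^ (-β - 1))) (Eventually.of_forall fun r => ?_) ?_
      ((integrableOn_min_mul_rpow h0 h1).const_mul _) (ae_of_all _ fun u => ?_)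
    · exact Measurable.aestronglyMeasurable (Measurable.mul (by fun_prop) (by fun_prop))
    · have h3 : ∀ᶠ r : ℝ in 𝓝[>] 0, r < 1 :=
        nhdsWithin_le_nhds (gt_mem_nhds one_pos)
      filter_upwards [h3, self_mem_nhdsWithin] with r hr1 hr0
      have hr0 : 0 < r := hr0
      filter_upwards [ae_restrict_mem measurableSet_Ioi] with u hu
      have hu0 : 0 < u := hu
      have h4 := norm_cexp_neg_mul_sub_one_le (z := (r : ℂ) - Complex.I) (by simpa using hr0.le) hu0.le
      have h5 : ‖(r : ℂ) - Complex.I‖ ≤ 2 := by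
        refine (norm_sub_le _ _).trans ?_
        rw [Complex.norm_real, Complex.norm_I, Real.norm_of_nonneg hr0.le]
        linarith
      rw [norm_mul, Complex.norm_real, Real.norm_of_nonneg (by positivity), ← mul_assoc]
      gcongr
      rcases min_cases 1 u with ⟨h, h'⟩ | ⟨h, h'⟩ <;> rw [h]
      · linarith [h4.1]
      · nlinarith [h4.2]
    · refine Tendsto.mul_const _ (Tendsto.const_sub _ ?_)
      exact (Complex.continuous_exp.tendsto _).comp ((tendsto_ofReal_sub_I.mul_const _).neg)
  have h3 := ((tendsto_sub_I_cpow β).mul_const (Complex.Gamma (1 - β))).div_const (β : ℂ)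
  have h4 := tendsto_nhds_unique h2 (h3.congr' (by
    filter_upwards [self_mem_nhdsWithin] with r hr
    exact (integral_one_sub_cexp_mul_rpow_of_re_pos h0 h1 (by simpa using hr)).symm))
  rw [← h4]
  refine integral_congr_ae (ae_of_all _ fun u => ?_)
  simp only
  rw [neg_mul, neg_neg, mul_comm Complex.I]

/-- The Dirichlet integral from the mass of the Fejér kernel: `u * fejer u / 2 = (1 - cos u) / u`
has derivative `sinc u - fejer u / 2` and tends to `0`. -/
lemma tendsto_integral_sinc : Tendsto (fun X : ℝ => ∫ u in (0 : ℝ)..X, Real.sinc u) atTop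
    (𝓝 (Real.pi / 2)) := by
  have hfj := continuous_fejer
  have h1 : ∀ X : ℝ, 0 < X → ∫ u in (0 : ℝ)..X, Real.sinc u =
      X * fejer X / 2 + (∫ u in (0 : ℝ)..X, fejer u) / 2 := by
    intro X hX
    have h2 := intervalIntegral.integral_eq_sub_of_hasDerivAt_of_le (a := 0) (b := X) hX.le
      (f := fun u => u * fejer u / 2) (f' := fun u => Real.sinc u - fejer u / 2)
      (by fun_prop) (fun u hu => ?_)
      ((Real.continuous_sinc.sub (hfj.div_const 2)).intervalIntegrable _ _)
    · rw [intervalIntegral.integral_sub (Real.continuous_sinc.intervalIntegrable _ _)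
        ((hfj.div_const 2).intervalIntegrable _ _), intervalIntegral.integral_div] at h2
      simp only [zero_mul, zero_div, sub_zero] at h2
      linarith
    · have hu0 : u ≠ 0 := hu.1.ne'
      have h3 : HasDerivAt (fun u : ℝ => (1 - Real.cos u) / u)
          ((Real.sin u * u - (1 - Real.cos u) * 1) / u ^ 2) u := by
        have := ((Real.hasDerivAt_cos u).const_sub 1).div (hasDerivAt_id u) hu0
        rw [neg_neg] at this
        exact this
      have h4 : (fun u : ℝ => u * fejer u / 2) =ᶠ[𝓝 u] fun u => (1 - Real.cos u) / u := by
        filter_upwards [isOpen_ne.mem_nhds hu0] with v hv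
        have hv : v ≠ 0 := hv
        rw [fejer_of_ne_zero hv]
        field_simp
      refine (h3.congr_of_eventuallyEq h4).congr_deriv ?_
      rw [Real.sinc_of_ne_zero hu0, fejer_of_ne_zero hu0]
      field_simp
  have h2 : Tendsto (fun X : ℝ => X * fejer X / 2) atTop (𝓝 0) := by
    have h3 : Tendsto (fun X : ℝ => 2 * X⁻¹) atTop (𝓝 0) := by
      simpa using tendsto_inv_atTop_zero.const_mul (2 : ℝ)
    refine squeeze_zero' ?_ ?_ h3
    · filter_upwards [eventually_ge_atTop 0] with X hX
      have := fejer_nonneg X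
      positivity
    · filter_upwards [eventually_gt_atTop 0] with X hX
      have := fejer_mul_sq_le X
      rw [← div_eq_mul_inv, le_div_iff₀ hX]
      nlinarith
  have h3 : Tendsto (fun X : ℝ => ∫ u in (0 : ℝ)..X, fejer u) atTop (𝓝 Real.pi) := by
    have h4 := intervalIntegral_tendsto_integral_Ioi (f := fejer) (μ := volume) 0
      integrable_fejer.integrableOn tendsto_id
    have h5 := integral_comp_abs (f := fejer)
    have h6 : ∀ x, fejer |x| = fejer x := fun x => by
      rcases abs_cases x with ⟨h, -⟩ | ⟨h, -⟩ <;> rw [h]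
      exact fejer_neg x
    simp only [h6, integral_fejer] at h5
    have h7 : ∫ x in Set.Ioi 0, fejer x = Real.pi := by linarith
    rwa [h7] at h4
  have := h2.add (h3.div_const 2)
  rw [zero_add] at this
  refine this.congr' ?_
  filter_upwards [eventually_gt_atTop 0] with X hX
  exact (h1 X hX).symm

/-! ### The characteristic function near zero for a one-sided regularly varying tail -/

/-- Exchange of two limits when the approximation error is itself asymptotically known, with a limit
that becomes small. It serves the two cases where the kernel decays too slowly for a direct use of
Karamata's theorem. -/
lemma tendsto_of_approx {ι κ : Type*} {l : Filter ι} {l' : Filter κ} [l'.NeBot] {F : ι → ℂ}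
    {G E : κ → ι → ℂ} {b e : κ → ℂ} {c : ℂ} (hG : ∀ᶠ k in l', Tendsto (G k) l (𝓝 (b k)))
    (hE : ∀ᶠ k in l', Tendsto (E k) l (𝓝 (e k)))
    (hF : ∀ᶠ k in l', ∀ᶠ x in l, ‖F x - G k x‖ ≤ ‖E k x‖) (hb : Tendsto b l' (𝓝 c))
    (he : Tendsto e l' (𝓝 0)) : Tendsto F l (𝓝 c) := by
  rw [Metric.tendsto_nhds]
  intro ε hε
  have h1 : ∀ᶠ k in l', dist (b k) c < ε / 4 := (Metric.tendsto_nhds.1 hb) _ (by positivity)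
  have h2 : ∀ᶠ k in l', dist (e k) 0 < ε / 4 := (Metric.tendsto_nhds.1 he) _ (by positivity)
  obtain ⟨k, hGk, hEk, hFk, hbk, hek⟩ := (hG.and (hE.and (hF.and (h1.and h2)))).exists
  filter_upwards [(Metric.tendsto_nhds.1 hGk) (ε / 4) (by positivity),
    (Metric.tendsto_nhds.1 hEk) (ε / 4) (by positivity), hFk] with x hx1 hx2 hx3
  have h3 : dist (F x) c ≤ dist (F x) (G k x) + dist (G k x) (b k) + dist (b k) c :=
    dist_triangle4 _ _ _ _
  have h4 : ‖E k x‖ ≤ dist (E k x) (e k) + dist (e k) 0 := by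
    rw [← dist_zero_right]; exact dist_triangle _ _ _
  rw [← dist_eq_norm] at hx3
  linarith

lemma setIntegral_Ioi_eq_integral_primitive {ρ : Measure ℝ} {g H : ℝ → ℂ}
    (hH : ∀ v, 0 < v → H v = ∫ u in Set.Ioc 0 v, g u) {x : ℝ} (hx : 0 < x) :
    ∫ y in Set.Ioi 0, H (y / x) ∂ρ = ∫ y, (∫ u in Set.Ioc 0 (y / x), g u) ∂ρ := by
  rw [← integral_indicator measurableSet_Ioi]
  refine integral_congr_ae (ae_of_all _ fun y => ?_)
  by_cases hy : 0 < y
  · rw [Set.indicator_of_mem (by exact hy)]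
    exact hH _ (by positivity)
  · rw [Set.indicator_of_notMem (by exact hy)]
    have : y / x ≤ 0 := div_nonpos_of_nonpos_of_nonneg (not_lt.1 hy) hx.le
    simp [Set.Ioc_eq_empty (not_lt.2 this)]

lemma primitive_of_hasDerivAt {g H : ℝ → ℂ} (hg : Continuous g) (hd : ∀ u, HasDerivAt H (g u) u)
    (h0 : H 0 = 0) (v : ℝ) (hv : 0 < v) : H v = ∫ u in Set.Ioc 0 v, g u := by
  rw [← intervalIntegral.integral_of_le hv.le,
    intervalIntegral.integral_eq_sub_of_hasDerivAt (fun u _ => hd u) (hg.intervalIntegrable _ _), h0,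
    sub_zero]

lemma hasDerivAt_one_sub_cexp_neg_mul (z : ℂ) (u : ℝ) :
    HasDerivAt (fun u : ℝ => 1 - Complex.exp (-(z * u))) (z * Complex.exp (-(z * u))) u := by
  have h2 : HasDerivAt (fun u : ℝ => -(z * (u : ℂ))) (-z) u := by
    have := ((hasDerivAt_id (u : ℂ)).comp_ofReal.const_mul z).neg
    rw [mul_one] at this
    exact this
  refine (h2.cexp.const_sub 1).congr_deriv ?_
  ring

section Tail

variable {T : ℝ → ℝ} {α : ℝ} {ρ : Measure ℝ} [IsFiniteMeasure ρ] {r : ℝ}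

/-- Karamata's theorem for `g u = z * exp (-z u)`: exponential damping makes `g` bounded and
`O(1/u)`, which are the two bounds for the exponents `p = 1` and `q = 0`. -/
lemma IsRegVarTail.tendsto_laplace (hT : IsRegVarTail T α) (hα0 : 0 < α) (hα1 : α < 1)
    (hρ : ∀ x, 0 < x → ρ.real (Set.Ioi x) ≤ T x)
    (hr : Tendsto (fun x => ρ.real (Set.Ioi x) / T x) atTop (𝓝 r)) {z : ℂ} (hz : 0 < z.re) :
    Tendsto (fun x : ℝ => (∫ y in Set.Ioi 0, (1 - Complex.exp (-(z * (y / x : ℝ)))) ∂ρ) / (T x : ℂ))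
      atTop (𝓝 (r * (z ^ (α : ℂ) * Complex.Gamma (1 - α)))) := by
  have hz0 : z ≠ 0 := by rintro rfl; simp at hz
  have hg : Continuous fun u : ℝ => z * Complex.exp (-(z * u)) := by fun_prop
  have hnorm : ∀ u : ℝ, ‖z * Complex.exp (-(z * u))‖ = ‖z‖ * Real.exp (-(z.re * u)) := fun u => by
    rw [norm_mul, Complex.norm_exp]; simp
  have key := (hT.tendsto_integral_div hα0 hρ hr hg.measurable (C := ‖z‖ + ‖z‖ / z.re) (p := 1)
    (q := 0) hα1 hα0 (fun u hu => ?_) (fun u hu => ?_)).2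
  · have h1 := integral_cexp_mul_rpow (a := 1 - α) (by linarith) hz
    have h2 : ∫ u in Set.Ioi (0 : ℝ), z * Complex.exp (-(z * u)) * ((u ^ (-α) : ℝ) : ℂ) =
        z ^ (α : ℂ) * Complex.Gamma (1 - α) := by
      simp_rw [mul_assoc]
      rw [integral_const_mul]
      rw [show 1 - α - 1 = -α by ring] at h1
      rw [h1, ← mul_assoc]
      congr 1
      · nth_rewrite 1 [← Complex.cpow_one z]
        rw [← Complex.cpow_add _ _ hz0]
        congr 1
        push_cast
        ring
      · push_cast
        rfl
    rw [h2] at key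
    refine key.congr' ?_
    filter_upwards [eventually_gt_atTop 0] with x hx
    rw [← setIntegral_Ioi_eq_integral_primitive (H := fun v : ℝ => 1 - Complex.exp (-(z * v)))
      (primitive_of_hasDerivAt hg (hasDerivAt_one_sub_cexp_neg_mul z) (by simp)) hx]
  · rw [hnorm, sub_self, Real.rpow_zero, mul_one]
    have h1 : Real.exp (-(z.re * u)) ≤ 1 := Real.exp_le_one_iff.2 (by nlinarith)
    have h2 : 0 ≤ ‖z‖ / z.re := by positivity
    nlinarith [norm_nonneg z]
  · rw [hnorm, zero_sub, Real.rpow_neg_one]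
    have h1 : Real.exp (-(z.re * u)) ≤ (z.re * u)⁻¹ := by
      rw [Real.exp_neg]
      have := Real.add_one_le_exp (z.re * u)
      exact inv_anti₀ (by positivity) (by linarith)
    calc _ ≤ ‖z‖ * (z.re * u)⁻¹ := by gcongr
      _ = ‖z‖ / z.re * u⁻¹ := by rw [mul_inv]; ring
      _ ≤ _ := by gcongr; linarith [norm_nonneg z]

/-- At `z = -i` the kernel has constant modulus and Karamata's theorem does not apply, so `z = ε -
i` is used and `ε ↓ 0`. The damping error at `u` has modulus exactly `1 - exp (-ε u)`, whose
normalized integral is known from the case `z = ε` and tends to a multiple of `ε ^ α`. -/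
lemma IsRegVarTail.tendsto_charFun_of_lt_one (hT : IsRegVarTail T α) (hα0 : 0 < α) (hα1 : α < 1)
    (hρ : ∀ x, 0 < x → ρ.real (Set.Ioi x) ≤ T x)
    (hr : Tendsto (fun x => ρ.real (Set.Ioi x) / T x) atTop (𝓝 r)) :
    Tendsto (fun x : ℝ => (∫ y in Set.Ioi 0, (1 - Complex.exp ((y / x : ℝ) * Complex.I)) ∂ρ) / (T x : ℂ))
      atTop (𝓝 (r * (Complex.exp (-(Real.pi * α / 2 : ℝ) * Complex.I) * Complex.Gamma (1 - α)))) := by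
  have hpos : ∀ᶠ ε : ℝ in 𝓝[>] 0, 0 < ε := self_mem_nhdsWithin
  have he : Tendsto (fun ε : ℝ => (r : ℂ) * ((ε : ℂ) ^ (α : ℂ) * Complex.Gamma (1 - α))) (𝓝[>] 0) (𝓝 0) := by
    have h1 : Tendsto (fun ε : ℝ => ε ^ α) (𝓝 0) (𝓝 (0 ^ α)) :=
      (Real.continuousAt_rpow_const 0 α (Or.inr hα0.le)).tendsto
    rw [Real.zero_rpow hα0.ne'] at h1
    have h2 := (((Complex.continuous_ofReal.tendsto _).comp
      (h1.mono_left (nhdsWithin_le_nhds (s := Set.Ioi 0)))).mul_const (Complex.Gamma (1 - α))).const_mul (r : ℂ)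
    simp only [Complex.ofReal_zero, zero_mul, mul_zero] at h2
    refine h2.congr' ?_
    filter_upwards [hpos] with ε hε
    simp only [Function.comp]
    rw [Complex.ofReal_cpow hε.le]
  refine tendsto_of_approx (l' := 𝓝[>] (0 : ℝ))
    (hpos.mono fun ε hε => hT.tendsto_laplace hα0 hα1 hρ hr (z := ε - Complex.I) (by simpa using hε))
    (hpos.mono fun ε hε => hT.tendsto_laplace hα0 hα1 hρ hr (z := ε) (by simpa using hε))
    (hpos.mono fun ε hε => ?_) (((tendsto_sub_I_cpow α).mul_const _).const_mul _) he
  filter_upwards [eventually_gt_atTop 0] with x hx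
  rw [← sub_div, norm_div, norm_div]
  refine div_le_div_of_nonneg_right ?_ (norm_nonneg _)
  have hreal : ∀ y : ℝ, 1 - Complex.exp (-((ε : ℂ) * (y / x : ℝ))) =
      ((1 - Real.exp (-(ε * (y / x))) : ℝ) : ℂ) := fun y => by push_cast; rfl
  have hint : ∀ z : ℂ, 0 ≤ z.re → IntegrableOn (fun y : ℝ => 1 - Complex.exp (-(z * (y / x : ℝ))))
      (Set.Ioi 0) ρ := fun z hz => by
    refine Integrable.of_bound (C := 2) (by fun_prop) ?_
    filter_upwards [ae_restrict_mem measurableSet_Ioi] with y hy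
    have : 0 < y / x := div_pos hy hx
    exact (norm_cexp_neg_mul_sub_one_le hz this.le).1
  have h0 : ∀ y : ℝ, Complex.exp ((y / x : ℝ) * Complex.I) = Complex.exp (-(-Complex.I * (y / x : ℝ))) :=
    fun y => by rw [neg_mul, neg_neg, mul_comm]
  simp only [h0]
  rw [← integral_sub (hint _ (by simp)) (hint _ (by simpa using hε.le))]
  simp only [hreal]
  rw [integral_complex_ofReal, Complex.norm_real]
  refine le_trans ?_ (le_abs_self _)
  have hi : IntegrableOn (fun y : ℝ => 1 - Real.exp (-(ε * (y / x)))) (Set.Ioi 0) ρ := by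
    have := (hint ε (by simpa using hε.le)).re
    refine this.congr (ae_of_all _ fun y => ?_)
    simp only [hreal]
    exact Complex.ofReal_re _
  refine norm_integral_le_of_norm_le hi ?_
  filter_upwards [ae_restrict_mem measurableSet_Ioi] with y hy
  have hyx : 0 < y / x := div_pos hy hx
  have h1 : 1 - Complex.exp (-(-Complex.I * (y / x : ℝ))) -
      (1 - Complex.exp (-(((ε : ℂ) - Complex.I) * (y / x : ℝ)))) =
      -(Complex.exp ((y / x : ℝ) * Complex.I) * ((1 - Real.exp (-(ε * (y / x))) : ℝ) : ℂ)) := by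
    push_cast
    rw [show -(((ε : ℂ) - Complex.I) * (y / x)) = (y / x) * Complex.I + -(ε * (y / x)) by ring,
      Complex.exp_add]
    ring_nf
  rw [h1, norm_neg, norm_mul, Complex.norm_exp_ofReal_mul_I, one_mul, Complex.norm_real,
    Real.norm_of_nonneg]
  have : Real.exp (-(ε * (y / x))) ≤ 1 := Real.exp_le_one_iff.2 (by nlinarith)
  linarith

lemma Gamma_two_sub_div (hα : α ≠ 1) :
    Complex.Gamma (1 - ((α - 1 : ℝ) : ℂ)) / ((α - 1 : ℝ) : ℂ) = -Complex.Gamma (1 - α) := by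
  have h1 : (1 - α : ℂ) ≠ 0 := by
    rw [sub_ne_zero]; exact_mod_cast hα.symm
  have h2 := Complex.Gamma_add_one (1 - α : ℂ) h1
  rw [show (1 - α + 1 : ℂ) = 1 - ((α - 1 : ℝ) : ℂ) by push_cast; ring] at h2
  have h3 : ((α - 1 : ℝ) : ℂ) ≠ 0 := by
    rw [Complex.ofReal_ne_zero, sub_ne_zero]; exact hα
  rw [h2, div_eq_iff h3]
  push_cast
  ring

/-- For `1 < α` the linear term is compensated; the kernel `i (1 - exp (i u))` is then bounded by
both `2` and `2 u`, and Karamata's theorem applies directly. The integrability statement is kept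
because it will yield integrability of the innovation. -/
lemma IsRegVarTail.tendsto_charFun_of_one_lt (hT : IsRegVarTail T α) (hα1 : 1 < α) (hα2 : α < 2)
    (hρ : ∀ x, 0 < x → ρ.real (Set.Ioi x) ≤ T x)
    (hr : Tendsto (fun x => ρ.real (Set.Ioi x) / T x) atTop (𝓝 r)) :
    (∀ᶠ x in atTop, IntegrableOn (fun y : ℝ => 1 - Complex.exp ((y / x : ℝ) * Complex.I) +
      (y / x : ℝ) * Complex.I) (Set.Ioi 0) ρ) ∧
    Tendsto (fun x : ℝ => (∫ y in Set.Ioi 0, (1 - Complex.exp ((y / x : ℝ) * Complex.I) +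
      (y / x : ℝ) * Complex.I) ∂ρ) / (T x : ℂ))
      atTop (𝓝 (r * (Complex.exp (-(Real.pi * α / 2 : ℝ) * Complex.I) * Complex.Gamma (1 - α)))) := by
  have hg : Continuous fun u : ℝ => Complex.I * (1 - Complex.exp (u * Complex.I)) := by fun_prop
  have hbd : ∀ u : ℝ, 0 < u → ‖Complex.I * (1 - Complex.exp (u * Complex.I))‖ ≤ 2 ∧
      ‖Complex.I * (1 - Complex.exp (u * Complex.I))‖ ≤ 2 * u := fun u hu => by
    have := norm_cexp_neg_mul_sub_one_le (z := -Complex.I) (by simp) hu.le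
    rw [neg_mul, neg_neg, mul_comm Complex.I, norm_neg, Complex.norm_I, one_mul] at this
    rwa [norm_mul, Complex.norm_I, one_mul]
  have hprim := primitive_of_hasDerivAt (H := fun u : ℝ => 1 - Complex.exp (u * Complex.I) + u * Complex.I)
    hg (fun u => by
      have h1 : HasDerivAt (fun u : ℝ => (u : ℂ) * Complex.I) Complex.I u := by
        have := (hasDerivAt_id (u : ℂ)).comp_ofReal.mul_const Complex.I
        rw [one_mul] at this
        exact this
      refine ((h1.cexp.const_sub 1).add h1).congr_deriv ?_
      ring) (by simp)
  have key := hT.tendsto_integral_div (by linarith) hρ hr hg.measurable (C := 2) (p := 2)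
    (q := 1) hα2 hα1 (fun u hu => ?_) (fun u hu => ?_)
  · constructor
    · filter_upwards [key.1, eventually_gt_atTop 0] with x hx hx0
      refine hx.integrableOn.congr ?_
      filter_upwards [ae_restrict_mem measurableSet_Ioi] with y hy
      exact (hprim _ (div_pos hy hx0)).symm
    have h2 : ∫ u in Set.Ioi (0 : ℝ), Complex.I * (1 - Complex.exp (u * Complex.I)) * ((u ^ (-α) : ℝ) : ℂ) =
        Complex.exp (-(Real.pi * α / 2 : ℝ) * Complex.I) * Complex.Gamma (1 - α) := by
      have h1 := integral_one_sub_cexp_mul_rpow (β := α - 1) (by linarith) (by linarith)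
      simp_rw [mul_assoc]
      rw [integral_const_mul]
      rw [show -(α - 1) - 1 = -α by ring, mul_div_assoc, Gamma_two_sub_div hα1.ne'] at h1
      rw [h1]
      have h3 : Complex.exp (-(Real.pi * (α - 1) / 2 : ℝ) * Complex.I) =
          Complex.exp (-(Real.pi * α / 2 : ℝ) * Complex.I) * Complex.I := by
        nth_rewrite 3 [← Complex.exp_pi_div_two_mul_I]
        rw [← Complex.exp_add]
        congr 1
        push_cast
        ring
      rw [h3]
      linear_combination -(Complex.exp (-(Real.pi * α / 2 : ℝ) * Complex.I) * Complex.Gamma (1 - α)) *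
        Complex.I_mul_I
    have key2 := key.2
    rw [h2] at key2
    refine key2.congr' ?_
    filter_upwards [eventually_gt_atTop 0] with x hx
    rw [← setIntegral_Ioi_eq_integral_primitive hprim hx]
  · have := (hbd u hu).2
    norm_num
    simpa using this
  · have := (hbd u hu).1
    norm_num
    simpa using this

/-- For `α = 1` the argument of the cosine is frozen at `X`, so that the kernel is `sin` cut off at
`X` and the limit is `∫₀^X sinc`. Freezing costs at most `2 T (X x) / T x → 2 / X`. -/
lemma IsRegVarTail.tendsto_one_sub_cos (hT : IsRegVarTail T 1)
    (hρ : ∀ x, 0 < x → ρ.real (Set.Ioi x) ≤ T x)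
    (hr : Tendsto (fun x => ρ.real (Set.Ioi x) / T x) atTop (𝓝 r)) :
    Tendsto (fun x : ℝ => (∫ y in Set.Ioi 0, ((1 - Real.cos (y / x) : ℝ) : ℂ) ∂ρ) / (T x : ℂ))
      atTop (𝓝 (r * (Real.pi / 2 : ℝ))) := by
  have hG : ∀ X : ℝ, 0 < X → Tendsto (fun x : ℝ =>
      (∫ y in Set.Ioi 0, ((1 - Real.cos (min (y / x) X) : ℝ) : ℂ) ∂ρ) / (T x : ℂ))
      atTop (𝓝 (r * (∫ u in (0 : ℝ)..X, Real.sinc u : ℝ))) := by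
    intro X hX
    have hg : Measurable fun u : ℝ => (Set.Iic X).indicator (fun u => (Real.sin u : ℂ)) u :=
      Measurable.indicator (by fun_prop) measurableSet_Iic
    have hnorm : ∀ u : ℝ, 0 < u → ‖(Set.Iic X).indicator (fun u => (Real.sin u : ℂ)) u‖ ≤ u ∧
        ‖(Set.Iic X).indicator (fun u => (Real.sin u : ℂ)) u‖ ≤ X * u⁻¹ := fun u hu => by
      by_cases h : u ≤ X
      · rw [Set.indicator_of_mem (by exact h), Complex.norm_real, Real.norm_eq_abs]
        have h1 : |Real.sin u| ≤ u := by simpa [abs_of_pos hu] using Real.abs_sin_le_abs (x := u)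
        refine ⟨h1, (Real.abs_sin_le_one u).trans ?_⟩
        rw [← div_eq_mul_inv, one_le_div hu]
        exact h
      · rw [Set.indicator_of_notMem (by exact h), norm_zero]
        exact ⟨hu.le, by positivity⟩
    have key := (hT.tendsto_integral_div one_pos hρ hr hg (C := 1 + X) (p := 2) (q := 0)
      one_lt_two one_pos (fun u hu => ?_) (fun u hu => ?_)).2
    · have h2 : ∫ u in Set.Ioi (0 : ℝ), (Set.Iic X).indicator (fun u => (Real.sin u : ℂ)) u *
          ((u ^ (-1 : ℝ) : ℝ) : ℂ) = (∫ u in (0 : ℝ)..X, Real.sinc u : ℝ) := by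
        rw [intervalIntegral.integral_of_le hX.le, ← integral_complex_ofReal]
        have : ∀ u : ℝ, (Set.Iic X).indicator (fun u => (Real.sin u : ℂ)) u * ((u ^ (-1 : ℝ) : ℝ) : ℂ) =
            (Set.Iic X).indicator (fun u => (Real.sin u : ℂ) * ((u ^ (-1 : ℝ) : ℝ) : ℂ)) u := fun u => by
          by_cases h : u ∈ Set.Iic X <;> simp [h]
        simp only [this]
        rw [setIntegral_indicator measurableSet_Iic, Set.Ioi_inter_Iic]
        refine setIntegral_congr_fun measurableSet_Ioc fun u hu => ?_
        rw [Real.sinc_of_ne_zero hu.1.ne', Real.rpow_neg_one, div_eq_mul_inv]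
        push_cast
        rfl
      rw [h2] at key
      refine key.congr' ?_
      filter_upwards [eventually_gt_atTop 0] with x hx
      rw [← setIntegral_Ioi_eq_integral_primitive
        (H := fun v : ℝ => ((1 - Real.cos (min v X) : ℝ) : ℂ)) (fun v hv => ?_) hx]
      rw [setIntegral_indicator measurableSet_Iic, Set.Ioc_inter_Iic, integral_complex_ofReal,
        ← intervalIntegral.integral_of_le (le_min hv.le hX.le), integral_sin, Real.cos_zero]
    · have := (hnorm u hu).1
      rw [show (2 : ℝ) - 1 = 1 by norm_num, Real.rpow_one]
      nlinarith
    · have := (hnorm u hu).2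
      rw [zero_sub, Real.rpow_neg_one]
      refine this.trans ?_
      gcongr
      linarith
  have hE : ∀ X : ℝ, 0 < X → Tendsto (fun x : ℝ => ((2 * T (X * x) : ℝ) : ℂ) / (T x : ℂ)) atTop
      (𝓝 ((2 * X ^ (-1 : ℝ) : ℝ) : ℂ)) := fun X hX => by
    refine ((Complex.continuous_ofReal.tendsto _).comp ((hT.ratio X hX).const_mul 2)).congr fun x => ?_
    simp only [Function.comp]
    push_cast
    ring
  refine tendsto_of_approx (l' := atTop) ((eventually_gt_atTop (0 : ℝ)).mono hG)
    ((eventually_gt_atTop (0 : ℝ)).mono hE) ?_ ?_ ?_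
  · filter_upwards [eventually_gt_atTop 0] with X hX
    filter_upwards [eventually_gt_atTop 0] with x hx
    rw [← sub_div, norm_div, norm_div]
    refine div_le_div_of_nonneg_right ?_ (norm_nonneg _)
    have hi : ∀ f : ℝ → ℝ, Continuous f → IntegrableOn (fun y : ℝ => ((1 - Real.cos (f y) : ℝ) : ℂ))
        (Set.Ioi 0) ρ := fun f hf => by
      refine Integrable.of_bound (C := 2) ?_ (ae_of_all _ fun y => ?_)
      · exact (by fun_prop : Continuous fun y : ℝ => ((1 - Real.cos (f y) : ℝ) : ℂ)).aestronglyMeasurable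
      · rw [Complex.norm_real, Real.norm_of_nonneg (by linarith [Real.cos_le_one (f y)])]
        linarith [Real.neg_one_le_cos (f y)]
    have hTp := hT.pos (X * x)
    rw [← integral_sub (hi _ (by fun_prop)) (hi _ (by fun_prop)), Complex.norm_real,
      Real.norm_of_nonneg (by positivity)]
    calc _ ≤ ∫ y in Set.Ioi 0, (Set.Ioi (X * x)).indicator (fun _ => (2 : ℝ)) y ∂ρ := by
          refine norm_integral_le_of_norm_le
            (((integrable_const (2 : ℝ)).indicator measurableSet_Ioi)) (ae_of_all _ fun y => ?_)
          by_cases hy : X * x < y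
          · rw [Set.indicator_of_mem (by exact hy), ← Complex.ofReal_sub, Complex.norm_real,
              Real.norm_eq_abs, abs_le]
            constructor <;> linarith [Real.neg_one_le_cos (y / x), Real.cos_le_one (y / x),
              Real.neg_one_le_cos (min (y / x) X), Real.cos_le_one (min (y / x) X)]
          · rw [Set.indicator_of_notMem (by exact hy), min_eq_left, sub_self, norm_zero]
            rw [div_le_iff₀ hx]
            exact not_lt.1 hy
      _ = 2 * ρ.real (Set.Ioi (X * x)) := by
          rw [setIntegral_indicator measurableSet_Ioi, Set.inter_eq_right.2
            (Set.Ioi_subset_Ioi (by positivity)), setIntegral_const, smul_eq_mul, mul_comm]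
      _ ≤ _ := by
          gcongr
          exact hρ _ (by positivity)
  · exact ((Complex.continuous_ofReal.tendsto _).comp tendsto_integral_sinc).const_mul _
  · have h1 := (tendsto_rpow_neg_atTop (one_pos : (0 : ℝ) < 1)).const_mul 2
    rw [mul_zero] at h1
    exact (Complex.continuous_ofReal.tendsto _).comp h1

end Tail

/-! ### The two-sided law for `α < 2` -/

/-- The two-sided tail `P(|ξ| > x)`. -/
noncomputable def absTail (μ : Measure ℝ) (x : ℝ) : ℝ := μ.real {y | x < |y|}

section

variable {μ : Measure ℝ} [IsProbabilityMeasure μ] {α cp cm : ℝ}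

lemma measurableSet_lt_abs (x : ℝ) : MeasurableSet {y : ℝ | x < |y|} :=
  measurableSet_lt measurable_const continuous_abs.measurable

lemma measurableSet_abs_le (x : ℝ) : MeasurableSet {y : ℝ | |y| ≤ x} :=
  measurableSet_le continuous_abs.measurable measurable_const

lemma isRegVarTail_absTail (hα2 : α < 2) (hDA : InDomainOfAttraction μ α cp cm) :
    IsRegVarTail (absTail μ) α := by
  obtain ⟨L₁, ⟨-, hLpos, hLr⟩, hlim⟩ := hDA.tail hα2
  have hanti : Antitone (absTail μ) := fun a b hab =>
    measureReal_mono (fun y (hy : b < |y|) => show a < |y| from hab.trans_lt hy)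
  have hpos' : ∀ᶠ x in atTop, 0 < absTail μ x := by
    filter_upwards [hLpos, hlim.eventually (lt_mem_nhds (one_pos : (0 : ℝ) < 1)),
      eventually_gt_atTop 0] with x h1 h2 h3
    by_contra h4
    have h5 : μ.real {y | x < |y|} = 0 := le_antisymm (not_lt.1 h4) measureReal_nonneg
    rw [h5, zero_div] at h2
    exact lt_irrefl _ h2
  -- A monotone tail that is positive arbitrarily far out is positive everywhere.
  have hpos : ∀ x, 0 < absTail μ x := fun x => by
    obtain ⟨z, hz1, hz2⟩ := (hpos'.and (eventually_ge_atTop x)).exists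
    exact hz1.trans_le (hanti hz2)
  refine ⟨hanti, hpos, fun x => measureReal_le_one, fun r hr => ?_⟩
  have hrx : Tendsto (fun x : ℝ => r * x) atTop atTop := tendsto_id.const_mul_atTop hr
  have h1 := hlim.comp hrx
  have h2 := ((h1.div hlim one_ne_zero).mul (hLr r hr)).mul_const (r ^ (-α))
  simp only [div_one, one_mul] at h2
  refine h2.congr' ?_
  filter_upwards [hLpos, hrx.eventually hLpos, eventually_gt_atTop 0] with x hx1 hx2 hx3
  have h3 := hpos x
  simp only [Function.comp, Pi.div_apply]
  rw [Real.mul_rpow hr.le hx3.le]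
  change absTail μ (r * x) / _ / (absTail μ x / _) * _ * _ = _
  have : 0 < r ^ (-α) := by positivity
  have : 0 < x ^ (-α) := by positivity
  field_simp

lemma measureReal_Ioi_le_absTail {x : ℝ} : μ.real (Set.Ioi x) ≤ absTail μ x :=
  measureReal_mono fun y (hy : x < y) => show x < |y| from hy.trans_le (le_abs_self y)

lemma measureReal_map_neg_Ioi (ν : Measure ℝ) (x : ℝ) :
    (ν.map (fun y => -y)).real (Set.Ioi x) = ν.real {y | y < -x} := by
  rw [map_measureReal_apply measurable_neg measurableSet_Ioi]
  congr 1
  ext y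
  simp

lemma measureReal_map_neg_Ioi_le_absTail {x : ℝ} :
    (μ.map (fun y => -y)).real (Set.Ioi x) ≤ absTail μ x := by
  rw [measureReal_map_neg_Ioi]
  exact measureReal_mono fun y (hy : y < -x) => show x < |y| from
    (lt_neg_of_lt_neg hy).trans_le (neg_le_abs y)

lemma cp_add_cm (hα2 : α < 2) (hDA : InDomainOfAttraction μ α cp cm) : cp + cm = 1 := by
  have hT := isRegVarTail_absTail hα2 hDA
  refine tendsto_nhds_unique ((hDA.right_tail hα2).add (hDA.left_tail hα2))
    (tendsto_const_nhds.congr' ?_)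
  filter_upwards [eventually_ge_atTop 0] with x hx
  have h1 : {y : ℝ | x < |y|} = {y | x < y} ∪ {y | y < -x} := by
    ext y
    simp only [Set.mem_ofPred_eq, Set.mem_union, lt_abs, lt_neg]
  have h2 : Disjoint {y : ℝ | x < y} {y | y < -x} := by
    rw [Set.disjoint_left]
    intro y (hy : x < y) (hy2 : y < -x)
    linarith
  rw [← add_div, ← measureReal_union h2 (measurableSet_Iio), ← h1, div_self]
  exact (hT.pos x).ne'

lemma _root_.MeasureTheory.Integrable.complex_conj {Ω : Type*} [MeasurableSpace Ω] {ρ : Measure Ω}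
    {f : Ω → ℂ} (hf : Integrable f ρ) : Integrable (fun y => (starRingEnd ℂ) (f y)) ρ :=
  Complex.conjCLE.toContinuousLinearMap.integrable_comp hf

/-- The negative half is moved to `(0, ∞)` by reflecting the law, so that the one-sided results
serve twice. A possible atom at `0` belongs to neither half, whence `f 0 = 0`. -/
lemma integral_eq_Ioi_add_Ioi_neg {f : ℝ → ℂ} (hf : Measurable f) (h0 : f 0 = 0)
    (hi1 : IntegrableOn f (Set.Ioi 0) μ)
    (hi2 : IntegrableOn (fun y => f (-y)) (Set.Ioi 0) (μ.map fun y => -y)) :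
    Integrable f μ ∧ ∫ y, f y ∂μ =
      ∫ y in Set.Ioi 0, f y ∂μ + ∫ y in Set.Ioi 0, f (-y) ∂(μ.map fun y => -y) := by
  have hpre : (fun y : ℝ => -y) ⁻¹' Set.Ioi 0 = Set.Iio 0 := by ext; simp
  have hfn : Measurable fun y => f (-y) := hf.comp measurable_neg
  have hi2' : IntegrableOn f (Set.Iio 0) μ := by
    rw [IntegrableOn, Measure.restrict_map measurable_neg measurableSet_Ioi, hpre,
      integrable_map_measure hfn.aestronglyMeasurable (by fun_prop)] at hi2
    simpa [Function.comp_def, IntegrableOn] using hi2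
  have hi3 : IntegrableOn f (Set.Iic 0) μ := by
    rw [← Set.Iio_union_right, integrableOn_union]
    exact ⟨hi2', integrableOn_singleton (by simp)⟩
  have hint : Integrable f μ := by
    rw [← integrableOn_univ, ← Set.Iic_union_Ioi (a := (0 : ℝ))]
    exact hi3.union hi1
  refine ⟨hint, ?_⟩
  rw [← integral_add_compl measurableSet_Ioi hint, Set.compl_Ioi]
  congr 1
  rw [setIntegral_map measurableSet_Ioi hfn.aestronglyMeasurable (by fun_prop),
    hpre]
  simp only [neg_neg]
  rw [← Set.Iio_union_right, setIntegral_union (by simp) (measurableSet_singleton _) hi2'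
    (integrableOn_singleton (by simp))]
  simp [h0]

lemma cos_half_pi_mul_ne_zero (h0 : 0 < α) (h1 : α ≠ 1) (h2 : α < 2) :
    Real.cos (Real.pi * α / 2) ≠ 0 := by
  have hpi := Real.pi_pos
  rcases lt_or_gt_of_ne h1 with h | h
  · exact (Real.cos_pos_of_mem_Ioo ⟨by nlinarith, by nlinarith⟩).ne'
  · exact (Real.cos_neg_of_pi_div_two_lt_of_lt (by nlinarith) (by nlinarith)).ne

/-- The two half-lines contribute conjugate constants; factoring out `Γ(1 - α) cos (π α / 2)` leaves
`1 - i (cp - cm) tan (π α / 2)`. -/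
lemma stableConst_mul_eq (h0 : 0 < α) (h1 : α ≠ 1) (h2 : α < 2) (hc : cp + cm = 1) :
    (cp * (Complex.exp (-(Real.pi * α / 2 : ℝ) * Complex.I) * Complex.Gamma (1 - α)) +
      cm * (starRingEnd ℂ) (Complex.exp (-(Real.pi * α / 2 : ℝ) * Complex.I) * Complex.Gamma (1 - α)) : ℂ) =
      stableConst α * (1 - Complex.I * (((cp - cm) * tau α 1 : ℝ) : ℂ)) := by
  have hG : Complex.Gamma (1 - α) = (Real.Gamma (1 - α) : ℝ) := by
    rw [← Complex.Gamma_ofReal]; push_cast; rfl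
  have hcos := cos_half_pi_mul_ne_zero h0 h1 h2
  rw [stableConst, if_neg h2.ne, if_neg h1, tau, if_neg h1, Real.sign_one, one_mul,
    Real.tan_eq_sin_div_cos, hG, map_mul, Complex.conj_ofReal, ← Complex.exp_conj, map_mul, map_neg,
    Complex.conj_ofReal, Complex.conj_I, neg_mul_neg]
  set θ := Real.pi * α / 2
  rw [Complex.exp_mul_I, Complex.exp_mul_I]
  push_cast
  rw [Complex.cos_neg, Complex.sin_neg]
  have hc' : (cm : ℂ) = 1 - cp := by
    rw [eq_sub_iff_add_eq, add_comm]; exact_mod_cast hc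
  have hcos' : Complex.cos (θ : ℂ) ≠ 0 := by
    rw [← Complex.ofReal_cos]; exact_mod_cast hcos
  rw [hc']
  field_simp
  ring

lemma one_sub_charFun_inv (x : ℝ) :
    1 - charFun μ (1 / x) = ∫ y, (1 - Complex.exp ((y / x : ℝ) * Complex.I)) ∂μ := by
  have hi : Integrable (fun y : ℝ => Complex.exp ((y / x : ℝ) * Complex.I)) μ :=
    Integrable.of_bound (C := 1) (by fun_prop)
      (ae_of_all _ fun y => by rw [Complex.norm_exp_ofReal_mul_I])
  rw [integral_sub (integrable_const _) hi, charFun_apply_real]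
  simp only [integral_const, probReal_univ, one_smul]
  congr 2
  ext y
  congr 1
  push_cast
  ring

lemma integrable_one_sub_cexp (ρ : Measure ℝ) [IsFiniteMeasure ρ] (x : ℝ) :
    Integrable (fun y : ℝ => 1 - Complex.exp ((y / x : ℝ) * Complex.I)) ρ :=
  (integrable_const _).sub (Integrable.of_bound (C := 1) (by fun_prop)
      (ae_of_all _ fun y => by rw [Complex.norm_exp_ofReal_mul_I]))

lemma one_sub_cexp_neg (x y : ℝ) : 1 - Complex.exp ((-y / x : ℝ) * Complex.I) =
    (starRingEnd ℂ) (1 - Complex.exp ((y / x : ℝ) * Complex.I)) := by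
  rw [map_sub, map_one, ← Complex.exp_conj, map_mul, Complex.conj_I, Complex.conj_ofReal]
  push_cast
  ring_nf

/-- Condition A removes what the one-sided analysis leaves out: symmetry kills the sine part when `α
= 1`, and centring kills the compensating linear term when `α > 1`. -/
lemma tendsto_charFun_absTail (hα0 : 0 < α) (hα2 : α < 2) (hDA : InDomainOfAttraction μ α cp cm)
    (hA : ConditionA μ α) :
    Tendsto (fun x : ℝ => (1 - charFun μ (1 / x)) / (absTail μ x : ℂ)) atTop
      (𝓝 (stableConst α * (1 - Complex.I * (((cp - cm) * tau α 1 : ℝ) : ℂ)))) := by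
  have hT := isRegVarTail_absTail hα2 hDA
  have hc := cp_add_cm hα2 hDA
  have : IsProbabilityMeasure (μ.map fun y => -y) := Measure.isProbabilityMeasure_map (by fun_prop)
  have hr2 : Tendsto (fun x => (μ.map fun y => -y).real (Set.Ioi x) / absTail μ x) atTop (𝓝 cm) := by
    simp_rw [measureReal_map_neg_Ioi]
    exact hDA.left_tail hα2
  have hconj : ∀ {F : ℝ → ℂ} {c : ℂ}, Tendsto (fun x => F x / (absTail μ x : ℂ)) atTop (𝓝 c) →
      Tendsto (fun x => (starRingEnd ℂ) (F x) / (absTail μ x : ℂ)) atTop (𝓝 ((starRingEnd ℂ) c)) := by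
    intro F c h
    refine ((Complex.continuous_conj.tendsto _).comp h).congr fun x => ?_
    simp
  rcases lt_trichotomy α 1 with h | h | h
  · have h1 := hT.tendsto_charFun_of_lt_one hα0 h (fun x _ => measureReal_Ioi_le_absTail)
      (hDA.right_tail hα2)
    have h2 := hT.tendsto_charFun_of_lt_one hα0 h (fun x _ => measureReal_map_neg_Ioi_le_absTail) hr2
    rw [← stableConst_mul_eq hα0 h.ne hα2 hc]
    have h3 := h1.add (hconj h2)
    rw [map_mul, Complex.conj_ofReal] at h3
    refine h3.congr fun x => ?_
    rw [one_sub_charFun_inv, (integral_eq_Ioi_add_Ioi_neg (by fun_prop) (by simp)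
      (integrable_one_sub_cexp μ x).integrableOn ?_).2, add_div, ← integral_conj]
    · simp only [one_sub_cexp_neg]
    · simp only [one_sub_cexp_neg]
      exact ((integrable_one_sub_cexp _ x).complex_conj).integrableOn
  · subst h
    have h1 := hT.tendsto_one_sub_cos (fun x _ => measureReal_Ioi_le_absTail) (hDA.right_tail hα2)
    have h2 := hT.tendsto_one_sub_cos (fun x _ => measureReal_map_neg_Ioi_le_absTail) hr2
    have h3 := h1.add h2
    have h4 : (cp * (Real.pi / 2 : ℝ) + cm * (Real.pi / 2 : ℝ) : ℂ) =
        stableConst 1 * (1 - Complex.I * (((cp - cm) * tau 1 1 : ℝ) : ℂ)) := by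
      have hc' : (cp + cm : ℂ) = 1 := by exact_mod_cast hc
      rw [← add_mul, hc']
      simp [stableConst, tau]
    rw [h4] at h3
    refine h3.congr fun x => ?_
    have hic : ∀ (ρ : Measure ℝ) [IsFiniteMeasure ρ],
        Integrable (fun y : ℝ => ((1 - Real.cos (y / x) : ℝ) : ℂ)) ρ := fun ρ _ => by
      refine Integrable.of_bound (C := 2) (by fun_prop) (ae_of_all _ fun y => ?_)
      rw [Complex.norm_real, Real.norm_of_nonneg (by linarith [Real.cos_le_one (y / x)])]
      linarith [Real.neg_one_le_cos (y / x)]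
    have hev : ∀ y : ℝ, ((1 - Real.cos (-y / x) : ℝ) : ℂ) = ((1 - Real.cos (y / x) : ℝ) : ℂ) :=
      fun y => by rw [neg_div, Real.cos_neg]
    have h5 := (integral_eq_Ioi_add_Ioi_neg (μ := μ) (f := fun y : ℝ => ((1 - Real.cos (y / x) : ℝ) : ℂ))
      (by fun_prop) (by simp) (hic μ).integrableOn
      (by simp only [hev]; exact (hic _).integrableOn)).2
    simp only [hev] at h5
    rw [← add_div, ← h5]
    congr 1
    have hsymm : (starRingEnd ℂ) (1 - charFun μ (1 / x)) = 1 - charFun μ (1 / x) := by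
      rw [map_sub, map_one, ← charFun_neg]
      congr 1
      have := charFun_map_mul (μ := μ) (-1) (1 / x)
      rw [show (fun y : ℝ => -1 * y) = fun y => -y by ext; ring, (hA.2 rfl : μ.map _ = μ)] at this
      rw [this]
      ring_nf
    rw [← Complex.conj_eq_iff_re.1 hsymm, integral_complex_ofReal, one_sub_charFun_inv]
    congr 1
    have := integral_re (integrable_one_sub_cexp μ x)
    simp only [RCLike.re_to_complex] at this
    rw [← this]
    refine integral_congr_ae (ae_of_all _ fun y => ?_)
    simp only
    rw [Complex.sub_re, Complex.exp_ofReal_mul_I_re, Complex.one_re]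
  · have h1 := hT.tendsto_charFun_of_one_lt h hα2 (fun x _ => measureReal_Ioi_le_absTail)
      (hDA.right_tail hα2)
    have h2 := hT.tendsto_charFun_of_one_lt h hα2 (fun x _ => measureReal_map_neg_Ioi_le_absTail) hr2
    rw [← stableConst_mul_eq hα0 h.ne' hα2 hc]
    have h3 := h1.2.add (hconj h2.2)
    rw [map_mul, Complex.conj_ofReal] at h3
    refine h3.congr' ?_
    filter_upwards [h1.1, h2.1, eventually_gt_atTop 0] with x hx1 hx2 hx0
    have hneg : ∀ y : ℝ, 1 - Complex.exp ((-y / x : ℝ) * Complex.I) + (-y / x : ℝ) * Complex.I =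
        (starRingEnd ℂ) (1 - Complex.exp ((y / x : ℝ) * Complex.I) + (y / x : ℝ) * Complex.I) := by
      intro y
      rw [one_sub_cexp_neg, map_add, map_mul, Complex.conj_I, Complex.conj_ofReal, neg_div]
      push_cast
      ring
    obtain ⟨h4, h5⟩ := integral_eq_Ioi_add_Ioi_neg (μ := μ)
      (f := fun y : ℝ => 1 - Complex.exp ((y / x : ℝ) * Complex.I) + (y / x : ℝ) * Complex.I)
      (by fun_prop) (by simp) hx1 (by simp only [hneg]; exact Integrable.complex_conj hx2)
    simp only [hneg] at h5
    rw [integral_conj] at h5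
    rw [← add_div, ← h5]
    congr 1
    -- Integrability of the innovation is not a hypothesis: it follows by subtracting the bounded
    -- integrand from the compensated one.
    have hi : Integrable (fun y : ℝ => ((y / x : ℝ) : ℂ) * Complex.I) μ :=
      (h4.sub (integrable_one_sub_cexp μ x)).congr (ae_of_all _ fun y => by simp)
    rw [integral_add (integrable_one_sub_cexp μ x) hi, ← one_sub_charFun_inv, integral_mul_const,
      integral_complex_ofReal, integral_div, hA.1 h]
    simp

/-- Karamata's theorem for `g u = 2u` on `u ≤ 1` gives `E min(|ξ|/x, 1)²`, which is the truncated
second moment over `x²` plus the tail; subtracting the tail gives `2/(2 - α) - 1 = α/(2 - α)`. Thus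
`kappa α` is the constant that makes `L` match the tail. -/
lemma tendsto_truncSecondMoment_div_absTail (hα0 : 0 < α) (hα2 : α < 2)
    (hDA : InDomainOfAttraction μ α cp cm) :
    Tendsto (fun x => truncSecondMoment μ x / x ^ 2 / absTail μ x) atTop (𝓝 (α / (2 - α))) := by
  have hT := isRegVarTail_absTail hα2 hDA
  have : IsProbabilityMeasure (μ.map fun y => |y|) :=
    Measure.isProbabilityMeasure_map (by fun_prop)
  have hR : ∀ x, (μ.map fun y => |y|).real (Set.Ioi x) = absTail μ x := fun x => by
    rw [map_measureReal_apply continuous_abs.measurable measurableSet_Ioi]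
    rfl
  have hr : Tendsto (fun x => (μ.map fun y => |y|).real (Set.Ioi x) / absTail μ x) atTop (𝓝 1) := by
    refine tendsto_const_nhds.congr fun x => ?_
    rw [hR, div_self (hT.pos x).ne']
  have hg : Measurable fun u : ℝ => (Set.Iic (1 : ℝ)).indicator (fun u => ((2 * u : ℝ) : ℂ)) u :=
    Measurable.indicator (by fun_prop) measurableSet_Iic
  have hnorm : ∀ u : ℝ, 0 < u → ‖(Set.Iic (1 : ℝ)).indicator (fun u => ((2 * u : ℝ) : ℂ)) u‖ ≤ 2 * u ∧
      ‖(Set.Iic (1 : ℝ)).indicator (fun u => ((2 * u : ℝ) : ℂ)) u‖ ≤ 2 * u⁻¹ := fun u hu => by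
    by_cases h : u ≤ 1
    · rw [Set.indicator_of_mem (by exact h), Complex.norm_real, Real.norm_of_nonneg (by positivity)]
      have := (one_le_inv₀ hu).2 h
      exact ⟨le_rfl, by linarith⟩
    · rw [Set.indicator_of_notMem (by exact h), norm_zero]
      exact ⟨by positivity, by positivity⟩
  have key := (hT.tendsto_integral_div hα0 (fun x _ => (hR x).le) hr hg (C := 2) (p := 2) (q := 0)
    hα2 hα0 (fun u hu => ?_) (fun u hu => ?_)).2
  · have h2 : ∫ u in Set.Ioi (0 : ℝ), (Set.Iic (1 : ℝ)).indicator (fun u => ((2 * u : ℝ) : ℂ)) u *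
        ((u ^ (-α) : ℝ) : ℂ) = ((2 / (2 - α) : ℝ) : ℂ) := by
      have : ∀ u : ℝ, (Set.Iic (1 : ℝ)).indicator (fun u => ((2 * u : ℝ) : ℂ)) u * ((u ^ (-α) : ℝ) : ℂ) =
          (Set.Iic (1 : ℝ)).indicator (fun u => ((2 * u : ℝ) : ℂ) * ((u ^ (-α) : ℝ) : ℂ)) u := fun u => by
        by_cases h : u ∈ Set.Iic (1 : ℝ) <;> simp [h]
      simp only [this]
      rw [setIntegral_indicator measurableSet_Iic, Set.Ioi_inter_Iic]
      have h3 : ∫ u in Set.Ioc (0 : ℝ) 1, ((2 * u : ℝ) : ℂ) * ((u ^ (-α) : ℝ) : ℂ) =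
          ∫ u in Set.Ioc (0 : ℝ) 1, ((2 * u ^ (1 - α) : ℝ) : ℂ) := by
        refine setIntegral_congr_fun measurableSet_Ioc fun u hu => ?_
        rw [← Complex.ofReal_mul, sub_eq_add_neg, Real.rpow_add hu.1, Real.rpow_one, mul_assoc]
      rw [h3, integral_complex_ofReal, ← intervalIntegral.integral_of_le zero_le_one,
        intervalIntegral.integral_const_mul, integral_rpow (Or.inl (by linarith))]
      congr 1
      rw [Real.one_rpow, Real.zero_rpow (by linarith)]
      ring_nf
    rw [h2, Complex.ofReal_one, one_mul] at key
    have h4 := ((Complex.continuous_re.tendsto _).comp key).sub_const 1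
    rw [Complex.ofReal_re, show 2 / (2 - α) - 1 = α / (2 - α) by
      have : 2 - α ≠ 0 := by linarith
      field_simp
      ring] at h4
    refine h4.congr' ?_
    filter_upwards [eventually_gt_atTop 0] with x hx
    have hTx := hT.pos x
    have h5 : ∀ y : ℝ, ∫ u in Set.Ioc 0 (|y| / x), (Set.Iic (1 : ℝ)).indicator (fun u => ((2 * u : ℝ) : ℂ)) u =
        ((({y : ℝ | |y| ≤ x}.indicator (fun y => y ^ 2 / x ^ 2) y +
          {y : ℝ | x < |y|}.indicator (fun _ => (1 : ℝ)) y : ℝ)) : ℂ) := by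
      intro y
      have hy0 : 0 ≤ |y| / x := by positivity
      rw [setIntegral_indicator measurableSet_Iic, Set.Ioc_inter_Iic, integral_complex_ofReal,
        ← intervalIntegral.integral_of_le (le_min hy0 zero_le_one),
        intervalIntegral.integral_const_mul, integral_id]
      congr 1
      by_cases hy : |y| ≤ x
      · rw [Set.indicator_of_mem (by exact hy), Set.indicator_of_notMem (by simpa using hy),
          min_eq_left ((div_le_one hx).2 hy), div_pow, sq_abs]
        ring
      · rw [Set.indicator_of_notMem (by exact hy), Set.indicator_of_mem (by simpa using hy),
          min_eq_right ((one_le_div hx).2 (not_le.1 hy).le)]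
        ring
    have hi1 : Integrable ({y : ℝ | |y| ≤ x}.indicator (fun y => y ^ 2 / x ^ 2)) μ := by
      refine Integrable.of_bound (C := 1)
        (Measurable.indicator (by fun_prop) (measurableSet_abs_le x)).aestronglyMeasurable
        (ae_of_all _ fun y => ?_)
      by_cases hy : |y| ≤ x
      · rw [Set.indicator_of_mem (by exact hy), Real.norm_of_nonneg (by positivity),
          div_le_one (by positivity)]
        exact sq_le_sq' (by linarith [neg_abs_le y]) (by linarith [le_abs_self y])
      · rw [Set.indicator_of_notMem (by exact hy)]; simp
    have hi2 : Integrable ({y : ℝ | x < |y|}.indicator (fun _ => (1 : ℝ))) μ :=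
      (integrable_const _).indicator (measurableSet_lt_abs x)
    have hm : AEStronglyMeasurable (fun y : ℝ => ∫ u in Set.Ioc 0 (y / x),
        (Set.Iic (1 : ℝ)).indicator (fun u => ((2 * u : ℝ) : ℂ)) u) (μ.map fun y => |y|) := by
      refine StronglyMeasurable.aestronglyMeasurable ?_
      have h6 : ∀ y : ℝ, ∫ u in Set.Ioc 0 (y / x),
          (Set.Iic (1 : ℝ)).indicator (fun u => ((2 * u : ℝ) : ℂ)) u =
          (((max 0 (min (y / x) 1)) ^ 2 : ℝ) : ℂ) := by
        intro y
        rw [setIntegral_indicator measurableSet_Iic, Set.Ioc_inter_Iic, integral_complex_ofReal]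
        congr 1
        by_cases h7 : 0 ≤ min (y / x) 1
        · rw [← intervalIntegral.integral_of_le h7, intervalIntegral.integral_const_mul, integral_id,
            max_eq_right h7]
          ring
        · rw [max_eq_left (not_le.1 h7).le, Set.Ioc_eq_empty (by linarith)]
          simp
      simp only [h6]
      exact (by fun_prop : Continuous fun y : ℝ => (((max 0 (min (y / x) 1)) ^ 2 : ℝ) : ℂ)).stronglyMeasurable
    simp only [Function.comp]
    rw [integral_map continuous_abs.measurable.aemeasurable hm]
    simp only [h5]
    rw [integral_complex_ofReal, ← Complex.ofReal_div, Complex.ofReal_re, integral_add hi1 hi2,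
      integral_indicator (measurableSet_abs_le x), integral_indicator (measurableSet_lt_abs x),
      integral_div]
    simp only [integral_const, smul_eq_mul, mul_one, measureReal_restrict_apply_univ]
    change (truncSecondMoment μ x / x ^ 2 + absTail μ x) / absTail μ x - 1 = _
    field_simp
    ring
  · have := (hnorm u hu).1
    rwa [show (2 : ℝ) - 1 = 1 by norm_num, Real.rpow_one]
  · have := (hnorm u hu).2
    rwa [zero_sub, Real.rpow_neg_one]

end

/-! ### The truncated second moment and the case `α = 2` -/

/-- The constant `κ_α` in the definition of the slowly varying function `L`. -/
noncomputable def kappa (α : ℝ) : ℝ := if α = 2 then 1 else (2 - α) / α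

lemma kappa_pos {α : ℝ} (h0 : 0 < α) (h2 : α ≤ 2) : 0 < kappa α := by
  unfold kappa
  split_ifs with h
  · exact one_pos
  · exact div_pos (sub_pos.2 (lt_of_le_of_ne h2 h)) h0

section

variable {μ : Measure ℝ} [IsProbabilityMeasure μ] {α cp cm : ℝ}

lemma integrable_indicator_sq (μ : Measure ℝ) [IsFiniteMeasure μ] (x : ℝ) :
    Integrable ({y : ℝ | |y| ≤ x}.indicator fun y => y ^ 2) μ := by
  refine Integrable.of_bound (C := x ^ 2)
    (Measurable.indicator (by fun_prop) (measurableSet_abs_le x)).aestronglyMeasurable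
    (ae_of_all _ fun y => ?_)
  by_cases hy : |y| ≤ x
  · rw [Set.indicator_of_mem (by exact hy), Real.norm_of_nonneg (by positivity)]
    exact sq_le_sq' (by linarith [neg_abs_le y]) (by linarith [le_abs_self y])
  · rw [Set.indicator_of_notMem (by exact hy), norm_zero]
    positivity

lemma truncSecondMoment_eq (ν : Measure ℝ) (x : ℝ) :
    truncSecondMoment ν x = ∫ y, {y : ℝ | |y| ≤ x}.indicator (fun y => y ^ 2) y ∂ν :=
  (integral_indicator (measurableSet_abs_le x)).symm

lemma truncSecondMoment_nonneg (ν : Measure ℝ) (x : ℝ) : 0 ≤ truncSecondMoment ν x :=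
  integral_nonneg fun _ => sq_nonneg _

lemma monotone_truncSecondMoment : Monotone (truncSecondMoment μ) := fun a b hab => by
  rw [truncSecondMoment_eq, truncSecondMoment_eq]
  refine integral_mono (integrable_indicator_sq μ a) (integrable_indicator_sq μ b) fun y => ?_
  exact Set.indicator_le_indicator_of_subset (fun y (hy : |y| ≤ a) => hy.trans hab)
    (fun _ => sq_nonneg _) y

/-- Right-continuity holds because the truncation is `|y| ≤ x`, not strict. It is what makes the
infimum in the normalizer attained. -/
lemma continuousWithinAt_truncSecondMoment (x : ℝ) :
    ContinuousWithinAt (truncSecondMoment μ) (Set.Ici x) x := by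
  change Tendsto (fun z => truncSecondMoment μ z) (𝓝[Set.Ici x] x) (𝓝 (truncSecondMoment μ x))
  simp_rw [truncSecondMoment_eq]
  refine tendsto_integral_filter_of_dominated_convergence
    ({y : ℝ | |y| ≤ x + 1}.indicator fun y => y ^ 2)
    (Eventually.of_forall fun z => (integrable_indicator_sq μ z).1) ?_
    (integrable_indicator_sq μ (x + 1)) (ae_of_all _ fun y => ?_)
  · have h1 : ∀ᶠ z in 𝓝[Set.Ici x] x, z < x + 1 := nhdsWithin_le_nhds (gt_mem_nhds (by linarith))
    filter_upwards [h1] with z hz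
    refine ae_of_all _ fun y => ?_
    rw [Real.norm_of_nonneg (Set.indicator_nonneg (fun _ _ => sq_nonneg _) y)]
    exact Set.indicator_le_indicator_of_subset (fun y (hy : |y| ≤ z) => hy.trans hz.le)
      (fun _ => sq_nonneg _) y
  · refine tendsto_const_nhds.congr' ?_
    by_cases hy : |y| ≤ x
    · filter_upwards [self_mem_nhdsWithin] with z hz
      rw [Set.indicator_of_mem (by exact hy), Set.indicator_of_mem (by exact hy.trans hz)]
    · have h1 : ∀ᶠ z in 𝓝[Set.Ici x] x, z < |y| := nhdsWithin_le_nhds (gt_mem_nhds (not_le.1 hy))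
      filter_upwards [h1] with z hz
      rw [Set.indicator_of_notMem (by exact hy), Set.indicator_of_notMem (by simpa using hz)]

lemma tendsto_truncSecondMoment_ratio (hα0 : 0 < α) (hα2 : α ≤ 2)
    (hDA : InDomainOfAttraction μ α cp cm) {r : ℝ} (hr : 0 < r) :
    Tendsto (fun x => truncSecondMoment μ (r * x) / truncSecondMoment μ x) atTop (𝓝 (r ^ (2 - α))) := by
  rcases lt_or_eq_of_le hα2 with h | h
  · have hT := isRegVarTail_absTail h hDA
    have h1 := tendsto_truncSecondMoment_div_absTail hα0 h hDA
    have hrx : Tendsto (fun x : ℝ => r * x) atTop atTop := tendsto_id.const_mul_atTop hr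
    have hne : α / (2 - α) ≠ 0 := (div_pos hα0 (by linarith)).ne'
    have h2 := (((h1.comp hrx).div h1 hne).mul (hT.ratio r hr)).mul_const (r ^ 2)
    rw [div_self hne, one_mul, ← Real.rpow_natCast, ← Real.rpow_add hr] at h2
    rw [show 2 - α = -α + (2 : ℕ) by push_cast; ring]
    refine h2.congr' ?_
    filter_upwards [eventually_gt_atTop 0, h1.eventually_ne hne] with x hx hx2
    have h3 := (hT.pos x).ne'
    have h4 := (hT.pos (r * x)).ne'
    have h5 : truncSecondMoment μ x ≠ 0 := by
      intro h0
      rw [h0] at hx2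
      simp at hx2
    simp only [Function.comp, Pi.div_apply]
    field_simp
    rw [Real.rpow_natCast, mul_comm]
  · have := (hDA.gaussian h).2.2 r hr
    rwa [h, sub_self, Real.rpow_zero]

lemma eventually_truncSecondMoment_pos (hα0 : 0 < α) (hα2 : α ≤ 2)
    (hDA : InDomainOfAttraction μ α cp cm) : ∀ᶠ x in atTop, 0 < truncSecondMoment μ x := by
  filter_upwards [(tendsto_truncSecondMoment_ratio hα0 hα2 hDA one_pos).eventually
    (lt_mem_nhds (show (0 : ℝ) < 1 ^ (2 - α) by simp))] with x hx
  refine lt_of_le_of_ne (truncSecondMoment_nonneg μ x) fun h => ?_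
  rw [← h, div_zero] at hx
  exact lt_irrefl _ hx

/-- Dyadic shells: on `R < |y| ≤ 2R` one has `|y| ≤ y² / R`, so the shell contributes at most
`(V(2R) - V(R)) / R ≤ η V(R) / R`, with `V` the truncated second moment. Since `η ≤ 1/2`, `V` grows
by at most `3/2` per doubling while `R` doubles, and the geometric series of ratio `3/4` sums to
`4`. -/
lemma lintegral_abs_tail_le {η x₀ : ℝ} (hη0 : 0 ≤ η) (hη : η ≤ 1 / 2) (hx₀ : 0 < x₀)
    (hV : ∀ x, x₀ ≤ x → truncSecondMoment μ (2 * x) ≤ (1 + η) * truncSecondMoment μ x) {x : ℝ}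
    (hx : x₀ ≤ x) :
    ∫⁻ y in {y | x < |y|}, ENNReal.ofReal |y| ∂μ ≤
      ENNReal.ofReal (4 * η * truncSecondMoment μ x / x) := by
  have hx0 : 0 < x := hx₀.trans_le hx
  have hV0 := truncSecondMoment_nonneg μ x
  have hsub : {y : ℝ | x < |y|} ⊆ ⋃ k : ℕ, {y : ℝ | 2 ^ k * x < |y| ∧ |y| ≤ 2 ^ (k + 1) * x} := by
    intro y (hy : x < |y|)
    have hex : ∃ n : ℕ, |y| ≤ 2 ^ n * x := by
      obtain ⟨n, hn⟩ := pow_unbounded_of_one_lt (|y| / x) one_lt_two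
      exact ⟨n, ((div_lt_iff₀ hx0).1 hn).le⟩
    classical
    rcases hn : Nat.find hex with _ | k
    · have := Nat.find_spec hex
      rw [hn, pow_zero, one_mul] at this
      exact absurd hy (not_lt.2 this)
    · refine Set.mem_iUnion.2 ⟨k, ?_, ?_⟩
      · exact not_le.1 (Nat.find_min hex (by omega))
      · have := Nat.find_spec hex
        rwa [hn] at this
  have hgrow : ∀ k : ℕ, truncSecondMoment μ (2 ^ k * x) ≤ (3 / 2) ^ k * truncSecondMoment μ x := by
    intro k
    induction k with
    | zero => simp
    | succ k ih =>
      have h1 := hV (2 ^ k * x) (hx.trans (le_mul_of_one_le_left hx0.le (one_le_pow₀ one_le_two)))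
      rw [pow_succ', mul_assoc]
      refine h1.trans ?_
      rw [pow_succ', mul_assoc]
      have := truncSecondMoment_nonneg μ (2 ^ k * x)
      gcongr
      linarith
  have hshell : ∀ k : ℕ, ∫⁻ y in {y : ℝ | 2 ^ k * x < |y| ∧ |y| ≤ 2 ^ (k + 1) * x},
      ENNReal.ofReal |y| ∂μ ≤ ENNReal.ofReal (η * truncSecondMoment μ x / x * (3 / 4) ^ k) := by
    intro k
    have hR : 0 < 2 ^ k * x := by positivity
    have hms : MeasurableSet {y : ℝ | 2 ^ k * x < |y| ∧ |y| ≤ 2 ^ (k + 1) * x} :=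
      (measurableSet_lt_abs _).inter (measurableSet_abs_le _)
    have hi := (integrable_indicator_sq μ (2 ^ (k + 1) * x)).sub (integrable_indicator_sq μ (2 ^ k * x))
    have hi2 : Integrable (fun y => (({y : ℝ | |y| ≤ 2 ^ (k + 1) * x}.indicator (fun y => y ^ 2) y -
          {y : ℝ | |y| ≤ 2 ^ k * x}.indicator (fun y => y ^ 2) y) / (2 ^ k * x))) μ :=
      hi.div_const (2 ^ k * x)
    have hnn : ∀ y : ℝ, {y : ℝ | 2 ^ k * x < |y| ∧ |y| ≤ 2 ^ (k + 1) * x}.indicator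
        (fun y => |y|) y ≤ (({y : ℝ | |y| ≤ 2 ^ (k + 1) * x}.indicator (fun y => y ^ 2) y -
          {y : ℝ | |y| ≤ 2 ^ k * x}.indicator (fun y => y ^ 2) y) / (2 ^ k * x)) := by
      intro y
      by_cases h1 : |y| ≤ 2 ^ k * x
      · have h2 : |y| ≤ 2 ^ (k + 1) * x := h1.trans (by rw [pow_succ]; nlinarith)
        rw [Set.indicator_of_notMem (fun h => absurd h.1 (not_lt.2 h1)),
          Set.indicator_of_mem (s := {y : ℝ | |y| ≤ 2 ^ k * x}) (by exact h1),
          Set.indicator_of_mem (by exact h2), sub_self, zero_div]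
      · rw [Set.indicator_of_notMem (s := {y : ℝ | |y| ≤ 2 ^ k * x}) (by exact h1), sub_zero]
        by_cases h2 : |y| ≤ 2 ^ (k + 1) * x
        · rw [Set.indicator_of_mem (by exact ⟨not_le.1 h1, h2⟩), Set.indicator_of_mem (by exact h2),
            le_div_iff₀ hR, ← sq_abs, sq]
          exact mul_le_mul_of_nonneg_left (not_le.1 h1).le (abs_nonneg _)
        · rw [Set.indicator_of_notMem (fun h => h2 h.2), Set.indicator_of_notMem (by exact h2),
            zero_div]
    have hnn0 : ∀ y : ℝ, 0 ≤ (({y : ℝ | |y| ≤ 2 ^ (k + 1) * x}.indicator (fun y => y ^ 2) y -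
          {y : ℝ | |y| ≤ 2 ^ k * x}.indicator (fun y => y ^ 2) y) / (2 ^ k * x)) := fun y =>
      (Set.indicator_nonneg (fun _ _ => abs_nonneg _) y).trans (hnn y)
    rw [← lintegral_indicator hms]
    calc _ ≤ ∫⁻ y, ENNReal.ofReal (({y : ℝ | |y| ≤ 2 ^ (k + 1) * x}.indicator (fun y => y ^ 2) y -
          {y : ℝ | |y| ≤ 2 ^ k * x}.indicator (fun y => y ^ 2) y) / (2 ^ k * x)) ∂μ := by
          refine lintegral_mono fun y => ?_
          rw [show {y : ℝ | 2 ^ k * x < |y| ∧ |y| ≤ 2 ^ (k + 1) * x}.indicator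
            (fun y => ENNReal.ofReal |y|) y = ENNReal.ofReal
            ({y : ℝ | 2 ^ k * x < |y| ∧ |y| ≤ 2 ^ (k + 1) * x}.indicator (fun y => |y|) y) by
              simp only [Set.indicator_apply]; split_ifs <;> simp]
          exact ENNReal.ofReal_le_ofReal (hnn y)
      _ = ENNReal.ofReal ((truncSecondMoment μ (2 ^ (k + 1) * x) - truncSecondMoment μ (2 ^ k * x)) /
            (2 ^ k * x)) := by
          rw [← ofReal_integral_eq_lintegral_ofReal hi2 (ae_of_all _ hnn0), integral_div,
            truncSecondMoment_eq, truncSecondMoment_eq, integral_sub (integrable_indicator_sq μ _)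
            (integrable_indicator_sq μ _)]
      _ ≤ _ := by
          refine ENNReal.ofReal_le_ofReal ?_
          have h1 := hV (2 ^ k * x) (hx.trans (le_mul_of_one_le_left hx0.le (one_le_pow₀ one_le_two)))
          rw [← mul_assoc, ← pow_succ'] at h1
          have h2 := hgrow k
          rw [div_le_iff₀ hR]
          calc _ ≤ η * truncSecondMoment μ (2 ^ k * x) := by linarith
            _ ≤ η * ((3 / 2) ^ k * truncSecondMoment μ x) := by gcongr
            _ = _ := by
              rw [show (3 / 2 : ℝ) ^ k = (3 / 4) ^ k * 2 ^ k by rw [← mul_pow]; norm_num]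
              field_simp
  calc _ ≤ ∫⁻ y in ⋃ k : ℕ, {y : ℝ | 2 ^ k * x < |y| ∧ |y| ≤ 2 ^ (k + 1) * x}, ENNReal.ofReal |y| ∂μ :=
        lintegral_mono_set hsub
    _ ≤ ∑' k : ℕ, ∫⁻ y in {y : ℝ | 2 ^ k * x < |y| ∧ |y| ≤ 2 ^ (k + 1) * x}, ENNReal.ofReal |y| ∂μ :=
        lintegral_iUnion_le _ _
    _ ≤ ∑' k : ℕ, ENNReal.ofReal (η * truncSecondMoment μ x / x * (3 / 4) ^ k) :=
        ENNReal.tsum_le_tsum hshell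
    _ = _ := by
        rw [← ENNReal.ofReal_tsum_of_nonneg (fun k => by positivity)
          ((summable_geometric_of_lt_one (by norm_num) (by norm_num)).mul_left _), tsum_mul_left,
          tsum_geometric_of_lt_one (by norm_num) (by norm_num)]
        congr 1
        ring

lemma integrableOn_abs_tail {ν : Measure ℝ} {x c : ℝ}
    (h : ∫⁻ y in {y | x < |y|}, ENNReal.ofReal |y| ∂ν ≤ ENNReal.ofReal c) (hc : 0 ≤ c) :
    IntegrableOn (fun y => |y|) {y | x < |y|} ν ∧ ∫ y in {y | x < |y|}, |y| ∂ν ≤ c := by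
  have h1 : IntegrableOn (fun y => |y|) {y | x < |y|} ν := by
    refine ⟨continuous_abs.aestronglyMeasurable, ?_⟩
    rw [hasFiniteIntegral_iff_ofReal (ae_of_all _ fun _ => abs_nonneg _)]
    exact h.trans_lt ENNReal.ofReal_lt_top
  refine ⟨h1, ?_⟩
  rw [← ENNReal.ofReal_le_ofReal_iff hc, ofReal_integral_eq_lintegral_ofReal h1
    (ae_of_all _ fun _ => abs_nonneg _)]
  exact h

lemma norm_cexp_sub_taylor_le {t : ℝ} (ht : |t| ≤ 1) :
    ‖Complex.exp (t * Complex.I) - 1 - t * Complex.I + ((t ^ 2 / 2 : ℝ) : ℂ)‖ ≤ |t| ^ 3 := by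
  have hn : ‖(t * Complex.I : ℂ)‖ = |t| := by
    rw [norm_mul, Complex.norm_I, mul_one, Complex.norm_real, Real.norm_eq_abs]
  have := Complex.exp_bound (x := t * Complex.I) (by rw [hn]; exact ht) (n := 3) (by norm_num)
  rw [hn] at this
  simp only [Finset.sum_range_succ, Finset.sum_range_zero, Nat.factorial] at this
  have h2 : Complex.exp (t * Complex.I) - 1 - t * Complex.I + ((t ^ 2 / 2 : ℝ) : ℂ) =
      Complex.exp (t * Complex.I) - (0 + (t * Complex.I) ^ 0 / ((1 : ℕ) : ℂ) +
        (t * Complex.I) ^ 1 / (((0 + 1) * 1 : ℕ) : ℂ) + (t * Complex.I) ^ 2 / (((1 + 1) * ((0 + 1) * 1) : ℕ) : ℂ)) := by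
    push_cast
    linear_combination ((t : ℂ) ^ 2 / 2) * Complex.I_sq
  rw [h2]
  refine this.trans ?_
  have : 0 ≤ |t| ^ 3 := by positivity
  norm_num
  nlinarith

lemma norm_cexp_sub_le {t : ℝ} (ht : 1 ≤ |t|) :
    ‖Complex.exp (t * Complex.I) - 1 - t * Complex.I‖ ≤ 3 * |t| := by
  refine (norm_sub_le _ _).trans ?_
  have h1 := norm_sub_le (Complex.exp (t * Complex.I)) 1
  rw [Complex.norm_exp_ofReal_mul_I, norm_one] at h1
  rw [norm_mul, Complex.norm_I, mul_one, Complex.norm_real, Real.norm_eq_abs]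
  linarith

end

section

variable {μ : Measure ℝ} [IsProbabilityMeasure μ] {α cp cm : ℝ}

lemma eventually_abs_tail_le (hV : SlowlyVarying (truncSecondMoment μ)) {η : ℝ} (hη : 0 < η) :
    ∀ᶠ x in atTop, IntegrableOn (fun y => |y|) {y | x < |y|} μ ∧
      ∫ y in {y | x < |y|}, |y| ∂μ ≤ η * truncSecondMoment μ x / x := by
  set η' := min (η / 4) (1 / 2)
  have hη'0 : 0 < η' := by positivity
  have hη'1 : η' ≤ 1 / 2 := min_le_right _ _
  have hη'2 : 4 * η' ≤ η := by linarith [min_le_left (η / 4) (1 / 2)]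
  have h1 := (hV.2.2 2 two_pos).eventually (gt_mem_nhds (show (1 : ℝ) < 1 + η' by linarith))
  obtain ⟨x₀, hx₀⟩ := eventually_atTop.1 (h1.and (hV.2.1.and (eventually_gt_atTop 0)))
  filter_upwards [eventually_ge_atTop x₀] with x hx
  have hx0 : 0 < x := (hx₀ x hx).2.2
  have h2 := lintegral_abs_tail_le hη'0.le hη'1 (hx₀ x₀ le_rfl).2.2 (fun x hx => by
    have := (hx₀ x hx).1
    rw [div_lt_iff₀ (hx₀ x hx).2.1] at this
    exact this.le) hx
  have hVx := (hx₀ x hx).2.1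
  obtain ⟨h3, h4⟩ := integrableOn_abs_tail h2 (by positivity)
  exact ⟨h3, h4.trans (by gcongr)⟩

/-- Centring removes the linear term and the truncated quadratic term gives `V(x) / (2 x²)`; slow
variation of `V` makes every remainder `o(V(x) / x²)`. -/
lemma tendsto_charFun_gaussian (hV : SlowlyVarying (truncSecondMoment μ)) (h0 : ∫ y, y ∂μ = 0) :
    Tendsto (fun x : ℝ => (1 - charFun μ (1 / x)) / ((truncSecondMoment μ x / x ^ 2 : ℝ) : ℂ)) atTop
      (𝓝 (1 / 2)) := by
  rw [Metric.tendsto_nhds]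
  intro ε' hε'
  set ε := min (ε' / 4) 1
  have hε : 0 < ε := by positivity
  have hε1 : ε ≤ 1 := min_le_right _ _
  have hε2 : 4 * ε ≤ ε' := by linarith [min_le_left (ε' / 4) 1]
  have hrat := (hV.2.2 ε hε).eventually (lt_mem_nhds (show 1 - ε < 1 by linarith))
  filter_upwards [eventually_abs_tail_le hV (η := ε / 6) (by positivity), hV.2.1, hrat,
    eventually_gt_atTop 0] with x ⟨htail, htail'⟩ hVx hratx hx
  rw [lt_div_iff₀ hVx] at hratx
  set V := truncSecondMoment μ with hVdef
  have hint_abs : Integrable (fun y : ℝ => |y|) μ := by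
    rw [← integrableOn_univ, show (Set.univ : Set ℝ) = {y | |y| ≤ x} ∪ {y | x < |y|} by
      ext y; simp [le_or_gt]]
    refine IntegrableOn.union ?_ htail
    refine Integrable.of_bound (C := x) continuous_abs.aestronglyMeasurable ?_
    filter_upwards [ae_restrict_mem (measurableSet_abs_le x)] with y hy
    rw [Real.norm_of_nonneg (abs_nonneg y)]
    exact hy
  have hint_id : Integrable (fun y : ℝ => y) μ := by
    refine hint_abs.mono' (by fun_prop) (ae_of_all _ fun y => le_of_eq (Real.norm_eq_abs y))
  have hi1 := integrable_one_sub_cexp μ x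
  have hi2 : Integrable (fun y : ℝ => ((y / x : ℝ) : ℂ) * Complex.I) μ :=
    ((hint_id.div_const x).ofReal).mul_const _
  have hi3 : Integrable (fun y : ℝ => (({y : ℝ | |y| ≤ x}.indicator (fun y => y ^ 2) y / (2 * x ^ 2) : ℝ) : ℂ)) μ :=
    ((integrable_indicator_sq μ x).div_const _).ofReal
  have hmain : (1 - charFun μ (1 / x)) - ((V x / (2 * x ^ 2) : ℝ) : ℂ) =
      ∫ y, (1 - Complex.exp ((y / x : ℝ) * Complex.I) + ((y / x : ℝ) : ℂ) * Complex.I -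
        (({y : ℝ | |y| ≤ x}.indicator (fun y => y ^ 2) y / (2 * x ^ 2) : ℝ) : ℂ)) ∂μ := by
    have hi12 : Integrable (fun y : ℝ => 1 - Complex.exp ((y / x : ℝ) * Complex.I) +
        ((y / x : ℝ) : ℂ) * Complex.I) μ := hi1.add hi2
    rw [integral_sub hi12 hi3, integral_add hi1 hi2, ← one_sub_charFun_inv,
      integral_mul_const, integral_complex_ofReal, integral_complex_ofReal, integral_div, integral_div,
      h0, ← truncSecondMoment_eq]
    simp [hVdef]
  -- Three ranges: for `|y| ≤ ε x` the cubic remainder is at most `ε y² / x²`; for `ε x < |y| ≤ x`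
  -- it is at most `y² / x²`, with mass `V x - V (ε x) ≤ ε V x`; beyond `x` the crude bound `3 |y| /
  -- x` meets the tail estimate with `η = ε / 6`. The total is `(5/2) ε V x / x²`.
  set D : ℝ → ℝ := fun y => ε / x ^ 2 * {y : ℝ | |y| ≤ x}.indicator (fun y => y ^ 2) y +
    1 / x ^ 2 * ({y : ℝ | |y| ≤ x}.indicator (fun y => y ^ 2) y -
      {y : ℝ | |y| ≤ ε * x}.indicator (fun y => y ^ 2) y) +
    3 / x * {y : ℝ | x < |y|}.indicator (fun y => |y|) y with hD
  have hj1 := (integrable_indicator_sq μ x).const_mul (ε / x ^ 2)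
  have hj2 : Integrable (fun y => 1 / x ^ 2 * ({y : ℝ | |y| ≤ x}.indicator (fun y => y ^ 2) y -
      {y : ℝ | |y| ≤ ε * x}.indicator (fun y => y ^ 2) y)) μ :=
    ((integrable_indicator_sq μ x).sub (integrable_indicator_sq μ (ε * x))).const_mul (1 / x ^ 2)
  have hj3 := (htail.integrable_indicator (measurableSet_lt_abs x)).const_mul (3 / x)
  have hDint : ∫ y, D y ∂μ = ε / x ^ 2 * V x + 1 / x ^ 2 * (V x - V (ε * x)) +
      3 / x * ∫ y in {y | x < |y|}, |y| ∂μ := by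
    have e1 : Integrable (fun y => ε / x ^ 2 * {y : ℝ | |y| ≤ x}.indicator (fun y => y ^ 2) y +
      1 / x ^ 2 * ({y : ℝ | |y| ≤ x}.indicator (fun y => y ^ 2) y -
      {y : ℝ | |y| ≤ ε * x}.indicator (fun y => y ^ 2) y)) μ := hj1.add hj2
    rw [hD, integral_add e1 hj3, integral_add hj1 hj2, integral_const_mul, integral_const_mul,
      integral_const_mul, integral_sub (integrable_indicator_sq μ x) (integrable_indicator_sq μ (ε * x)),
      ← truncSecondMoment_eq, ← truncSecondMoment_eq, integral_indicator (measurableSet_lt_abs x)]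
  have hbound : ‖(1 - charFun μ (1 / x)) - ((V x / (2 * x ^ 2) : ℝ) : ℂ)‖ ≤ ∫ y, D y ∂μ := by
    rw [hmain]
    refine norm_integral_le_of_norm_le ((hj1.add hj2).add hj3) (ae_of_all _ fun y => ?_)
    have hyx : |y / x| = |y| / x := by rw [abs_div, abs_of_pos hx]
    by_cases hy : |y| ≤ x
    · have h1 : |y / x| ≤ 1 := by rw [hyx]; exact (div_le_one hx).2 hy
      have h2 := norm_cexp_sub_taylor_le h1
      rw [Set.indicator_of_mem (by exact hy), ← norm_neg]
      rw [show -(1 - Complex.exp ((y / x : ℝ) * Complex.I) + ((y / x : ℝ) : ℂ) * Complex.I -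
          ((y ^ 2 / (2 * x ^ 2) : ℝ) : ℂ)) = Complex.exp ((y / x : ℝ) * Complex.I) - 1 -
          ((y / x : ℝ) : ℂ) * Complex.I + (((y / x) ^ 2 / 2 : ℝ) : ℂ) by push_cast; ring]
      refine h2.trans ?_
      have h3 : |y / x| ^ 3 = |y| / x * (y ^ 2 / x ^ 2) := by
        rw [hyx, ← sq_abs y]; ring
      have h4 : D y = ε / x ^ 2 * y ^ 2 + 1 / x ^ 2 * (y ^ 2 -
          {y : ℝ | |y| ≤ ε * x}.indicator (fun y => y ^ 2) y) := by
        simp only [hD]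
        rw [Set.indicator_of_mem (s := {y : ℝ | |y| ≤ x}) (by exact hy),
          Set.indicator_of_notMem (s := {y : ℝ | x < |y|}) (by simpa using hy)]
        ring
      change _ ≤ D y
      rw [h3, h4]
      have h5 : 0 ≤ y ^ 2 / x ^ 2 := by positivity
      by_cases hy2 : |y| ≤ ε * x
      · rw [Set.indicator_of_mem (by exact hy2), sub_self, mul_zero, add_zero]
        have : |y| / x ≤ ε := (div_le_iff₀ hx).2 hy2
        calc _ ≤ ε * (y ^ 2 / x ^ 2) := by gcongr
          _ = _ := by ring
      · rw [Set.indicator_of_notMem (by exact hy2), sub_zero]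
        have h6 : |y| / x ≤ 1 := (div_le_one hx).2 hy
        have h7 : 0 ≤ ε * (y ^ 2 / x ^ 2) := by positivity
        calc _ ≤ 1 * (y ^ 2 / x ^ 2) := by gcongr
          _ ≤ ε * (y ^ 2 / x ^ 2) + 1 * (y ^ 2 / x ^ 2) := by linarith
          _ = _ := by ring
    · have hy' : x < |y| := not_le.1 hy
      have h1 : 1 ≤ |y / x| := by rw [hyx]; exact (one_le_div hx).2 hy'.le
      have h2 := norm_cexp_sub_le h1
      have hy3 : ¬ |y| ≤ ε * x := not_le.2 (lt_of_le_of_lt (mul_le_of_le_one_left hx.le hε1) hy')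
      have h4 : D y = 3 / x * |y| := by
        simp only [hD]
        rw [Set.indicator_of_notMem (s := {y : ℝ | |y| ≤ x}) (by exact hy),
          Set.indicator_of_notMem (s := {y : ℝ | |y| ≤ ε * x}) (by exact hy3),
          Set.indicator_of_mem (s := {y : ℝ | x < |y|}) (by exact hy')]
        ring
      change _ ≤ D y
      rw [Set.indicator_of_notMem (by exact hy), h4, ← norm_neg]
      rw [show -(1 - Complex.exp ((y / x : ℝ) * Complex.I) + ((y / x : ℝ) : ℂ) * Complex.I -
          ((0 / (2 * x ^ 2) : ℝ) : ℂ)) = Complex.exp ((y / x : ℝ) * Complex.I) - 1 -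
          ((y / x : ℝ) : ℂ) * Complex.I by push_cast; ring]
      rw [hyx] at h2
      refine h2.trans (le_of_eq ?_)
      ring
  have hVx2 : 0 < V x / x ^ 2 := by positivity
  have hfin : ∫ y, D y ∂μ ≤ (5 / 2 * ε) * (V x / x ^ 2) := by
    rw [hDint]
    have h1 : 3 / x * ∫ y in {y | x < |y|}, |y| ∂μ ≤ 3 / x * (ε / 6 * V x / x) := by gcongr
    have h2 : 1 / x ^ 2 * (V x - V (ε * x)) ≤ 1 / x ^ 2 * (ε * V x) := by
      gcongr
      linarith
    calc _ ≤ ε / x ^ 2 * V x + 1 / x ^ 2 * (ε * V x) + 3 / x * (ε / 6 * V x / x) := by linarith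
      _ = _ := by field_simp; ring
  have hVc : ((V x / x ^ 2 : ℝ) : ℂ) ≠ 0 := by exact_mod_cast hVx2.ne'
  have e : ((V x / (2 * x ^ 2) : ℝ) : ℂ) = ((V x / x ^ 2 : ℝ) : ℂ) * (1 / 2) := by
    push_cast
    ring
  rw [dist_eq_norm, show (1 - charFun μ (1 / x)) / ((V x / x ^ 2 : ℝ) : ℂ) - 1 / 2 =
    ((1 - charFun μ (1 / x)) - ((V x / (2 * x ^ 2) : ℝ) : ℂ)) / ((V x / x ^ 2 : ℝ) : ℂ) by
      rw [e, sub_div _ (_ * _), mul_div_cancel_left₀ _ hVc], norm_div, Complex.norm_real, Real.norm_of_nonneg hVx2.le, div_lt_iff₀ hVx2]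
  calc _ ≤ _ := hbound.trans hfin
    _ < ε' * (V x / x ^ 2) := by gcongr; linarith

/-! ### The weight function near zero -/

lemma weight_abs (ν : Measure ℝ) (α s : ℝ) : weight ν α |s| = weight ν α s := by
  simp [weight]

lemma weight_nonneg (ν : Measure ℝ) (hα0 : 0 < α) (hα2 : α ≤ 2) (s : ℝ) : 0 ≤ weight ν α s := by
  unfold weight L
  have h1 := (kappa_pos hα0 hα2).le
  unfold kappa at h1
  have h2 := truncSecondMoment_nonneg ν (max (1 / |s|) (cutoff ν))
  have h3 : 0 ≤ max (1 / |s|) (cutoff ν) := le_max_of_le_left (by positivity)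
  positivity

lemma weight_zero (ν : Measure ℝ) (hα0 : 0 < α) : weight ν α 0 = 0 := by
  rw [weight, abs_zero, Real.zero_rpow hα0.ne', zero_mul]

/-- For small `s` the cutoff plays no role and the powers of `s` combine, so the cases `α < 2` and
`α = 2` share one formula. -/
lemma weight_eq (ν : Measure ℝ) {s : ℝ} (hs : 0 < s) (hc : cutoff ν ≤ 1 / s) :
    weight ν α s = kappa α * (s ^ 2 * truncSecondMoment ν (1 / s)) := by
  rw [weight, L, abs_of_pos hs, max_eq_left hc, one_div, Real.inv_rpow hs.le, ← Real.rpow_neg hs.le,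
    ← kappa]
  have : s ^ α * s ^ (-(α - 2)) = s ^ 2 := by
    rw [← Real.rpow_add hs, ← Real.rpow_natCast]
    congr 1
    push_cast
    ring
  rw [← this]
  ring

lemma tendsto_inv_nhdsGT_atTop : Tendsto (fun s : ℝ => 1 / s) (𝓝[>] 0) atTop := by
  simpa using tendsto_inv_nhdsGT_zero (𝕜 := ℝ)

lemma eventually_weight_eq (ν : Measure ℝ) (α : ℝ) : ∀ᶠ s in 𝓝[>] (0 : ℝ),
    weight ν α s = kappa α * (s ^ 2 * truncSecondMoment ν (1 / s)) := by
  filter_upwards [self_mem_nhdsWithin, tendsto_inv_nhdsGT_atTop.eventually_ge_atTop (cutoff ν)]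
    with s hs hs2
  exact weight_eq ν hs hs2

lemma eventually_weight_pos (hα0 : 0 < α) (hα2 : α ≤ 2) (hDA : InDomainOfAttraction μ α cp cm) :
    ∀ᶠ s in 𝓝[>] (0 : ℝ), 0 < weight μ α s := by
  filter_upwards [eventually_weight_eq μ α, self_mem_nhdsWithin,
    tendsto_inv_nhdsGT_atTop.eventually (eventually_truncSecondMoment_pos hα0 hα2 hDA)] with s hs hs0 hV
  have hs0 : 0 < s := hs0
  have := kappa_pos hα0 hα2
  rw [hs]
  positivity

/-- The index is `2 - (2 - α) = α`: the truncated second moment has index `2 - α` at infinity and is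
evaluated at `1 / s`. -/
lemma tendsto_weight_ratio (hα0 : 0 < α) (hα2 : α ≤ 2) (hDA : InDomainOfAttraction μ α cp cm)
    {r : ℝ} (hr : 0 < r) :
    Tendsto (fun s => weight μ α (r * s) / weight μ α s) (𝓝[>] 0) (𝓝 (r ^ α)) := by
  have hrs : Tendsto (fun s : ℝ => r * s) (𝓝[>] 0) (𝓝[>] 0) := by
    refine tendsto_nhdsWithin_iff.2 ⟨?_, ?_⟩
    · have : Tendsto (fun s : ℝ => r * s) (𝓝 0) (𝓝 (r * 0)) := tendsto_id.const_mul r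
      rw [mul_zero] at this
      exact this.mono_left nhdsWithin_le_nhds
    · filter_upwards [self_mem_nhdsWithin] with s hs
      exact mul_pos hr hs
  have h1 := ((tendsto_truncSecondMoment_ratio hα0 hα2 hDA (inv_pos.2 hr)).comp
    tendsto_inv_nhdsGT_atTop).const_mul (r ^ 2)
  have h2 : r ^ 2 * r⁻¹ ^ (2 - α) = r ^ α := by
    rw [Real.inv_rpow hr.le, ← Real.rpow_neg hr.le, ← Real.rpow_natCast, ← Real.rpow_add hr]
    congr 1
    push_cast
    ring
  rw [h2] at h1
  refine h1.congr' ?_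
  filter_upwards [eventually_weight_eq μ α, hrs.eventually (eventually_weight_eq μ α),
    self_mem_nhdsWithin] with s hs1 hs2 hs0
  have hs0 : 0 < s := hs0
  have hk := (kappa_pos hα0 hα2).ne'
  rw [hs1, hs2]
  simp only [Function.comp]
  rw [show r⁻¹ * (1 / s) = 1 / (r * s) by field_simp, mul_div_mul_left _ _ hk, mul_pow, mul_assoc,
    mul_div_assoc, mul_div_mul_left _ _ (by positivity)]

lemma tendsto_charFun_weight (hα0 : 0 < α) (hα2 : α ≤ 2) (hDA : InDomainOfAttraction μ α cp cm)
    (hA : ConditionA μ α) :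
    Tendsto (fun s : ℝ => (1 - charFun μ s) / (weight μ α s : ℂ)) (𝓝[>] 0)
      (𝓝 (stableConst α * (1 - Complex.I * (((cp - cm) * tau α 1 : ℝ) : ℂ)))) := by
  rcases lt_or_eq_of_le hα2 with h | h
  · have hT := isRegVarTail_absTail h hDA
    have h1 := (tendsto_charFun_absTail hα0 h hDA hA).comp tendsto_inv_nhdsGT_atTop
    have h2 := (tendsto_truncSecondMoment_div_absTail hα0 h hDA).comp tendsto_inv_nhdsGT_atTop
    have h2a : (2 - α) ≠ 0 := by linarith
    have h3 := (Complex.continuous_ofReal.tendsto _).comp (h2.const_mul (kappa α))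
    rw [show kappa α * (α / (2 - α)) = 1 by
      rw [kappa, if_neg h.ne]; field_simp] at h3
    have h4 := h1.div h3 (by simp)
    rw [Complex.ofReal_one, div_one] at h4
    refine h4.congr' ?_
    filter_upwards [eventually_weight_eq μ α, self_mem_nhdsWithin] with s hs1 hs0
    have hs0 : 0 < s := hs0
    have h5 : (absTail μ (1 / s) : ℂ) ≠ 0 := by exact_mod_cast (hT.pos (1 / s)).ne'
    simp only [Function.comp, Pi.div_apply]
    rw [hs1, one_div_one_div]
    push_cast
    by_cases h6 : (truncSecondMoment μ (1 / s) : ℂ) = 0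
    · rw [h6]; simp
    have h7 : (s : ℂ) ≠ 0 := by exact_mod_cast hs0.ne'
    have h8 : (kappa α : ℂ) ≠ 0 := by exact_mod_cast (kappa_pos hα0 hα2).ne'
    field_simp
  · have h1 := (tendsto_charFun_gaussian (hDA.gaussian h) (hA.1 (by linarith))).comp
      tendsto_inv_nhdsGT_atTop
    have h2 : (stableConst α * (1 - Complex.I * (((cp - cm) * tau α 1 : ℝ) : ℂ)) : ℂ) = 1 / 2 := by
      have : tau α 1 = 0 := by
        rw [tau, if_neg (by linarith), h, show Real.pi * 2 / 2 = Real.pi by ring, Real.tan_pi, mul_zero]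
      rw [this, stableConst, if_pos h]
      simp
    rw [h2]
    refine h1.congr' ?_
    filter_upwards [eventually_weight_eq μ α, self_mem_nhdsWithin] with s hs1 hs0
    simp only [Function.comp]
    rw [hs1, kappa, if_pos h, one_div_one_div]
    congr 2
    rw [one_mul, one_div, inv_pow, div_inv_eq_mul, mul_comm]

end

/-! ### Upper bounds for the modulus of the characteristic function -/

section

variable {μ : Measure ℝ} [IsProbabilityMeasure μ] {α cp cm : ℝ}

lemma stableConst_pos (hα0 : 0 < α) (hα2 : α ≤ 2) : 0 < stableConst α := by
  unfold stableConst
  have hπ := Real.pi_pos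
  split_ifs with h2 h1
  · norm_num
  · positivity
  · rcases lt_or_gt_of_ne h1 with h | h
    · refine mul_pos (Real.Gamma_pos_of_pos (by linarith)) (Real.cos_pos_of_mem_Ioo ⟨?_, ?_⟩)
      · have : 0 < Real.pi * α := by positivity
        linarith
      · have : Real.pi * α < Real.pi * 1 := by gcongr
        linarith
    · have h3 : α < 2 := lt_of_le_of_ne hα2 h2
      have h4 : Real.Gamma (2 - α) = (1 - α) * Real.Gamma (1 - α) := by
        rw [← Real.Gamma_add_one (by linarith)]
        ring_nf
      have h5 : 0 < Real.Gamma (2 - α) := Real.Gamma_pos_of_pos (by linarith)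
      have h6 : Real.Gamma (1 - α) < 0 := by
        by_contra! h7
        have := mul_nonpos_of_nonpos_of_nonneg (show 1 - α ≤ 0 by linarith) h7
        linarith
      refine mul_pos_of_neg_of_neg h6 (Real.cos_neg_of_pi_div_two_lt_of_lt ?_ ?_)
      · have : Real.pi * 1 < Real.pi * α := by gcongr
        linarith
      · have : Real.pi * α < Real.pi * 2 := by gcongr
        linarith

lemma stableConst_mul_re (y : ℝ) :
    ((stableConst α : ℂ) * (1 - Complex.I * (y : ℂ))).re = stableConst α := by
  simp

lemma norm_charFun_abs (ν : Measure ℝ) (s : ℝ) : ‖charFun ν |s|‖ = ‖charFun ν s‖ := by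
  rcases abs_choice s with h | h
  · rw [h]
  · rw [h, charFun_neg, RCLike.norm_conj]

/-- Read off from the expansion: `1 - φ(s) → 0` while its ratio to the weight has a nonzero limit,
the real part of which is `c_α > 0`. -/
lemma tendsto_weight_zero (hα0 : 0 < α) (hα2 : α ≤ 2) (hDA : InDomainOfAttraction μ α cp cm)
    (hA : ConditionA μ α) : Tendsto (fun s => weight μ α s) (𝓝[>] 0) (𝓝 0) := by
  have h1 := tendsto_charFun_weight hα0 hα2 hDA hA
  have h0 : (stableConst α * (1 - Complex.I * (((cp - cm) * tau α 1 : ℝ) : ℂ)) : ℂ) ≠ 0 := by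
    intro h
    have := stableConst_mul_re (α := α) ((cp - cm) * tau α 1)
    rw [h] at this
    exact (stableConst_pos hα0 hα2).ne this
  have h2 : Tendsto (fun s : ℝ => 1 - charFun μ s) (𝓝[>] 0) (𝓝 0) := by
    have : Continuous (charFun μ) := continuous_charFun
    have hc : Continuous (fun s : ℝ => 1 - charFun μ s) := continuous_const.sub this
    have h := hc.tendsto 0
    simp only [charFun_zero, probReal_univ, Complex.ofReal_one, sub_self] at h
    exact h.mono_left nhdsWithin_le_nhds
  have h3 := (h2.div h1 h0).norm
  rw [zero_div, norm_zero] at h3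
  refine h3.congr' ?_
  filter_upwards [eventually_weight_pos hα0 hα2 hDA, h1.eventually_ne h0] with s hs hne
  have h4 : 1 - charFun μ s ≠ 0 := by
    intro h
    simp [h] at hne
  simp only [Pi.div_apply]
  rw [div_div_cancel₀ h4, Complex.norm_real, Real.norm_of_nonneg hs.le]

/-- With `φ = 1 - w z`, `|φ|² = 1 - 2 w Re z + w² |z|²`. Here `Re z` exceeds `c_α / 2`, and the
bound on `w` keeps the last term below `w c_α / 2`, so `|φ|² ≤ exp (-w c_α / 2)`. -/
lemma exists_norm_charFun_le_exp (hα0 : 0 < α) (hα2 : α ≤ 2) (hDA : InDomainOfAttraction μ α cp cm)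
    (hA : ConditionA μ α) :
    ∃ C > 0, ∃ s₀ > 0, ∀ s, |s| ≤ s₀ → ‖charFun μ s‖ ≤ Real.exp (-C * weight μ α s) := by
  have h1 := tendsto_charFun_weight hα0 hα2 hDA hA
  set ζ : ℂ := stableConst α * (1 - Complex.I * (((cp - cm) * tau α 1 : ℝ) : ℂ)) with hζ
  have hc := stableConst_pos hα0 hα2
  set k := stableConst α with hk
  have hre : ζ.re = k := stableConst_mul_re _
  have h2 : ∀ᶠ s in 𝓝[>] (0 : ℝ), k / 2 < ((1 - charFun μ s) / (weight μ α s : ℂ)).re := by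
    refine ((Complex.continuous_re.tendsto _).comp h1).eventually (lt_mem_nhds ?_)
    rw [hre]
    linarith
  have h3 : ∀ᶠ s in 𝓝[>] (0 : ℝ), ‖(1 - charFun μ s) / (weight μ α s : ℂ)‖ < ‖ζ‖ + 1 :=
    h1.norm.eventually (gt_mem_nhds (by linarith))
  have h4 : ∀ᶠ s in 𝓝[>] (0 : ℝ), weight μ α s < k / (2 * (‖ζ‖ + 1) ^ 2) :=
    (tendsto_weight_zero hα0 hα2 hDA hA).eventually (gt_mem_nhds (by positivity))
  have hev : ∀ᶠ s in 𝓝[>] (0 : ℝ), ‖charFun μ s‖ ≤ Real.exp (-(k / 4) * weight μ α s) := by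
    filter_upwards [h2, h3, h4, eventually_weight_pos hα0 hα2 hDA] with s h2 h3 h4 hw
    set w := weight μ α s
    set z := (1 - charFun μ s) / (w : ℂ) with hz
    have hwc : (w : ℂ) ≠ 0 := by exact_mod_cast hw.ne'
    have e : charFun μ s = 1 - w * z := by
      rw [hz, mul_div_cancel₀ _ hwc]; ring
    have h5 : ‖charFun μ s‖ ^ 2 = 1 - 2 * w * z.re + w ^ 2 * ‖z‖ ^ 2 := by
      rw [e, Complex.sq_norm, Complex.sq_norm, Complex.normSq_apply, Complex.normSq_apply]
      simp
      ring
    rw [lt_div_iff₀ (by positivity)] at h4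
    have h6 : ‖z‖ ^ 2 ≤ (‖ζ‖ + 1) ^ 2 := by gcongr
    have h7 : ‖charFun μ s‖ ^ 2 ≤ 1 - w * (k / 2) := by
      rw [h5]
      have h8 : w ^ 2 * ‖z‖ ^ 2 ≤ w ^ 2 * (‖ζ‖ + 1) ^ 2 := by gcongr
      have h9 : w * (w * (2 * (‖ζ‖ + 1) ^ 2)) ≤ w * k := by gcongr
      have h10 : w * (k / 2) ≤ w * z.re := by gcongr
      nlinarith
    have h8 : ‖charFun μ s‖ ^ 2 ≤ Real.exp (-(k / 4) * w) ^ 2 := by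
      rw [← Real.exp_nat_mul]
      refine h7.trans ?_
      have := Real.add_one_le_exp (-(w * (k / 2)))
      refine le_trans (by linarith) (this.trans (le_of_eq ?_))
      congr 1
      push_cast
      ring
    exact le_of_sq_le_sq h8 (Real.exp_pos _).le
  obtain ⟨s₁, hs₁, h⟩ := mem_nhdsGT_iff_exists_Ioc_subset.1 hev
  have hs₁ : 0 < s₁ := hs₁
  refine ⟨k / 4, by positivity, s₁, hs₁, fun s hs => ?_⟩
  rcases eq_or_ne s 0 with rfl | hs0
  · simp [weight_zero μ hα0]
  · have := h (show |s| ∈ Set.Ioc 0 s₁ from ⟨abs_pos.2 hs0, hs⟩)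
    simpa [norm_charFun_abs, weight_abs] using this

/-- A one-sided Potter bound for the weight. The exponent `α / 2` is any choice below `α`: it
corresponds to growth of the truncated second moment of order `2 - α / 2 > 2 - α`. -/
lemma exists_weight_lower_bound (hα0 : 0 < α) (hα2 : α ≤ 2) (hDA : InDomainOfAttraction μ α cp cm) :
    ∃ C > 0, ∃ s₀ > 0, ∀ s t, 1 ≤ |t| → |s * t| ≤ s₀ →
      |t| ^ (α / 2) * weight μ α s ≤ C * weight μ α (s * t) := by
  have hr := (tendsto_truncSecondMoment_ratio hα0 hα2 hDA two_pos).eventually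
    (gt_mem_nhds (show (2 : ℝ) ^ (2 - α) < 2 ^ (2 - α / 2) from
      Real.rpow_lt_rpow_of_exponent_lt one_lt_two (by linarith)))
  obtain ⟨x₀, hx₀⟩ := eventually_atTop.1 ((hr.and (eventually_truncSecondMoment_pos hα0 hα2 hDA)).and
    ((eventually_ge_atTop (cutoff μ)).and (eventually_gt_atTop 0)))
  have hx₀0 : 0 < x₀ := (hx₀ x₀ le_rfl).2.2
  have hpot : ∀ x y, x₀ ≤ x → 1 ≤ y → truncSecondMoment μ (x * y) ≤
      2 ^ (2 - α / 2) * y ^ (2 - α / 2) * truncSecondMoment μ x := fun x y hx hy =>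
    le_rpow_of_monotone_of_doubling monotone_truncSecondMoment (truncSecondMoment_nonneg μ)
      (by linarith) hx₀0 (fun x hx => by
        have := (hx₀ x hx).1
        rw [div_lt_iff₀ this.2] at this
        exact this.1.le) hx hy
  refine ⟨2 ^ (2 - α / 2), by positivity, 1 / x₀, by positivity, fun s t ht hst => ?_⟩
  rcases eq_or_ne s 0 with rfl | hs0
  · simp [weight_zero μ hα0]
  rw [← weight_abs μ α s, ← weight_abs μ α (s * t)]
  rw [abs_mul] at hst ⊢
  have hs : 0 < |s| := abs_pos.2 hs0
  set s := |s|
  set t := |t|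
  have ht0 : 0 < t := by linarith
  have h1 : x₀ ≤ 1 / (s * t) := by
    rw [le_one_div hx₀0 (by positivity)]
    exact hst
  have h2 : 1 / (s * t) ≤ 1 / s :=
    one_div_le_one_div_of_le hs (le_mul_of_one_le_right hs.le ht)
  have h3 := hpot _ t h1 ht
  rw [weight_eq μ hs ((hx₀ _ (h1.trans h2)).2.1), weight_eq μ (by positivity) ((hx₀ _ h1).2.1)]
  rw [show 1 / (s * t) * t = 1 / s by field_simp] at h3
  have hk := (kappa_pos hα0 hα2).le
  have h4 : t ^ (α / 2) * t ^ (2 - α / 2) = t ^ 2 := by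
    rw [← Real.rpow_add ht0, ← Real.rpow_natCast]
    congr 1
    push_cast
    ring
  calc _ ≤ t ^ (α / 2) * (kappa α * (s ^ 2 * (2 ^ (2 - α / 2) * t ^ (2 - α / 2) *
        truncSecondMoment μ (1 / (s * t))))) := by gcongr
    _ = 2 ^ (2 - α / 2) * (kappa α * (s ^ 2 * (t ^ (α / 2) * t ^ (2 - α / 2)) *
        truncSecondMoment μ (1 / (s * t)))) := by ring
    _ = _ := by rw [h4]; ring

/-- If `|φ(s)| = 1` with argument `θ`, then `cos (s y - θ)` has mean `1`, so `s y - θ` lies in `2πℤ`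
almost surely and the law is lattice. -/
lemma norm_charFun_lt_one (hnl : IsNonLattice μ) {s : ℝ} (hs : s ≠ 0) : ‖charFun μ s‖ < 1 := by
  refine lt_of_le_of_ne (norm_charFun_le_one s) fun h => hnl ?_
  rw [← norm_charFun_abs] at h
  have hs : 0 < |s| := abs_pos.2 hs
  set s := |s|
  set θ := Complex.arg (charFun μ s)
  have h1 : charFun μ s = Complex.exp (θ * Complex.I) := by
    conv_lhs => rw [← Complex.norm_mul_exp_arg_mul_I (charFun μ s), h]
    simp [θ]
  have hint : Integrable (fun y : ℝ => Complex.exp ((s * y - θ : ℝ) * Complex.I)) μ := by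
    refine Integrable.of_bound (C := 1) (by fun_prop) (ae_of_all _ fun y => ?_)
    rw [Complex.norm_exp_ofReal_mul_I]
  have h2 : ∫ y, Complex.exp ((s * y - θ : ℝ) * Complex.I) ∂μ = 1 := by
    have : ∀ y : ℝ, Complex.exp ((s * y - θ : ℝ) * Complex.I) =
        Complex.exp (s * y * Complex.I) * Complex.exp (-(θ * Complex.I)) := fun y => by
      rw [← Complex.exp_add]; congr 1; push_cast; ring
    simp_rw [this]
    rw [integral_mul_const, ← charFun_apply_real, h1, ← Complex.exp_add, add_neg_cancel,
      Complex.exp_zero]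
  have h3 : ∫ y, Real.cos (s * y - θ) ∂μ = 1 := by
    have := congrArg Complex.re h2
    rw [← RCLike.re_eq_complex_re, ← integral_re hint] at this
    simpa only [RCLike.re_eq_complex_re, Complex.exp_ofReal_mul_I_re, Complex.one_re] using this
  have hcos : Integrable (fun y : ℝ => Real.cos (s * y - θ)) μ :=
    Integrable.of_bound (C := 1) (by fun_prop) (ae_of_all _ fun y => Real.abs_cos_le_one _)
  have h4 : ∫ y, (1 - Real.cos (s * y - θ)) ∂μ = 0 := by
    rw [integral_sub (integrable_const _) hcos, h3]
    simp
  have hcos' : Integrable (fun y : ℝ => 1 - Real.cos (s * y - θ)) μ := (integrable_const _).sub hcos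
  rw [integral_eq_zero_iff_of_nonneg (fun y => by simpa using Real.cos_le_one _) hcos'] at h4
  refine ⟨θ / s, 2 * Real.pi / s, by positivity, ?_⟩
  filter_upwards [h4] with y hy
  have hy : 1 - Real.cos (s * y - θ) = 0 := hy
  obtain ⟨k, hk⟩ := (Real.cos_eq_one_iff _).1 (show Real.cos (s * y - θ) = 1 by linarith)
  refine ⟨k, ?_⟩
  field_simp
  linarith

/-- Merges the two frequency ranges into one exponential bound that can be multiplied over `i`. For
`|c t| ≤ r` the expansion at zero and the Potter bound apply; for `r ≤ |c t| ≤ U` non-latticeness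
and compactness give `|φ| ≤ ρ < 1`. -/
lemma exists_norm_charFun_mul_le (hα0 : 0 < α) (hα2 : α ≤ 2) (hDA : InDomainOfAttraction μ α cp cm)
    (hA : ConditionA μ α) (hnl : IsNonLattice μ) {U : ℝ} (hU : 0 < U) :
    ∃ C > 0, ∃ c₀ > 0, ∀ c t, |c| ≤ c₀ → 1 ≤ |t| → |c * t| ≤ U →
      ‖charFun μ (c * t)‖ ≤ Real.exp (-C * (|t| ^ (α / 2) * weight μ α c)) := by
  obtain ⟨C₁, hC₁, s₁, hs₁, h1⟩ := exists_norm_charFun_le_exp hα0 hα2 hDA hA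
  obtain ⟨C₂, hC₂, s₂, hs₂, h2⟩ := exists_weight_lower_bound hα0 hα2 hDA
  set r := min s₁ s₂
  have hr : 0 < r := lt_min hs₁ hs₂
  obtain ⟨ρ, hρ0, hρ1, hρ⟩ : ∃ ρ, 0 < ρ ∧ ρ < 1 ∧ ∀ s, r ≤ |s| → |s| ≤ U → ‖charFun μ s‖ ≤ ρ := by
    rcases le_or_gt r U with hrU | hrU
    · have hcont : Continuous (fun s : ℝ => ‖charFun μ s‖) := continuous_charFun.norm
      obtain ⟨s', hs', hmax⟩ := isCompact_Icc.exists_isMaxOn (Set.nonempty_Icc.2 hrU)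
        hcont.continuousOn
      refine ⟨max (1 / 2) ‖charFun μ s'‖, by positivity, max_lt (by norm_num)
        (norm_charFun_lt_one hnl (hr.trans_le hs'.1).ne'), fun s hs1 hs2 => ?_⟩
      rw [← norm_charFun_abs]
      exact (hmax ⟨hs1, hs2⟩).trans (le_max_right _ _)
    · exact ⟨1 / 2, by norm_num, by norm_num, fun s h1 h2 => by linarith⟩
  -- On `|c t| ≤ U` the quantity `|t| ^ (α/2) * weight μ α c` never exceeds `M`: bound `|t|` by `(U
  -- / r) (r / |c|)` and apply the Potter bound at `t = r / |c|`. Hence the constant `ρ` is at most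
  -- `exp (-C |t| ^ (α/2) w(c))` once `C ≤ -log ρ / M`.
  set M := (U / r) ^ (α / 2) * (C₂ * weight μ α r) + 1
  have hwr := weight_nonneg μ hα0 hα2 r
  have hM : 0 < M := by positivity
  have hlog : 0 < -Real.log ρ := by linarith [Real.log_neg hρ0 hρ1]
  refine ⟨min (C₁ / C₂) (-Real.log ρ / M), by positivity, r, hr, fun c t hc ht hct => ?_⟩
  have hwc := weight_nonneg μ hα0 hα2 c
  rcases le_or_gt |c * t| r with h | h
  · refine (h1 _ (h.trans (min_le_left _ _))).trans (Real.exp_le_exp.2 ?_)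
    have h3 := h2 c t ht (h.trans (min_le_right _ _))
    have h4 : min (C₁ / C₂) (-Real.log ρ / M) * (|t| ^ (α / 2) * weight μ α c) ≤
        C₁ / C₂ * (C₂ * weight μ α (c * t)) :=
      mul_le_mul (min_le_left _ _) h3 (by positivity) (by positivity)
    rw [← mul_assoc (C₁ / C₂), div_mul_cancel₀ _ hC₂.ne'] at h4
    linarith
  · refine (hρ _ h.le hct).trans ?_
    refine (Real.exp_log hρ0).symm.le.trans (Real.exp_le_exp.2 ?_)
    have hc0 : 0 < |c| := by
      rw [abs_pos]
      rintro rfl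
      simp at h
      linarith
    have h3 := h2 |c| (r / |c|) (by
      rw [abs_of_pos (by positivity)]
      exact (one_le_div hc0).2 hc) (by
      rw [mul_div_cancel₀ _ hc0.ne', abs_of_pos hr]
      exact min_le_right _ _)
    rw [mul_div_cancel₀ _ hc0.ne', weight_abs, abs_of_pos (show 0 < r / |c| by positivity)] at h3
    have h4 : |t| ≤ U / r * (r / |c|) := by
      rw [div_mul_div_cancel₀ hr.ne', le_div_iff₀ hc0, mul_comm, ← abs_mul]
      exact hct
    have h5 : |t| ^ (α / 2) * weight μ α c ≤ M := by
      calc |t| ^ (α / 2) * weight μ α c ≤ (U / r * (r / |c|)) ^ (α / 2) * weight μ α c := by gcongr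
        _ = (U / r) ^ (α / 2) * ((r / |c|) ^ (α / 2) * weight μ α c) := by
          rw [Real.mul_rpow (by positivity) (by positivity)]; ring
        _ ≤ (U / r) ^ (α / 2) * (C₂ * weight μ α r) := by gcongr
        _ ≤ M := by simp [M]
    have h6 : min (C₁ / C₂) (-Real.log ρ / M) * (|t| ^ (α / 2) * weight μ α c) ≤
        -Real.log ρ / M * M := mul_le_mul (min_le_right _ _) h5 (by positivity) (by positivity)
    rw [div_mul_cancel₀ _ hM.ne'] at h6
    linarith

end

/-! ### Sums of weights at the normalizer -/

lemma posWeight_add_negWeight {ι : Type*} (μ : Measure ℝ) {α : ℝ} (hα0 : 0 < α) {c : ι → ℝ}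
    (hc : Summable fun i => weight μ α (c i)) :
    posWeight μ α c + negWeight μ α c = ∑' i, weight μ α (c i) := by
  have h1 : posWeight μ α c = ∑' i, {i | 0 < c i}.indicator (fun i => weight μ α (c i)) i :=
    tsum_subtype {i | 0 < c i} fun i => weight μ α (c i)
  have h2 : negWeight μ α c = ∑' i, {i | c i < 0}.indicator (fun i => weight μ α (c i)) i :=
    tsum_subtype {i | c i < 0} fun i => weight μ α (c i)
  rw [h1, h2, ← (hc.indicator _).tsum_add (hc.indicator _)]
  refine tsum_congr fun i => ?_
  rcases lt_trichotomy (c i) 0 with h | h | h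
  · rw [Set.indicator_of_notMem (by simpa using h.le), Set.indicator_of_mem (by exact h), zero_add]
  · rw [Set.indicator_of_notMem (by simp [h]), Set.indicator_of_notMem (by simp [h]), h,
      weight_zero μ hα0, zero_add]
  · rw [Set.indicator_of_mem (by exact h), Set.indicator_of_notMem (by simpa using h.le), add_zero]

lemma negWeight_eq_zero {ι : Type*} (μ : Measure ℝ) {α : ℝ} {c : ι → ℝ} (hc : ∀ i, 0 ≤ c i) :
    negWeight μ α c = 0 := by
  have : IsEmpty {i // c i < 0} := ⟨fun i => absurd i.2 (not_lt.2 (hc i))⟩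
  exact tsum_empty

section

variable {μ : Measure ℝ} [IsProbabilityMeasure μ] {α cp cm : ℝ} {ι : Type*}

lemma continuousWithinAt_weight_div (hα0 : 0 < α) (b : ℝ) {x : ℝ} (hx : 0 < x) :
    ContinuousWithinAt (fun x => weight μ α (b / x)) (Set.Ici x) x := by
  rcases eq_or_ne b 0 with rfl | hb
  · simp only [zero_div]
    exact continuousWithinAt_const
  have hb : 0 < |b| := abs_pos.2 hb
  have h1 : ContinuousWithinAt (fun y : ℝ => |b / y| ^ α) (Set.Ici x) x := by
    refine ContinuousAt.continuousWithinAt (ContinuousAt.rpow_const ?_ (Or.inr hα0.le))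
    exact (continuousAt_const.div continuousAt_id hx.ne').abs
  have h2 : ContinuousWithinAt (fun y : ℝ => 1 / |b / y|) (Set.Ici x) x := by
    refine ContinuousAt.continuousWithinAt (continuousAt_const.div
      (continuousAt_const.div continuousAt_id hx.ne').abs ?_)
    rw [abs_div]
    have : 0 < |x| := abs_pos.2 hx.ne'
    positivity
  have h3 : ContinuousWithinAt (fun y : ℝ => max (1 / |b / y|) (cutoff μ)) (Set.Ici x) x :=
    h2.max continuousWithinAt_const
  have h4 : 0 < max (1 / |b / x|) (cutoff μ) := by
    refine lt_max_of_lt_left ?_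
    rw [abs_div]
    have : 0 < |x| := abs_pos.2 hx.ne'
    positivity
  have h5 : Set.MapsTo (fun y : ℝ => max (1 / |b / y|) (cutoff μ)) (Set.Ici x)
      (Set.Ici (max (1 / |b / x|) (cutoff μ))) := by
    intro y hy
    have hy : x ≤ y := hy
    simp only [Set.mem_Ici]
    refine max_le_max_right _ ?_
    rw [abs_div, abs_div, one_div_div, one_div_div, abs_of_pos hx, abs_of_pos (hx.trans_le hy)]
    gcongr
  have h6 := ContinuousWithinAt.comp (g := truncSecondMoment μ)
    (f := fun y : ℝ => max (1 / |b / y|) (cutoff μ)) (x := x)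
    (continuousWithinAt_truncSecondMoment _) h3 h5
  have h7 := h3.rpow_const (p := α - 2) (Or.inl h4.ne')
  exact h1.mul ((continuousWithinAt_const.mul h7).mul h6)

/-- The infimum belongs to the defining set. Each weight is right-continuous in `x`, so every finite
partial sum is at most `1` at the infimum; summability follows from that bound instead of being
passed to the limit. -/
lemma summable_weight_div_normalizer (hα0 : 0 < α) (hα2 : α ≤ 2) {b : ι → ℝ}
    (hb : 0 < normalizer μ α b) :
    Summable (fun i => weight μ α (b i / normalizer μ α b)) ∧
      ∑' i, weight μ α (b i / normalizer μ α b) ≤ 1 := by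
  set E := {x : ℝ | 1 ≤ x ∧ Summable (fun i => weight μ α (b i / x)) ∧
    ∑' i, weight μ α (b i / x) ≤ 1} with hE
  have hne : E.Nonempty := by
    by_contra h
    rw [Set.not_nonempty_iff_eq_empty] at h
    -- The infimum of the empty set is `0` by convention, so positivity of the normalizer certifies
    -- that the set is nonempty.
    rw [normalizer, ← hE, h, Real.sInf_empty] at hb
    exact lt_irrefl _ hb
  have hbdd : BddBelow E := ⟨1, fun x hx => hx.1⟩
  set x₀ := normalizer μ α b
  have hglb : IsGLB E x₀ := isGLB_csInf hne hbdd
  obtain ⟨u, -, hux, hu, huE⟩ := hglb.exists_seq_antitone_tendsto hne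
  have hu' : Tendsto u atTop (𝓝[Set.Ici x₀] x₀) :=
    tendsto_nhdsWithin_iff.2 ⟨hu, Eventually.of_forall hux⟩
  have key : ∀ F : Finset ι, ∑ i ∈ F, weight μ α (b i / x₀) ≤ 1 := fun F => by
    refine le_of_tendsto (tendsto_finsetSum F fun i _ =>
      (continuousWithinAt_weight_div hα0 (b i) hb).tendsto.comp hu') (Eventually.of_forall fun n => ?_)
    exact ((huE n).2.1.sum_le_tsum F fun i _ => weight_nonneg μ hα0 hα2 _).trans (huE n).2.2
  have hs := summable_of_sum_le (fun i => weight_nonneg μ hα0 hα2 _) key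
  exact ⟨hs, hs.tsum_le_of_sum_le key⟩

lemma eventually_weight_mul_le (hα0 : 0 < α) (hα2 : α ≤ 2) (hDA : InDomainOfAttraction μ α cp cm)
    {r K : ℝ} (hr : 0 < r) (hK : r ^ α < K) :
    ∃ δ > 0, ∀ s, |s| ≤ δ → weight μ α (r * s) ≤ K * weight μ α s := by
  have h := ((tendsto_weight_ratio hα0 hα2 hDA hr).eventually (gt_mem_nhds hK)).and
    (eventually_weight_pos hα0 hα2 hDA)
  obtain ⟨δ, hδ, h⟩ := mem_nhdsGT_iff_exists_Ioc_subset.1 h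
  refine ⟨δ, hδ, fun s hs => ?_⟩
  rcases eq_or_ne s 0 with rfl | hs0
  · simp [weight_zero μ hα0]
  · have := h (show |s| ∈ Set.Ioc 0 δ from ⟨abs_pos.2 hs0, hs⟩)
    simp only [Set.mem_ofPred_eq] at this
    rw [div_lt_iff₀ this.2, ← weight_abs, abs_mul, abs_abs, abs_of_pos hr, weight_abs] at this
    rw [← weight_abs, abs_mul, abs_of_pos hr]
    exact this.1.le

/-- The sum is at most `1` at `B n`. At `B n / r`, just below the infimum, it must exceed `1`, and
regular variation, applicable uniformly in `i` because `|b n i| / B n ≤ A / B n`, changes each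
weight by a factor close to `r ^ α` only. -/
lemma tendsto_tsum_weight (hα0 : 0 < α) (hα2 : α ≤ 2) (hDA : InDomainOfAttraction μ α cp cm)
    {b : ℕ → ι → ℝ} {A : ℝ} (hA : ∀ n i, |b n i| ≤ A) {B : ℕ → ℝ}
    (hB : ∀ n, B n = normalizer μ α (b n)) (hBtop : Tendsto B atTop atTop) :
    Tendsto (fun n => ∑' i, weight μ α (b n i / B n)) atTop (𝓝 1) := by
  refine tendsto_order.2 ⟨fun η hη => ?_, fun η hη => ?_⟩
  · wlog hη0 : 0 < η generalizing η
    · filter_upwards [this (1 / 2) (by norm_num) (by norm_num)] with n hn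
      linarith
    set η' := (η + 1) / 2
    have hη' : η' < 1 := by simp only [η']; linarith
    have hη'0 : 0 < η' := by positivity
    have hηη' : η < η' := by simp only [η']; linarith
    -- So `r ^ α = 1 / η' < 1 / η`; the gap between `η` and `η'` absorbs the error in the ratio of
    -- weights.
    set r := (1 / η') ^ (1 / α) with hr
    have hr1 : 1 < r := Real.one_lt_rpow (by rwa [lt_div_iff₀ hη'0, one_mul]) (by positivity)
    have hr0 : 0 < r := by linarith
    have hrα : r ^ α = 1 / η' := by
      rw [hr, ← Real.rpow_mul (by positivity), one_div_mul_cancel hα0.ne', Real.rpow_one]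
    obtain ⟨δ, hδ, hw⟩ := eventually_weight_mul_le hα0 hα2 hDA hr0 (K := 1 / η) (by
      rw [hrα]; exact one_div_lt_one_div_of_lt hη0 hηη')
    filter_upwards [hBtop.eventually_gt_atTop r, hBtop.eventually_ge_atTop (A / δ)] with n hn1 hn2
    have hBn : 0 < B n := by linarith
    have hs := summable_weight_div_normalizer hα0 hα2 (μ := μ) (b := b n) (by rwa [← hB])
    rw [← hB] at hs
    have hc : ∀ i, weight μ α (b n i / (B n / r)) ≤ 1 / η * weight μ α (b n i / B n) := fun i => by
      rw [show b n i / (B n / r) = r * (b n i / B n) by field_simp]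
      refine hw _ ?_
      rw [abs_div, abs_of_pos hBn, div_le_iff₀ hBn]
      rw [div_le_iff₀ hδ] at hn2
      linarith [hA n i]
    -- Needed because failing to lie in the defining set could also mean divergence; with
    -- summability and `B n / r ≥ 1` secured, it means a sum above `1`.
    have hs2 : Summable fun i => weight μ α (b n i / (B n / r)) :=
      Summable.of_nonneg_of_le (fun i => weight_nonneg μ hα0 hα2 _) hc (hs.1.mul_left _)
    have hlt : B n / r < B n := div_lt_self hBn hr1
    have hnot : ¬ (∑' i, weight μ α (b n i / (B n / r)) ≤ 1) := fun h => by
      have : normalizer μ α (b n) ≤ B n / r :=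
        csInf_le ⟨1, fun x hx => hx.1⟩ ⟨by rw [one_le_div hr0]; exact hn1.le, hs2, h⟩
      rw [← hB] at this
      linarith
    have := hs2.tsum_le_tsum hc (hs.1.mul_left _)
    rw [tsum_mul_left] at this
    have h1 : 1 < 1 / η * ∑' i, weight μ α (b n i / B n) := (not_le.1 hnot).trans_le this
    rw [one_div, inv_mul_eq_div, lt_div_iff₀ hη0] at h1
    linarith
  · filter_upwards [hBtop.eventually_gt_atTop 0] with n hn
    have hs := summable_weight_div_normalizer hα0 hα2 (μ := μ) (b := b n) (by rwa [← hB])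
    rw [← hB] at hs
    exact hs.2.trans_lt hη

end

/-! ### Partial sums as series in the innovations -/

/-- For fixed `i` the sites `j - i` are distinct. The bound is independent of `Γ`, which is why no
condition on the regions is needed. -/
lemma abs_sumCoeff_le {d : ℕ} {a : (Fin d → ℤ) → ℝ} (ha : Summable fun i => |a i|)
    (Γ : Finset (Fin d → ℤ)) (i : Fin d → ℤ) : |sumCoeff a Γ i| ≤ ∑' i, |a i| := by
  calc |sumCoeff a Γ i| ≤ ∑ j ∈ Γ, |a (j - i)| := Finset.abs_sum_le_sum_abs _ _
    _ = ∑ k ∈ Γ.map (Equiv.subRight i).toEmbedding, |a k| := by simp [Finset.sum_map]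
    _ ≤ _ := ha.sum_le_tsum _ fun _ _ => abs_nonneg _

section

variable {Ω : Type*} [MeasurableSpace Ω] {P : Measure Ω}

lemma charFun_map_eq_integral {S : Ω → ℝ} (hS : AEMeasurable S P) (t : ℝ) :
    charFun (P.map S) t = ∫ ω, Complex.exp (t * S ω * Complex.I) ∂P := by
  rw [charFun_apply_real, integral_map hS (by fun_prop)]

lemma tendsto_charFun_map [IsProbabilityMeasure P] {Y : ℕ → Ω → ℝ} {S : Ω → ℝ} (hY : ∀ N, AEMeasurable (Y N) P)
    (h : ∀ᵐ ω ∂P, Tendsto (fun N => Y N ω) atTop (𝓝 (S ω))) (t : ℝ) :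
    Tendsto (fun N => charFun (P.map (Y N)) t) atTop (𝓝 (charFun (P.map S) t)) := by
  have hS : AEMeasurable S P := aemeasurable_of_tendsto_metrizable_ae _ hY h
  simp_rw [fun N => charFun_map_eq_integral (hY N), charFun_map_eq_integral hS]
  refine tendsto_integral_of_dominated_convergence (fun _ => 1) (fun N => ?_) (integrable_const _)
    (fun N => ae_of_all _ fun ω => ?_) ?_
  · exact (Continuous.aestronglyMeasurable (f := fun x : ℝ => Complex.exp (t * x * Complex.I))
      (by fun_prop)).comp_aemeasurable (hY N)
  · rw [← Complex.ofReal_mul, Complex.norm_exp_ofReal_mul_I]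
  · filter_upwards [h] with ω hω
    have : Continuous (fun x : ℝ => Complex.exp (t * x * Complex.I)) := by fun_prop
    exact (this.tendsto _).comp hω

variable {d : ℕ} {a : (Fin d → ℤ) → ℝ} {ξ X : (Fin d → ℤ) → Ω → ℝ} {μ : Measure ℝ}

/-- The series for `X j` is enumerated through `j - e k`, so that all `j ∈ Γ` run through the
innovations in the same order `e` and the finitely many series can be added termwise. This uses
convergence in every order. -/
lemma IsLinearField.ae_tendsto_partialSum (hX : IsLinearField P a ξ X) (e : ℕ ≃ (Fin d → ℤ))
    (Γ : Finset (Fin d → ℤ)) :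
    ∀ᵐ ω ∂P, Tendsto (fun N => ∑ k ∈ Finset.range N, sumCoeff a Γ (e k) * ξ (e k) ω) atTop
      (𝓝 (partialSum X Γ ω)) := by
  have h : ∀ᵐ ω ∂P, ∀ j ∈ Γ, Tendsto (fun N => ∑ k ∈ Finset.range N, a (j - e k) * ξ (e k) ω) atTop
      (𝓝 (X j ω)) := by
    refine (ae_ball_iff Γ.countable_toSet).2 fun j _ => ?_
    simpa using hX j (e.trans (Equiv.subLeft j))
  filter_upwards [h] with ω hω
  have h1 := tendsto_finsetSum Γ hω
  refine h1.congr fun N => ?_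
  rw [Finset.sum_comm]
  exact Finset.sum_congr rfl fun k _ => (Finset.sum_mul ..).symm

lemma aemeasurable_sum_mul (hlaw : ∀ i, HasLaw (ξ i) μ P) (b : (Fin d → ℤ) → ℝ)
    (e : ℕ ≃ (Fin d → ℤ)) (N : ℕ) :
    AEMeasurable (fun ω => ∑ k ∈ Finset.range N, b (e k) * ξ (e k) ω) P :=
  Finset.aemeasurable_fun_sum _ fun k _ => (hlaw (e k)).aemeasurable.const_mul _

lemma charFun_map_sum_mul (hlaw : ∀ i, HasLaw (ξ i) μ P) (hindep : iIndepFun ξ P)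
    (b : (Fin d → ℤ) → ℝ) (e : ℕ ≃ (Fin d → ℤ)) (N : ℕ) (t : ℝ) :
    charFun (P.map (fun ω => ∑ k ∈ Finset.range N, b (e k) * ξ (e k) ω)) t =
      ∏ k ∈ Finset.range N, charFun μ (b (e k) * t) := by
  have h1 : iIndepFun (fun (k : ℕ) ω => b (e k) * ξ (e k) ω) P :=
    (hindep.precomp e.injective).comp (fun k x => b (e k) * x) fun k => by fun_prop
  rw [(h1.restrict _).charFun_map_fun_finsetSum_eq_prod
    fun k _ => (hlaw (e k)).aemeasurable.const_mul _, Finset.prod_apply]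
  refine Finset.prod_congr rfl fun k _ => ?_
  rw [charFun_map_mul_comp (hlaw (e k)).aemeasurable, (hlaw (e k)).map_eq]

lemma IsLinearField.aemeasurable_partialSum (hd : 0 < d) (hX : IsLinearField P a ξ X)
    (hlaw : ∀ i, HasLaw (ξ i) μ P) (Γ : Finset (Fin d → ℤ)) : AEMeasurable (partialSum X Γ) P := by
  have : NeZero d := ⟨hd.ne'⟩
  obtain ⟨e⟩ : Nonempty (ℕ ≃ (Fin d → ℤ)) := nonempty_equiv_of_countable
  exact aemeasurable_of_tendsto_metrizable_ae _ (aemeasurable_sum_mul hlaw _ e)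
    (hX.ae_tendsto_partialSum e Γ)

/-- A single enumeration serves all regions and frequencies. It exists because `d > 0` makes the
index lattice infinite. -/
lemma IsLinearField.exists_tendsto_prod_charFun [IsProbabilityMeasure P] (hd : 0 < d) (hX : IsLinearField P a ξ X)
    (hlaw : ∀ i, HasLaw (ξ i) μ P) (hindep : iIndepFun ξ P) :
    ∃ e : ℕ ≃ (Fin d → ℤ), ∀ (Γ : Finset (Fin d → ℤ)) (t : ℝ),
      Tendsto (fun N => ∏ k ∈ Finset.range N, charFun μ (sumCoeff a Γ (e k) * t)) atTop
        (𝓝 (charFun (P.map (partialSum X Γ)) t)) := by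
  have : NeZero d := ⟨hd.ne'⟩
  obtain ⟨e⟩ : Nonempty (ℕ ≃ (Fin d → ℤ)) := nonempty_equiv_of_countable
  refine ⟨e, fun Γ t => ?_⟩
  have h := tendsto_charFun_map (fun N => aemeasurable_sum_mul hlaw (sumCoeff a Γ) e N)
    (hX.ae_tendsto_partialSum e Γ) t
  simpa only [charFun_map_sum_mul hlaw hindep] using h

end

/-! ### Convergence and domination of the characteristic functions of the partial sums -/

/-- The exponent `-c_α |u| ^ α (1 - i β τ(α, u))` of the stable characteristic function. -/
noncomputable def stableExponent (α β u : ℝ) : ℂ :=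
  -((stableConst α * |u| ^ α : ℝ) : ℂ) * (1 - Complex.I * ((β * tau α u : ℝ) : ℂ))

lemma stableCharFun_eq_exp (α β u : ℝ) :
    stableCharFun α β u = Complex.exp (stableExponent α β u) := rfl

lemma stableExponent_re (α β u : ℝ) : (stableExponent α β u).re = -(stableConst α * |u| ^ α) := by
  simp [stableExponent]

lemma stableExponent_re_nonpos {α : ℝ} (hα0 : 0 < α) (hα2 : α ≤ 2) (β u : ℝ) :
    (stableExponent α β u).re ≤ 0 := by
  rw [stableExponent_re]
  have := stableConst_pos hα0 hα2
  have h : 0 ≤ stableConst α * |u| ^ α := by positivity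
  linarith

lemma stableExponent_zero {α : ℝ} (hα0 : 0 < α) (β : ℝ) : stableExponent α β 0 = 0 := by
  simp [stableExponent, Real.zero_rpow hα0.ne']

lemma tau_mul_of_pos {α r : ℝ} (hr : 0 < r) (u : ℝ) : tau α (r * u) = tau α u := by
  unfold tau
  congr 2
  rcases lt_trichotomy u 0 with h | rfl | h
  · rw [Real.sign_of_neg h, Real.sign_of_neg (mul_neg_of_pos_of_neg hr h)]
  · simp
  · rw [Real.sign_of_pos h, Real.sign_of_pos (by positivity)]

lemma tau_neg (α u : ℝ) : tau α (-u) = -tau α u := by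
  unfold tau
  split_ifs <;> simp [Real.sign_neg]

lemma stableExponent_mul {α : ℝ} (hα0 : 0 < α) (β : ℝ) {r : ℝ} (hr : 0 ≤ r) (u : ℝ) :
    stableExponent α β (r * u) = ((r ^ α : ℝ) : ℂ) * stableExponent α β u := by
  rcases hr.eq_or_lt with rfl | hr
  · simp [stableExponent_zero hα0, Real.zero_rpow hα0.ne']
  · rw [stableExponent, stableExponent, tau_mul_of_pos hr, abs_mul, abs_of_pos hr,
      Real.mul_rpow hr.le (abs_nonneg u)]
    push_cast
    ring

lemma stableExponent_neg (α β u : ℝ) :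
    stableExponent α β (-u) = (starRingEnd ℂ) (stableExponent α β u) := by
  simp [stableExponent, tau_neg]

/-- Telescoping: the factors are exchanged one at a time and all others have modulus at most `1`. -/
lemma norm_prod_sub_prod_le_sum {ι : Type*} (s : Finset ι) {z y : ι → ℂ} (hz : ∀ i, ‖z i‖ ≤ 1)
    (hy : ∀ i, ‖y i‖ ≤ 1) : ‖∏ i ∈ s, z i - ∏ i ∈ s, y i‖ ≤ ∑ i ∈ s, ‖z i - y i‖ := by
  classical
  induction s using Finset.induction_on with
  | empty => simp
  | insert i s hi ih =>
    rw [Finset.prod_insert hi, Finset.prod_insert hi, Finset.sum_insert hi]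
    have h1 : ‖∏ i ∈ s, y i‖ ≤ 1 := by
      rw [norm_prod]
      exact Finset.prod_le_one (fun _ _ => norm_nonneg _) fun i _ => hy i
    calc _ = ‖z i * (∏ i ∈ s, z i - ∏ i ∈ s, y i) + (z i - y i) * ∏ i ∈ s, y i‖ := by
          congr 1; ring
      _ ≤ ‖z i‖ * ‖∏ i ∈ s, z i - ∏ i ∈ s, y i‖ + ‖z i - y i‖ * ‖∏ i ∈ s, y i‖ := by
          rw [← norm_mul, ← norm_mul]
          exact norm_add_le _ _
      _ ≤ 1 * ‖∏ i ∈ s, z i - ∏ i ∈ s, y i‖ + ‖z i - y i‖ * 1 := by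
          gcongr
          exact hz i
      _ ≤ _ := by linarith

section

variable {μ : Measure ℝ} [IsProbabilityMeasure μ] {α cp cm : ℝ}

lemma tendsto_charFun_mul_weight (hα0 : 0 < α) (hα2 : α ≤ 2) (hDA : InDomainOfAttraction μ α cp cm)
    (hA : ConditionA μ α) (u : ℝ) :
    Tendsto (fun s : ℝ => (1 - charFun μ (u * s)) / (weight μ α s : ℂ)) (𝓝[>] 0)
      (𝓝 (-stableExponent α (cp - cm) u)) := by
  have hpos : ∀ u : ℝ, 0 < u → Tendsto (fun s : ℝ => (1 - charFun μ (u * s)) / (weight μ α s : ℂ))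
      (𝓝[>] 0) (𝓝 (-stableExponent α (cp - cm) u)) := fun u hu => by
    have hus : Tendsto (fun s : ℝ => u * s) (𝓝[>] 0) (𝓝[>] 0) := by
      refine tendsto_nhdsWithin_iff.2 ⟨?_, ?_⟩
      · have : Tendsto (fun s : ℝ => u * s) (𝓝 0) (𝓝 (u * 0)) := tendsto_id.const_mul u
        rw [mul_zero] at this
        exact this.mono_left nhdsWithin_le_nhds
      · filter_upwards [self_mem_nhdsWithin] with s hs
        exact mul_pos hu hs
    have h1 := ((tendsto_charFun_weight hα0 hα2 hDA hA).comp hus).mul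
      ((Complex.continuous_ofReal.tendsto _).comp (tendsto_weight_ratio hα0 hα2 hDA hu))
    have h2 : (stableConst α * (1 - Complex.I * (((cp - cm) * tau α 1 : ℝ) : ℂ)) * ((u ^ α : ℝ) : ℂ) : ℂ)
        = -stableExponent α (cp - cm) u := by
      rw [← mul_one u, stableExponent_mul hα0 _ hu.le, stableExponent, mul_one]
      simp
      ring
    rw [h2] at h1
    refine h1.congr' ?_
    filter_upwards [hus.eventually (eventually_weight_pos hα0 hα2 hDA)] with s hs
    have : (weight μ α (u * s) : ℂ) ≠ 0 := by exact_mod_cast hs.ne'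
    simp only [Function.comp]
    push_cast
    rw [div_mul_div_cancel₀ this]
  rcases lt_trichotomy u 0 with h | rfl | h
  · have h1 := (Complex.continuous_conj.tendsto _).comp (hpos (-u) (neg_pos.2 h))
    rw [stableExponent_neg, map_neg, Complex.conj_conj] at h1
    refine h1.congr fun s => ?_
    simp only [Function.comp, neg_mul, charFun_neg, map_div₀, map_sub, map_one, Complex.conj_conj,
      Complex.conj_ofReal]
  · simp [stableExponent_zero hα0]
  · exact hpos u h

/-- Both terms are `1 + w E + o(w)`. Comparing with the exponential avoids taking logarithms of
characteristic functions. -/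
lemma tendsto_charFun_sub_exp_div_weight (hα0 : 0 < α) (hα2 : α ≤ 2)
    (hDA : InDomainOfAttraction μ α cp cm) (hA : ConditionA μ α) (u : ℝ) :
    Tendsto (fun s : ℝ => (charFun μ (u * s) -
      Complex.exp (weight μ α s * stableExponent α (cp - cm) u)) / (weight μ α s : ℂ)) (𝓝[>] 0)
      (𝓝 0) := by
  set E := stableExponent α (cp - cm) u
  have hw : Tendsto (fun s : ℝ => (weight μ α s : ℂ)) (𝓝[>] 0) (𝓝[≠] 0) := by
    refine tendsto_nhdsWithin_iff.2 ⟨?_, ?_⟩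
    · have := (Complex.continuous_ofReal.tendsto _).comp (tendsto_weight_zero hα0 hα2 hDA hA)
      rwa [Complex.ofReal_zero] at this
    · filter_upwards [eventually_weight_pos hα0 hα2 hDA] with s hs
      simpa using hs.ne'
  have h1 : HasDerivAt (fun z : ℂ => Complex.exp (z * E)) E 0 := by
    simpa using ((hasDerivAt_id (0 : ℂ)).mul_const E).cexp
  have h2 := (hasDerivAt_iff_tendsto_slope.1 h1).comp hw
  have h3 := ((tendsto_charFun_mul_weight hα0 hα2 hDA hA u).neg.sub h2)
  rw [neg_neg, sub_self] at h3
  refine h3.congr fun s => ?_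
  simp [slope_def_field]
  ring

lemma exists_norm_charFun_sub_exp_le (hα0 : 0 < α) (hα2 : α ≤ 2)
    (hDA : InDomainOfAttraction μ α cp cm) (hA : ConditionA μ α) (u : ℝ) {ε : ℝ} (hε : 0 < ε) :
    ∃ δ > 0, ∀ s, 0 < s → s ≤ δ → ‖charFun μ (u * s) -
      Complex.exp (weight μ α s * stableExponent α (cp - cm) u)‖ ≤ ε * weight μ α s := by
  have h := (tendsto_charFun_sub_exp_div_weight hα0 hα2 hDA hA u).norm
  rw [norm_zero] at h
  obtain ⟨δ, hδ, h⟩ := mem_nhdsGT_iff_exists_Ioc_subset.1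
    ((h.eventually (gt_mem_nhds hε)).and (eventually_weight_pos hα0 hα2 hDA))
  refine ⟨δ, hδ, fun s hs0 hs => ?_⟩
  have h1 := h ⟨hs0, hs⟩
  simp only [Set.mem_ofPred_eq, norm_div, Complex.norm_real] at h1
  rw [Real.norm_of_nonneg h1.2.le, div_lt_iff₀ h1.2] at h1
  exact h1.1.le

/-- The stable exponent at `t` or `-t`, according to the sign of `c`. -/
noncomputable def signedExponent (α β t c : ℝ) : ℂ :=
  if 0 < c then stableExponent α β t else if c < 0 then stableExponent α β (-t) else 0

lemma signedExponent_re_nonpos (hα0 : 0 < α) (hα2 : α ≤ 2) (β t c : ℝ) :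
    (signedExponent α β t c).re ≤ 0 := by
  unfold signedExponent
  split_ifs
  · exact stableExponent_re_nonpos hα0 hα2 _ _
  · exact stableExponent_re_nonpos hα0 hα2 _ _
  · simp

lemma exists_norm_charFun_sub_exp_signedExponent_le (hα0 : 0 < α) (hα2 : α ≤ 2)
    (hDA : InDomainOfAttraction μ α cp cm) (hA : ConditionA μ α) (t : ℝ) {ε : ℝ} (hε : 0 < ε) :
    ∃ δ > 0, ∀ c, |c| ≤ δ → ‖charFun μ (c * t) -
      Complex.exp (weight μ α c * signedExponent α (cp - cm) t c)‖ ≤ ε * weight μ α c := by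
  obtain ⟨δ₁, hδ₁, h1⟩ := exists_norm_charFun_sub_exp_le hα0 hα2 hDA hA t hε
  obtain ⟨δ₂, hδ₂, h2⟩ := exists_norm_charFun_sub_exp_le hα0 hα2 hDA hA (-t) hε
  refine ⟨min δ₁ δ₂, lt_min hδ₁ hδ₂, fun c hc => ?_⟩
  rcases lt_trichotomy c 0 with h | rfl | h
  · have := h2 (-c) (neg_pos.2 h) (by rw [← abs_of_neg h]; exact hc.trans (min_le_right _ _))
    rw [← abs_of_neg h, weight_abs, abs_of_neg h] at this
    rw [signedExponent, if_neg h.not_gt, if_pos h]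
    rwa [neg_mul_neg, mul_comm] at this
  · simp [weight_zero μ hα0]
  · have := h1 c h (by rw [← abs_of_pos h]; exact hc.trans (min_le_left _ _))
    rw [signedExponent, if_pos h]
    rwa [mul_comm] at this

lemma hasSum_weight_mul_signedExponent {ι : Type*} (ν : Measure ℝ) (β t : ℝ)
    {c : ι → ℝ} (hc : Summable fun i => weight ν α (c i)) :
    HasSum (fun i => (weight ν α (c i) : ℂ) * signedExponent α β t (c i))
      (posWeight ν α c * stableExponent α β t + negWeight ν α c * stableExponent α β (-t)) := by
  have h1 : posWeight ν α c = ∑' i, {i | 0 < c i}.indicator (fun i => weight ν α (c i)) i :=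
    tsum_subtype {i | 0 < c i} fun i => weight ν α (c i)
  have h2 : negWeight ν α c = ∑' i, {i | c i < 0}.indicator (fun i => weight ν α (c i)) i :=
    tsum_subtype {i | c i < 0} fun i => weight ν α (c i)
  have h3 := (Complex.hasSum_ofReal.2 (hc.indicator {i | 0 < c i}).hasSum).mul_right
    (stableExponent α β t)
  have h4 := (Complex.hasSum_ofReal.2 (hc.indicator {i | c i < 0}).hasSum).mul_right
    (stableExponent α β (-t))
  rw [← h1] at h3
  rw [← h2] at h4
  refine (h3.add h4).congr_fun fun i => ?_
  rcases lt_trichotomy (c i) 0 with h | h | h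
  · simp [signedExponent, h, h.not_gt]
  · simp [signedExponent, h]
  · simp [signedExponent, h, h.not_gt]

end

lemma integrable_exp_neg_mul_abs_rpow {b p : ℝ} (hb : 0 < b) (hp : 0 < p) :
    Integrable fun t : ℝ => Real.exp (-b * |t| ^ p) := by
  have h1 : IntegrableOn (fun t : ℝ => Real.exp (-b * |t| ^ p)) (Set.Ioi 0) := by
    have := integrableOn_rpow_mul_exp_neg_mul_rpow (s := 0) (by norm_num) hp hb
    refine this.congr_fun (fun t ht => ?_) measurableSet_Ioi
    have ht : 0 < t := ht
    simp [abs_of_pos ht]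
  rw [← integrableOn_univ, ← Set.Iic_union_Ioi (a := (0 : ℝ))]
  refine IntegrableOn.union ?_ h1
  rw [integrableOn_Iic_iff_integrableOn_Iio]
  have h2 := h1.comp_neg
  rw [Set.neg_Ioi, neg_zero] at h2
  simpa using h2

lemma norm_cexp_weight_mul_le_one (ν : Measure ℝ) {α : ℝ} (hα0 : 0 < α) (hα2 : α ≤ 2) (c : ℝ) {z : ℂ}
    (hz : z.re ≤ 0) : ‖Complex.exp (weight ν α c * z)‖ ≤ 1 := by
  rw [Complex.norm_exp, Real.exp_le_one_iff, Complex.re_ofReal_mul]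
  exact mul_nonpos_of_nonneg_of_nonpos (weight_nonneg ν hα0 hα2 c) hz

section

variable {Ω : Type*} [MeasurableSpace Ω] {P : Measure Ω} [IsProbabilityMeasure P] {d : ℕ} {α : ℝ}
  {a : (Fin d → ℤ) → ℝ} {ξ X : (Fin d → ℤ) → Ω → ℝ} {μ : Measure ℝ} [IsProbabilityMeasure μ]
  {cp cm : ℝ} {Γ : ℕ → Finset (Fin d → ℤ)} {B : ℕ → ℝ}

/-- The product of the comparison factors is exactly `exp` of the expression assumed to tend to `H`.
The difference of the products is at most `ε / 2` times a sum of weights, and that sum is at most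
`1` by the choice of the normalizer. -/
lemma tendsto_charFun_partialSum (hd : 0 < d) (hα0 : 0 < α) (hα2 : α ≤ 2)
    (hlaw : ∀ i, HasLaw (ξ i) μ P) (hindep : iIndepFun ξ P) (hDA : InDomainOfAttraction μ α cp cm)
    (hA : ConditionA μ α) (ha : Summable (fun i => |a i|)) (hX : IsLinearField P a ξ X)
    (hB : ∀ n, B n = normalizer μ α (sumCoeff a (Γ n))) (hBtop : Tendsto B atTop atTop) (t : ℝ)
    {H : ℂ} (hH : Tendsto (fun n =>
      posWeight μ α (fun i => sumCoeff a (Γ n) i / B n) * stableExponent α (cp - cm) t +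
      negWeight μ α (fun i => sumCoeff a (Γ n) i / B n) * stableExponent α (cp - cm) (-t))
      atTop (𝓝 H)) :
    Tendsto (fun n => charFun (P.map (partialSum X (Γ n))) (t / B n)) atTop (𝓝 (Complex.exp H)) := by
  obtain ⟨e, he⟩ := hX.exists_tendsto_prod_charFun hd hlaw hindep
  refine ((Complex.continuous_exp.tendsto _).comp hH).congr_dist ?_
  rw [Metric.tendsto_nhds]
  intro ε hε
  obtain ⟨δ, hδ, hle⟩ := exists_norm_charFun_sub_exp_signedExponent_le hα0 hα2 hDA hA t (half_pos hε)
  filter_upwards [hBtop.eventually_gt_atTop 0, hBtop.eventually_ge_atTop ((∑' i, |a i|) / δ)]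
    with n hn hn2
  set c : (Fin d → ℤ) → ℝ := fun i => sumCoeff a (Γ n) i / B n
  have hcδ : ∀ i, |c i| ≤ δ := fun i => by
    simp only [c]
    rw [abs_div, abs_of_pos hn, div_le_iff₀ hn]
    rw [div_le_iff₀ hδ] at hn2
    linarith [abs_sumCoeff_le ha (Γ n) i]
  obtain ⟨hs, hs1⟩ : Summable (fun i => weight μ α (c i)) ∧ ∑' i, weight μ α (c i) ≤ 1 := by
    have := summable_weight_div_normalizer hα0 hα2 (μ := μ) (b := sumCoeff a (Γ n)) (by rwa [← hB])
    rwa [← hB] at this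
  have h1 := he (Γ n) (t / B n)
  have h2 := (e.hasSum_iff.2 (hasSum_weight_mul_signedExponent μ (α := α) (cp - cm) t hs)).tendsto_sum_nat
  have h3 := (Complex.continuous_exp.tendsto _).comp h2
  have h4 := (h3.sub h1).norm
  rw [Real.dist_0_eq_abs, abs_of_nonneg dist_nonneg, dist_eq_norm]
  -- The estimate is proved for finite products with a bound independent of `N` and then passes to
  -- the limit.
  refine lt_of_le_of_lt (le_of_tendsto h4 (Eventually.of_forall fun N => ?_)) (half_lt_self hε)
  simp only [Function.comp]
  rw [norm_sub_rev, Complex.exp_sum]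
  refine (norm_prod_sub_prod_le_sum _ (fun k => norm_charFun_le_one _)
    fun k => norm_cexp_weight_mul_le_one μ hα0 hα2 _ (signedExponent_re_nonpos hα0 hα2 _ _ _)).trans ?_
  calc _ ≤ ∑ k ∈ Finset.range N, ε / 2 * weight μ α (c (e k)) := by
        refine Finset.sum_le_sum fun k _ => ?_
        rw [show sumCoeff a (Γ n) (e k) * (t / B n) = c (e k) * t by simp only [c]; ring]
        exact hle _ (hcδ _)
    _ = ε / 2 * ∑ k ∈ Finset.range N, weight μ α (c (e k)) := (Finset.mul_sum ..).symm
    _ ≤ ε / 2 * 1 := by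
        gcongr
        refine le_trans ?_ hs1
        rw [← e.tsum_eq]
        exact (e.summable_iff.2 hs).sum_le_tsum _ fun k _ => weight_nonneg μ hα0 hα2 _
    _ = ε / 2 := mul_one _

/-- Multiplying the factorwise bounds puts `∑ w(c_i)` in the exponent, and this sum is eventually at
least `1/2`. The range `|t| ≤ K * B n` together with `|c_i| ≤ A / B n` keeps `c_i t` bounded. -/
lemma exists_integrable_bound_charFun_partialSum (hd : 0 < d) (hα0 : 0 < α) (hα2 : α ≤ 2)
    (hlaw : ∀ i, HasLaw (ξ i) μ P) (hindep : iIndepFun ξ P) (hDA : InDomainOfAttraction μ α cp cm)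
    (hA : ConditionA μ α) (hnl : IsNonLattice μ) (ha : Summable (fun i => |a i|))
    (hX : IsLinearField P a ξ X) (hB : ∀ n, B n = normalizer μ α (sumCoeff a (Γ n)))
    (hBtop : Tendsto B atTop atTop) {K : ℝ} (hK : 0 < K) :
    ∃ g : ℝ → ℝ, Integrable g ∧ ∀ᶠ n in atTop, ∀ t, |t| ≤ K * B n →
      ‖charFun (P.map (partialSum X (Γ n))) (t / B n)‖ ≤ g t := by
  obtain ⟨e, he⟩ := hX.exists_tendsto_prod_charFun hd hlaw hindep
  set A := ∑' i, |a i|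
  have hA0 : 0 ≤ A := tsum_nonneg fun i => abs_nonneg _
  obtain ⟨C, hC, c₀, hc₀, hle⟩ := exists_norm_charFun_mul_le hα0 hα2 hDA hA hnl
    (U := (A + 1) * K) (by positivity)
  -- The factor `exp (C / 2)` makes the majorant at least `1` on `|t| ≤ 1`, where the factorwise
  -- bound is not available.
  refine ⟨fun t => Real.exp (C / 2) * Real.exp (-(C / 2) * |t| ^ (α / 2)),
    (integrable_exp_neg_mul_abs_rpow (by positivity) (by positivity)).const_mul _, ?_⟩
  have hlim := tendsto_tsum_weight hα0 hα2 hDA (fun n i => abs_sumCoeff_le ha (Γ n) i) hB hBtop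
  filter_upwards [hBtop.eventually_gt_atTop 0, hBtop.eventually_ge_atTop (A / c₀),
    hlim.eventually (lt_mem_nhds (show (1 / 2 : ℝ) < 1 by norm_num))] with n hn hn2 hhalf t ht
  set c : (Fin d → ℤ) → ℝ := fun i => sumCoeff a (Γ n) i / B n
  have habs : ∀ i, |c i| = |sumCoeff a (Γ n) i| / B n := fun i => by
    simp only [c]
    rw [abs_div, abs_of_pos hn]
  have hcA : ∀ i, |c i| ≤ A / B n := fun i => by
    rw [habs]
    gcongr
    exact abs_sumCoeff_le ha (Γ n) i
  rw [← Real.exp_add]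
  rcases le_or_gt |t| 1 with h1 | h1
  · have := Measure.isProbabilityMeasure_map (hX.aemeasurable_partialSum hd hlaw (Γ n))
    refine (norm_charFun_le_one _).trans (Real.one_le_exp ?_)
    have := Real.rpow_le_one (abs_nonneg t) h1 (show 0 ≤ α / 2 by positivity)
    have : C / 2 * |t| ^ (α / 2) ≤ C / 2 * 1 := by gcongr
    linarith
  · have hs : Summable (fun i => weight μ α (c i)) := by
      have := (summable_weight_div_normalizer hα0 hα2 (μ := μ) (b := sumCoeff a (Γ n))
        (by rwa [← hB])).1
      rwa [← hB] at this
    have h2 := (e.summable_iff.2 hs).hasSum.tendsto_sum_nat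
    have h3 : Tendsto (fun N => Real.exp (-C * (|t| ^ (α / 2) *
        ∑ k ∈ Finset.range N, weight μ α (c (e k))))) atTop
        (𝓝 (Real.exp (-C * (|t| ^ (α / 2) * ∑' i, weight μ α (c i))))) := by
      rw [← e.tsum_eq]
      exact (Real.continuous_exp.tendsto _).comp ((h2.const_mul _).const_mul _)
    refine (le_of_tendsto_of_tendsto (he (Γ n) (t / B n)).norm h3
      (Eventually.of_forall fun N => ?_)).trans (Real.exp_le_exp.2 ?_)
    · simp only
      rw [norm_prod, Finset.mul_sum, Finset.mul_sum, Real.exp_sum]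
      refine Finset.prod_le_prod (fun _ _ => norm_nonneg _) fun k _ => ?_
      rw [show sumCoeff a (Γ n) (e k) * (t / B n) = c (e k) * t by simp only [c]; ring]
      refine hle _ _ ((hcA _).trans ?_) h1.le ?_
      · rw [div_le_iff₀ hn]
        rw [div_le_iff₀ hc₀] at hn2
        linarith
      · rw [abs_mul]
        calc |c (e k)| * |t| ≤ A / B n * (K * B n) := by gcongr; exact hcA _
          _ = A * K := by field_simp
          _ ≤ (A + 1) * K := by gcongr; linarith
    · have : |t| ^ (α / 2) * (1 / 2) ≤ |t| ^ (α / 2) * ∑' i, weight μ α (c i) := by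
        gcongr
      have := mul_le_mul_of_nonneg_left this hC.le
      linarith

end

/-! ### Existence of the stable law and its mixtures -/

lemma norm_stableExponent_le {α : ℝ} (hα0 : 0 < α) (β u : ℝ) :
    ‖stableExponent α β u‖ ≤ |u| ^ α * ‖stableExponent α β 1‖ := by
  have h : ∀ v : ℝ, 0 ≤ v → ‖stableExponent α β v‖ = v ^ α * ‖stableExponent α β 1‖ := fun v hv => by
    conv_lhs => rw [← mul_one v, stableExponent_mul hα0 β hv, norm_mul, Complex.norm_real,
      Real.norm_of_nonneg (by positivity)]
  rcases le_or_gt 0 u with hu | hu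
  · rw [abs_of_nonneg hu, h u hu]
  · rw [abs_of_neg hu, ← h (-u) (by linarith), stableExponent_neg, RCLike.norm_conj]

lemma continuousAt_stableCharFun_zero {α : ℝ} (hα0 : 0 < α) (β : ℝ) :
    ContinuousAt (stableCharFun α β) 0 := by
  have h : Tendsto (stableExponent α β) (𝓝 0) (𝓝 0) := by
    refine squeeze_zero_norm (norm_stableExponent_le hα0 β) ?_
    have : ContinuousAt (fun u : ℝ => |u| ^ α * ‖stableExponent α β 1‖) 0 :=
      (continuousAt_id.abs.rpow_const (Or.inr hα0.le)).mul continuousAt_const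
    have h := this.tendsto
    simpa [Real.zero_rpow hα0.ne'] using h
  have h2 := (Complex.continuous_exp.tendsto _).comp h
  rw [← stableExponent_zero hα0 β] at h2
  exact h2

/-- Existence half of Lévy's continuity theorem: continuity of the limit at `0` gives tightness,
Prokhorov a convergent subsequence, and its limit has the required characteristic function. -/
lemma exists_charFun_eq_of_tendsto {ν : ℕ → Measure ℝ} [∀ n, IsProbabilityMeasure (ν n)] {f : ℝ → ℂ}
    (hf : ContinuousAt f 0) (h : ∀ t, Tendsto (fun n => charFun (ν n) t) atTop (𝓝 (f t))) :
    ∃ G : Measure ℝ, IsProbabilityMeasure G ∧ ∀ t, charFun G t = f t := by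
  have htight := isTightMeasureSet_of_tendsto_charFun hf h
  set ρ : ℕ → ProbabilityMeasure ℝ := fun n => ⟨ν n, inferInstance⟩
  have hcomp : IsCompact (closure (Set.range ρ)) := by
    refine isCompact_closure_of_isTightMeasureSet ?_
    convert htight using 1
    ext m
    constructor
    · rintro ⟨_, ⟨n, rfl⟩, rfl⟩
      exact ⟨n, rfl⟩
    · rintro ⟨n, rfl⟩
      exact ⟨ρ n, ⟨n, rfl⟩, rfl⟩
  obtain ⟨G, -, φ, hφ, hG⟩ := hcomp.tendsto_subseq fun n => subset_closure (Set.mem_range_self n)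
  refine ⟨G, inferInstance, fun t => ?_⟩
  have h1 := ProbabilityMeasure.tendsto_iff_tendsto_charFun.1 hG t
  exact tendsto_nhds_unique h1 ((h t).comp hφ.tendsto_atTop)

section

variable {μ : Measure ℝ} [IsProbabilityMeasure μ] {α cp cm : ℝ}

/-- The innovations themselves supply the stable law: the sum of `N k` independent copies of `s k *
ξ` has characteristic function `φ(t s) ^ N`, compared with `exp (w(s) E) ^ N` as in the main
argument. -/
lemma exists_stableLaw (hα0 : 0 < α) (hα2 : α ≤ 2) (hDA : InDomainOfAttraction μ α cp cm)
    (hA : ConditionA μ α) :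
    ∃ G : Measure ℝ, IsProbabilityMeasure G ∧ ∀ t, charFun G t = stableCharFun α (cp - cm) t := by
  set s : ℕ → ℝ := fun k => 1 / ((k : ℝ) + 1)
  have hs : Tendsto s atTop (𝓝[>] 0) :=
    tendsto_nhdsWithin_iff.2 ⟨tendsto_one_div_add_atTop_nhds_zero_nat,
      Eventually.of_forall fun k => Set.mem_Ioi.2 Nat.one_div_pos_of_nat⟩
  -- Chosen so that `N k * weight μ α (s k) → 1`, the analogue of the normalization by `B n`.
  set N : ℕ → ℕ := fun k => ⌊1 / weight μ α (s k)⌋₊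
  have hmeas : ∀ k, AEMeasurable (fun x : ℝ => s k * x) μ := fun k => by fun_prop
  have hp : ∀ k, IsProbabilityMeasure (μ.map (fun x => s k * x)) := fun k =>
    Measure.isProbabilityMeasure_map (hmeas k)
  set ν : ℕ → Measure ℝ := fun k =>
    (Measure.pi fun _ : Fin (N k) => μ.map (fun x => s k * x)).map (fun p => ∑ i, p i) with hν
  have hpν : ∀ k, IsProbabilityMeasure (ν k) := fun k =>
    Measure.isProbabilityMeasure_map (by fun_prop)
  have hchar : ∀ k t, charFun (ν k) t = charFun μ (t * s k) ^ N k := fun k t => by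
    simp only [hν]
    rw [charFun_map_sum_pi_eq_prod, Finset.prod_apply, Finset.prod_const, charFun_map_mul, mul_comm]
    simp
  refine exists_charFun_eq_of_tendsto (ν := ν) (continuousAt_stableCharFun_zero hα0 _) fun t => ?_
  have hpos := hs.eventually (eventually_weight_pos hα0 hα2 hDA)
  have hw : Tendsto (fun k => weight μ α (s k)) atTop (𝓝[>] 0) :=
    tendsto_nhdsWithin_iff.2 ⟨(tendsto_weight_zero hα0 hα2 hDA hA).comp hs, hpos⟩
  have hNw : Tendsto (fun k => (N k : ℝ) * weight μ α (s k)) atTop (𝓝 1) := by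
    refine (tendsto_nat_floor_div_atTop.comp (tendsto_inv_nhdsGT_atTop.comp hw)).congr fun k => ?_
    simp [N]
  set E := stableExponent α (cp - cm) t
  have h1 : Tendsto (fun k => Complex.exp (weight μ α (s k) * E) ^ N k) atTop
      (𝓝 (stableCharFun α (cp - cm) t)) := by
    have h := (Complex.continuous_exp.tendsto _).comp
      (((Complex.continuous_ofReal.tendsto _).comp hNw).mul_const E)
    rw [Complex.ofReal_one, one_mul] at h
    refine h.congr fun k => ?_
    simp only [Function.comp]
    rw [← Complex.exp_nat_mul]
    push_cast
    ring_nf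
  refine h1.congr_dist ?_
  rw [Metric.tendsto_nhds]
  intro ε hε
  obtain ⟨δ, hδ, hle⟩ := exists_norm_charFun_sub_exp_le hα0 hα2 hDA hA t (half_pos hε)
  filter_upwards [hpos, hs (Ioc_mem_nhdsGT hδ)] with k hk hk2
  rw [Real.dist_0_eq_abs, abs_of_nonneg dist_nonneg, dist_comm, dist_eq_norm, hchar]
  refine lt_of_le_of_lt ?_ (half_lt_self hε)
  have h2 := norm_prod_sub_prod_le_sum (Finset.range (N k)) (z := fun _ => charFun μ (t * s k))
    (y := fun _ => Complex.exp (weight μ α (s k) * E)) (fun _ => norm_charFun_le_one _)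
    fun _ => norm_cexp_weight_mul_le_one μ hα0 hα2 _ (stableExponent_re_nonpos hα0 hα2 _ _)
  simp only [Finset.prod_const, Finset.sum_const, Finset.card_range, nsmul_eq_mul] at h2
  refine h2.trans ?_
  have h3 : (N k : ℝ) ≤ 1 / weight μ α (s k) := Nat.floor_le (by positivity)
  calc _ ≤ 1 / weight μ α (s k) * (ε / 2 * weight μ α (s k)) := by
        gcongr
        exact hle _ hk2.1 hk2.2
    _ = ε / 2 := by field_simp

end

/-- For `α < 2` symmetry forces `cp = cm`; for `α = 2` the constants are unconstrained but `tan π =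
0`. -/
lemma beta_mul_tau_eq_zero_of_isSymmetric {μ : Measure ℝ} {α cp cm : ℝ} (hα2 : α ≤ 2) (hDA : InDomainOfAttraction μ α cp cm)
    (hsym : IsSymmetric μ) (t : ℝ) : (cp - cm) * tau α t = 0 := by
  rcases hα2.lt_or_eq with h | h
  · have heq : ∀ x : ℝ, μ.real {y | y < -x} = μ.real {y | x < y} := fun x => by
      conv_lhs => rw [← hsym]
      have hm : MeasurableSet {y : ℝ | y < -x} := measurableSet_Iio
      rw [map_measureReal_apply (by fun_prop) hm]
      congr 1
      ext y
      simp
    have h2 := hDA.left_tail h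
    simp_rw [heq] at h2
    rw [tendsto_nhds_unique (hDA.right_tail h) h2, sub_self, zero_mul]
  · rw [tau, if_neg (by linarith), h, show Real.pi * 2 / 2 = Real.pi by ring, Real.tan_pi, mul_zero,
      mul_zero]

lemma stableExponent_neg_of_isSymmetric {μ : Measure ℝ} {α cp cm : ℝ} (hα2 : α ≤ 2) (hDA : InDomainOfAttraction μ α cp cm)
    (hsym : IsSymmetric μ) (t : ℝ) :
    stableExponent α (cp - cm) (-t) = stableExponent α (cp - cm) t := by
  simp [stableExponent, beta_mul_tau_eq_zero_of_isSymmetric hα2 hDA hsym]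

lemma isProbabilityMeasure_mixedLaw (G : Measure ℝ) [IsProbabilityMeasure G] (α c : ℝ) :
    IsProbabilityMeasure (mixedLaw G α c) :=
  Measure.isProbabilityMeasure_map (by fun_prop)

lemma charFun_mixedLaw (G : Measure ℝ) [IsProbabilityMeasure G] (α c t : ℝ) :
    charFun (mixedLaw G α c) t =
      charFun G (c ^ (1 / α) * t) * charFun G ((1 - c) ^ (1 / α) * -t) := by
  have h1 : IsProbabilityMeasure (G.map (fun x => c ^ (1 / α) * x)) :=
    Measure.isProbabilityMeasure_map (by fun_prop)
  have h2 : IsProbabilityMeasure (G.map (fun x => -(1 - c) ^ (1 / α) * x)) :=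
    Measure.isProbabilityMeasure_map (by fun_prop)
  have h : mixedLaw G α c = ((G.map (fun x => c ^ (1 / α) * x)).prod
      (G.map (fun x => -(1 - c) ^ (1 / α) * x))).map (fun p => p.1 + p.2) := by
    rw [Measure.map_prod_map _ _ (by fun_prop) (by fun_prop), Measure.map_map (by fun_prop)
      (by fun_prop), mixedLaw]
    congr 1
    ext p
    simp [Prod.map]
    ring
  rw [h, charFun_map_add_prod_eq_mul, Pi.mul_apply, charFun_map_mul, charFun_map_mul]
  congr 2
  ring

/-- Homogeneity of the exponent turns the scalings `c ^ (1/α)` and `(1 - c) ^ (1/α)` into the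
coefficients `c` and `1 - c`, matching the limits of the positive and negative weights. -/
lemma charFun_mixedLaw_of_stable {G : Measure ℝ} [IsProbabilityMeasure G] {α β c : ℝ} (hα0 : 0 < α)
    (hG : ∀ t, charFun G t = stableCharFun α β t) (hc0 : 0 ≤ c) (hc1 : c ≤ 1) (t : ℝ) :
    charFun (mixedLaw G α c) t =
      Complex.exp (c * stableExponent α β t + (1 - c : ℝ) * stableExponent α β (-t)) := by
  have hc1 : 0 ≤ 1 - c := by linarith
  rw [charFun_mixedLaw, hG, hG, stableCharFun_eq_exp, stableCharFun_eq_exp,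
    stableExponent_mul hα0 _ (by positivity), stableExponent_mul hα0 _ (by positivity),
    ← Real.rpow_mul hc0, ← Real.rpow_mul hc1, one_div_mul_cancel hα0.ne', Real.rpow_one,
    Real.rpow_one, Complex.exp_add]

lemma integrable_charFun_of_norm_le {ν : Measure ℝ} [IsProbabilityMeasure ν] {α : ℝ} (hα0 : 0 < α)
    (hα2 : α ≤ 2) (h : ∀ t, ‖charFun ν t‖ ≤ Real.exp (-stableConst α * |t| ^ α)) :
    Integrable (charFun ν) :=
  (integrable_exp_neg_mul_abs_rpow (stableConst_pos hα0 hα2) hα0).mono'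
    continuous_charFun.aestronglyMeasurable (ae_of_all _ h)

lemma localLimit_of_charFun {Ω : Type*} [MeasurableSpace Ω] {P : Measure Ω} [IsProbabilityMeasure P]
    {S : ℕ → Ω → ℝ} (hS : ∀ n, AEMeasurable (S n) P) {B : ℕ → ℝ} (hB : Tendsto B atTop atTop)
    {ν : Measure ℝ} [IsProbabilityMeasure ν] (hν : Integrable (charFun ν))
    (hlim : ∀ t, Tendsto (fun n => charFun (P.map (S n)) (t / B n)) atTop (𝓝 (charFun ν t)))
    (hdom : ∀ K : ℝ, 0 < K → ∃ g : ℝ → ℝ, Integrable g ∧ ∀ᶠ n in atTop, ∀ t, |t| ≤ K * B n →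
      ‖charFun (P.map (S n)) (t / B n)‖ ≤ g t) :
    LocalLimit P B S ν :=
  ⟨charInv (charFun ν), continuous_charInv hν, charInv_charFun_nonneg ν hν,
    eq_withDensity_charInv ν hν, fun _ hm hs => tendstoUniformly_of_charFun hS hB hν hlim hdom hm hs⟩

end LinearRandomField

/-! ### The local limit theorem -/

theorem mainTheorem2 {Ω : Type*} [MeasurableSpace Ω] (P : Measure Ω) [IsProbabilityMeasure P]
    (d : ℕ) (hd : 0 < d) (α : ℝ) (hα0 : 0 < α) (hα2 : α ≤ 2)
    -- i.i.d. innovations with common law `μ`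
    (ξ : (Fin d → ℤ) → Ω → ℝ) (μ : Measure ℝ)
    (hlaw : ∀ i, HasLaw (ξ i) μ P) (hindep : iIndepFun ξ P)
    (cp cm : ℝ) (hDA : InDomainOfAttraction μ α cp cm)
    (hA : ConditionA μ α) (hnl : IsNonLattice μ)
    -- the coefficients and the linear random field
    (a : (Fin d → ℤ) → ℝ) (hexist : Summable (fun i => weight μ α (a i)))
    (ha : Summable (fun i => |a i|))
    (X : (Fin d → ℤ) → Ω → ℝ) (hX : IsLinearField P a ξ X)
    -- arbitrary finite regions
    (Γ : ℕ → Finset (Fin d → ℤ))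
    (B : ℕ → ℝ) (hB : ∀ n, B n = normalizer μ α (sumCoeff a (Γ n)))
    (hBtop : Tendsto B atTop atTop) :
    ∃ G : Measure ℝ, IsProbabilityMeasure G ∧
      (∀ t : ℝ, charFun G t = stableCharFun α (cp - cm) t) ∧
      (∀ c : ℝ, 0 ≤ c → c ≤ 1 →
        Tendsto (fun n => posWeight μ α (fun i => sumCoeff a (Γ n) i / B n)) atTop (𝓝 c) →
        Tendsto (fun n => negWeight μ α (fun i => sumCoeff a (Γ n) i / B n)) atTop (𝓝 (1 - c)) →
        LocalLimit P B (fun n => partialSum X (Γ n)) (mixedLaw G α c)) ∧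
      ((IsSymmetric μ ∨ ∀ i, 0 ≤ a i) →
        LocalLimit P B (fun n => partialSum X (Γ n)) G) := by
  have hμ : IsProbabilityMeasure μ := by
    rw [← (hlaw 0).map_eq]
    exact Measure.isProbabilityMeasure_map (hlaw 0).aemeasurable
  obtain ⟨G, hGp, hG⟩ := exists_stableLaw hα0 hα2 hDA hA
  have hS : ∀ n, AEMeasurable (partialSum X (Γ n)) P := fun n =>
    hX.aemeasurable_partialSum hd hlaw (Γ n)
  have hdom := fun (K : ℝ) (hK : 0 < K) => exists_integrable_bound_charFun_partialSum hd hα0 hα2 hlaw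
    hindep hDA hA hnl ha hX hB hBtop hK
  refine ⟨G, hGp, hG, fun c hc0 hc1 hpos hneg => ?_, fun h => ?_⟩
  · have hp := isProbabilityMeasure_mixedLaw G α c
    have hchar := charFun_mixedLaw_of_stable hα0 hG hc0 hc1
    refine localLimit_of_charFun hS hBtop (integrable_charFun_of_norm_le hα0 hα2 fun t => ?_)
      (fun t => ?_) hdom
    -- The exponents at `t` and `-t` have the same real part, so the weights `c` and `1 - c` add up
    -- and the modulus is `exp (-c_α |t| ^ α)` for every `c`.
    · rw [hchar, Complex.norm_exp, Complex.add_re, Complex.re_ofReal_mul, Complex.re_ofReal_mul,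
        stableExponent_re, stableExponent_re, abs_neg]
      exact le_of_eq (by ring_nf)
    · rw [hchar]
      refine tendsto_charFun_partialSum hd hα0 hα2 hlaw hindep hDA hA ha hX hB hBtop t ?_
      exact (((Complex.continuous_ofReal.tendsto _).comp hpos).mul_const _).add
        (((Complex.continuous_ofReal.tendsto _).comp hneg).mul_const _)
  · refine localLimit_of_charFun hS hBtop (integrable_charFun_of_norm_le hα0 hα2 fun t => ?_)
      (fun t => ?_) hdom
    · rw [hG, stableCharFun_eq_exp, Complex.norm_exp, stableExponent_re, neg_mul]
    · rw [hG, stableCharFun_eq_exp]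
      refine tendsto_charFun_partialSum hd hα0 hα2 hlaw hindep hDA hA ha hX hB hBtop t ?_
      -- Here the positive and negative weights need not converge separately; only their total does,
      -- and it suffices because either the exponent is even or the negative weight is zero.
      have hlim := ((Complex.continuous_ofReal.tendsto _).comp (tendsto_tsum_weight hα0 hα2 hDA
        (fun n i => abs_sumCoeff_le ha (Γ n) i) hB hBtop)).mul_const (stableExponent α (cp - cm) t)
      rw [Complex.ofReal_one, one_mul] at hlim
      refine hlim.congr' ?_
      filter_upwards [hBtop.eventually_gt_atTop 0] with n hn
      have hs := (summable_weight_div_normalizer hα0 hα2 (μ := μ) (b := sumCoeff a (Γ n))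
        (by rwa [← hB])).1
      rw [← hB] at hs
      simp only [Function.comp]
      rw [← posWeight_add_negWeight μ hα0 hs, Complex.ofReal_add, add_mul]
      rcases h with h | h
      · rw [stableExponent_neg_of_isSymmetric hα2 hDA h]
      · have hc : ∀ i, 0 ≤ sumCoeff a (Γ n) i / B n := fun i =>
          div_nonneg (Finset.sum_nonneg fun j _ => h _) hn.le
        simp [negWeight_eq_zero μ hc]
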